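/- Let $H$ be a complex Hilbert space with an orthonormal basis $(e_i)_{i\in\mathbb Z}$, let $H_+$ be the closed span of the $e_i$ with $i\ge 0$, $H_-=H_+^\perp$, and $\pi_\pm$ the orthogonal projections onto $H_\pm$. Let $\mathrm{Gr}_{\mathrm{res}}$ be the set of closed subspaces $W\subset H$ for which $\pi_+\colon W\to H_+$ is Fredholm and $\pi_-\colon W\to H_-$ is Hilbert–Schmidt. It is a Hilbert manifold, embedded in the space $L^2$ of Hilbert–Schmidt operators by $W\mapsto \pi_W-\pi_+$ ($\pi_W$ the orthogonal projection onto $W$), with base point $H_+$. Let $H'$ be a complex Hilbert space with an orthonormal basis $(e'_i)_{i\in\mathbb N}$ and let $\mathrm U^1$ be the Banach–Lie group of unitary operators $P$ on $H'$ with $P-1$ of trace class, with the topology and smooth structure given by $P\mapsto P-1\in L^1$ (trace norm) and base point $1$. The block sum on both spaces is induced by the unitary $\rho$ from the Hilbert space to two copies of itself with $\rho(e_{2k})=(e_k,0)$, $\rho(e_{2k+1})=(0,e_k)$: $P\boxplus Q=\rho^*(P\oplus Q)\rho$ and $W\boxplus V=\rho^*(W\oplus V)$. These spaces carry the universal Chern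 character forms $$\mathrm{ch}_{\mathrm{even}}=\text{(virtual dimension)}+\sum_{k\ge1}\Big(\frac{i}{2\pi}\Big)^k\frac1{k!}\,\mathrm{tr}\big((\pi_W\,d\pi_W\,d\pi_W)^k\big),\qquad \mathrm{ch}_{\mathrm{odd}}=\sum_{k\ge1}\Big(\frac{i}{2\pi}\Big)^k\frac{(-1)^{k-1}(k-1)!}{(2k-1)!}\,\mathrm{tr}\big((P^{-1}dP)^{2k-1}\big).$$ Two smooth maps $f,g$ from a manifold $M$ to $\mathrm{Gr}_{\mathrm{res}}$ (resp. $\mathrm U^1$) are Chern–Simons homotopic if there is a smooth homotopy $F\colon M\times[0,1]\to\mathrm{Gr}_{\mathrm{res}}$ (resp. $\mathrm U^1$) from $f$ to $g$ whose Chern–Simons form $\int_{[0,1]}F^*\mathrm{ch}_{\mathrm{even}}$ (resp. $\int_{[0,1]}F^*\mathrm{ch}_{\mathrm{odd}}$) is exact; in degree $0$, exact means zero. Let $\hat K^0(M)$ (resp. $\hat K^1(M)$) be the set of smooth maps $M\to\mathrm{Gr}_{\mathrm{res}}$ (resp. $M\to\mathrm U^1$) modulo the equivalence relation generated by Chern–Simons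 homotopy and by $f\sim f\boxplus\mathrm{const}$, where $\mathrm{const}$ is the constant map to the base point. Let $K^0(M)=[M,\mathrm{Gr}_{\mathrm{res}}]$ be the set of homotopy classes of continuous maps. **Proposition.** Let $M=*$ be the point. 1. The block sum induces abelian group structures on $\hat K^0(*)$ and $K^0(*)$. The underlying class map $I\colon\hat K^0(*)\to K^0(*)$, which sends the class of a map to its homotopy class, is well defined and is an isomorphism of groups, and $K^0(*)\cong\mathbb Z$. 2. The block sum induces an abelian group structure on $\hat K^1(*)$, and the Fredholm determinant induces an isomorphism of groups $\hat K^1(*)\cong\mathbb R/\mathbb Z$: there is an isomorphism $D\colon\hat K^1(*)\to\mathbb R/\mathbb Z$ with $\det(P)=e^{2\pi i\,D([P])}$ for every $P\in\mathrm U^1$. -/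

import Mathlib

namespace DiffK

open scoped ContDiff Manifold ENNReal

noncomputable section

section Operators

variable {H : Type*} [NormedAddCommGroup H] [InnerProductSpace ℂ H] [CompleteSpace H]
variable {ι : Type*}

/-- The isometry `H → H` which sends the basis vector `e i` to `e (φ i)`. -/
def basisIsometry (b : HilbertBasis ι ℂ H) (φ : ι → ι) (hφ : Function.Injective φ) : H →ₗᵢ[ℂ] H :=
  ((b.orthonormal.comp φ hφ).orthogonalFamily.linearIsometry).comp b.repr.toLinearIsometry

/-- The bounded operator underlying `basisIsometry`. -/
def basisShift (b : HilbertBasis ι ℂ H) (φ : ι → ι) (hφ : Function.Injective φ) : H →L[ℂ] H :=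
  (basisIsometry b φ hφ).toContinuousLinearMap

theorem basisShift_basis (b : HilbertBasis ι ℂ H) (φ : ι → ι) (hφ : Function.Injective φ) (i : ι) :
    basisShift b φ hφ (b i) = b (φ i) := by
  classical
  simp only [basisShift, basisIsometry, LinearIsometry.coe_toContinuousLinearMap,
    LinearIsometry.coe_comp, LinearIsometryEquiv.coe_toLinearIsometry, Function.comp_apply,
    HilbertBasis.repr_self]
  rw [OrthogonalFamily.linearIsometry_apply_single]
  simp

theorem ext_basis (b : HilbertBasis ι ℂ H) {x y : H} (h : ∀ i, inner ℂ (b i) x = inner ℂ (b i) y) :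
    x = y := by
  apply b.repr.injective
  ext i
  simp [b.repr_apply_apply, h]

theorem basisShift_adjoint_basis_apply (b : HilbertBasis ι ℂ H) (φ : ι → ι)
    (hφ : Function.Injective φ) (i : ι) :
    star (basisShift b φ hφ) (b (φ i)) = b i := by
  classical
  apply ext_basis b
  intro j
  rw [ContinuousLinearMap.star_eq_adjoint, ContinuousLinearMap.adjoint_inner_right,
    basisShift_basis, orthonormal_iff_ite.1 b.orthonormal, orthonormal_iff_ite.1 b.orthonormal]
  simp [hφ.eq_iff]

theorem basisShift_adjoint_basis_of_notMem (b : HilbertBasis ι ℂ H) (φ : ι → ι)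
    (hφ : Function.Injective φ) (j : ι) (hj : j ∉ Set.range φ) :
    star (basisShift b φ hφ) (b j) = 0 := by
  classical
  apply ext_basis b
  intro i
  rw [ContinuousLinearMap.star_eq_adjoint, ContinuousLinearMap.adjoint_inner_right,
    basisShift_basis, orthonormal_iff_ite.1 b.orthonormal, inner_zero_right, if_neg]
  rintro rfl
  exact hj ⟨i, rfl⟩

theorem inner_basis_star_basisShift (b : HilbertBasis ι ℂ H) (φ : ι → ι)
    (hφ : Function.Injective φ) (i : ι) (x : H) :
    inner ℂ (b i) (star (basisShift b φ hφ) x) = inner ℂ (b (φ i)) x := by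
  rw [ContinuousLinearMap.star_eq_adjoint, ContinuousLinearMap.adjoint_inner_right,
    basisShift_basis]

theorem norm_basisShift_apply (b : HilbertBasis ι ℂ H) (φ : ι → ι)
    (hφ : Function.Injective φ) (x : H) : ‖basisShift b φ hφ x‖ = ‖x‖ :=
  (basisIsometry b φ hφ).norm_map x

theorem star_basisShift_mul_self (b : HilbertBasis ι ℂ H) (φ : ι → ι)
    (hφ : Function.Injective φ) : star (basisShift b φ hφ) * basisShift b φ hφ = 1 := by
  ext x
  apply ext_inner_left ℂ
  intro y
  simp only [ContinuousLinearMap.star_eq_adjoint, mul_apply_eq_comp,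
    ContinuousLinearMap.adjoint_inner_right, one_apply_eq_self]
  exact (basisIsometry b φ hφ).inner_map_map y x

theorem norm_star_basisShift_le (b : HilbertBasis ι ℂ H) (φ : ι → ι)
    (hφ : Function.Injective φ) : ‖star (basisShift b φ hφ)‖ ≤ 1 := by
  rw [norm_star]
  exact (basisIsometry b φ hφ).norm_toContinuousLinearMap_le

/-! ### Hilbert-Schmidt operators -/

/-- `T` is Hilbert-Schmidt: `∑ ‖T e_i‖ ^ 2 < ∞`. -/
def IsHilbertSchmidt (b : HilbertBasis ι ℂ H) (T : H →L[ℂ] H) : Prop :=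
  Memℓp (fun i => T (b i)) 2

/-- The Hilbert-Schmidt operators as a linear subspace of the bounded operators. -/
def hsSubmodule (b : HilbertBasis ι ℂ H) : Submodule ℂ (H →L[ℂ] H) where
  carrier := {T | IsHilbertSchmidt b T}
  add_mem' h₁ h₂ := h₁.add h₂
  zero_mem' := zero_memℓp
  smul_mem' c _ h := h.const_smul c

/-- The space `L²` of Hilbert-Schmidt operators (it is given the Hilbert-Schmidt norm below, not
the operator norm). -/
def HSOp (b : HilbertBasis ι ℂ H) : Type _ := ↥(hsSubmodule b)

namespace HSOp

variable (b : HilbertBasis ι ℂ H)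

instance : AddCommGroup (HSOp b) := inferInstanceAs (AddCommGroup ↥(hsSubmodule b))

instance : Module ℂ (HSOp b) := inferInstanceAs (Module ℂ ↥(hsSubmodule b))

/-- The underlying bounded operator. -/
def op : HSOp b →ₗ[ℂ] (H →L[ℂ] H) := (hsSubmodule b).subtype

/-- The square summable family `(T e_i)_i`. -/
def toLp : HSOp b →ₗ[ℂ] lp (fun _ : ι => H) 2 where
  toFun T := ⟨fun i => op b T (b i), T.2⟩
  map_add' _ _ := rfl
  map_smul' _ _ := rfl

theorem toLp_injective : Function.Injective (toLp b) := by
  intro S T h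
  apply Subtype.ext
  have h' : ∀ i, op b S (b i) = op b T (b i) := fun i =>
    congrFun (congrArg (fun f : lp (fun _ : ι => H) 2 => (f : ι → H)) h) i
  refine ContinuousLinearMap.ext_on
    (Submodule.dense_iff_topologicalClosure_eq_top.2 b.dense_span) ?_
  rintro _ ⟨i, rfl⟩
  exact h' i

/-- The Hilbert-Schmidt norm `‖T‖ = (∑ ‖T e_i‖ ^ 2) ^ (1 / 2)`. -/
instance : NormedAddCommGroup (HSOp b) :=
  NormedAddCommGroup.induced (HSOp b) (lp (fun _ : ι => H) 2) (toLp b) (toLp_injective b)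

instance : NormedSpace ℂ (HSOp b) := NormedSpace.induced ℂ (HSOp b) (lp (fun _ : ι => H) 2) (toLp b)

theorem norm_eq (T : HSOp b) : ‖T‖ = ‖toLp b T‖ := rfl

end HSOp

/-! ### Trace class operators -/

/-- Pairs `(Φ, Ψ)` of contractions `ℂⁿ → H`, for all `n`. The operators `Φ ∘ Ψ*` are exactly the
finite rank contractions of `H`. -/
def ContractionPair (H : Type*) [NormedAddCommGroup H] [InnerProductSpace ℂ H] : Type _ :=
  Σ n : ℕ, {p : (EuclideanSpace ℂ (Fin n) →L[ℂ] H) × (EuclideanSpace ℂ (Fin n) →L[ℂ] H) //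
    ‖p.1‖ ≤ 1 ∧ ‖p.2‖ ≤ 1}

/-- The trace of the finite rank operator `T ∘ (Φ ∘ Ψ*)`, that is, of the `n × n` matrix
`Ψ* ∘ T ∘ Φ`. -/
def tracePairing (T : H →L[ℂ] H) (j : ContractionPair H) : ℂ :=
  ∑ i, inner ℂ (j.2.1.2 (EuclideanSpace.single i 1)) (T (j.2.1.1 (EuclideanSpace.single i 1)))

/-- `T` is of trace class: `sup |tr (T K)| < ∞`, where `K` runs through the finite rank
contractions. This supremum is the trace norm `tr |T|`. -/
def IsTraceClass (T : H →L[ℂ] H) : Prop :=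
  Memℓp (tracePairing T) ∞

theorem tracePairing_add (S T : H →L[ℂ] H) :
    tracePairing (S + T) = tracePairing S + tracePairing T := by
  ext j
  simp [tracePairing, Finset.sum_add_distrib]

theorem tracePairing_smul (c : ℂ) (T : H →L[ℂ] H) :
    tracePairing (c • T) = c • tracePairing T := by
  ext j
  simp [tracePairing, Finset.mul_sum]

theorem tracePairing_zero : tracePairing (0 : H →L[ℂ] H) = 0 := by
  ext j
  simp [tracePairing]

variable (H) in
/-- The trace class operators as a linear subspace of the bounded operators. -/
def traceClassSubmodule : Submodule ℂ (H →L[ℂ] H) where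
  carrier := {T | IsTraceClass T}
  add_mem' {S T} h₁ h₂ := by
    change Memℓp (tracePairing (S + T)) ∞
    rw [tracePairing_add]
    exact Memℓp.add (f := tracePairing S) (g := tracePairing T) h₁ h₂
  zero_mem' := by
    change Memℓp (tracePairing 0) ∞
    rw [tracePairing_zero]
    exact zero_memℓp
  smul_mem' c T h := by
    change Memℓp (tracePairing (c • T)) ∞
    rw [tracePairing_smul]
    exact (show Memℓp (tracePairing T) ∞ from h).const_smul c

variable (H) in
/-- The space `L¹` of trace class operators (it is given the trace norm below, not the operator
norm). -/
def TraceClassOp : Type _ := ↥(traceClassSubmodule H)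

namespace TraceClassOp

instance : AddCommGroup (TraceClassOp H) := inferInstanceAs (AddCommGroup ↥(traceClassSubmodule H))

instance : Module ℂ (TraceClassOp H) := inferInstanceAs (Module ℂ ↥(traceClassSubmodule H))

variable (H) in
/-- The underlying bounded operator. -/
def op : TraceClassOp H →ₗ[ℂ] (H →L[ℂ] H) := (traceClassSubmodule H).subtype

variable (H) in
/-- The bounded family `(tr (T K))_K`. -/
def toLp : TraceClassOp H →ₗ[ℂ] lp (fun _ : ContractionPair H => ℂ) ∞ where
  toFun T := ⟨tracePairing (op H T), T.2⟩
  map_add' _ _ := Subtype.ext (tracePairing_add _ _)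
  map_smul' _ _ := Subtype.ext (tracePairing_smul _ _)

variable (H) in
theorem toLp_injective : Function.Injective (toLp H) := by
  rw [injective_iff_map_eq_zero]
  intro T hT
  have key : ∀ j, tracePairing (op H T) j = 0 := fun j =>
    congrFun (congrArg (fun f : lp (fun _ : ContractionPair H => ℂ) ∞ =>
      (f : ContractionPair H → ℂ)) hT) j
  have unit : ∀ x y : H, ‖x‖ ≤ 1 → ‖y‖ ≤ 1 → inner ℂ y (op H T x) = 0 := by
    intro x y hx hy
    let Φ : H → (EuclideanSpace ℂ (Fin 1) →L[ℂ] H) := fun z =>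
      (EuclideanSpace.proj (0 : Fin 1) : EuclideanSpace ℂ (Fin 1) →L[ℂ] ℂ).smulRight z
    have hΦ : ∀ z : H, ‖z‖ ≤ 1 → ‖Φ z‖ ≤ 1 := by
      intro z hz
      refine ContinuousLinearMap.opNorm_le_bound _ zero_le_one fun v => ?_
      have h1 : ‖v 0‖ ≤ ‖v‖ := PiLp.norm_apply_le v 0
      have : ‖Φ z v‖ = ‖v 0‖ * ‖z‖ := by simp [Φ, norm_smul]
      rw [this, one_mul]
      calc ‖v 0‖ * ‖z‖ ≤ ‖v‖ * 1 := by gcongr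
        _ = ‖v‖ := mul_one _
    have := key ⟨1, ⟨(Φ x, Φ y), hΦ x hx, hΦ y hy⟩⟩
    simpa [tracePairing, Φ] using this
  apply Subtype.ext
  ext x
  apply ext_inner_left ℂ
  intro y
  change inner ℂ y (op H T x) = inner ℂ y (0 : H)
  rw [inner_zero_right]
  have hb : ∀ z : H, ‖((‖z‖ + 1 : ℝ) : ℂ)⁻¹ • z‖ ≤ 1 := by
    intro z
    rw [norm_smul, norm_inv, Complex.norm_real, Real.norm_of_nonneg (by positivity),
      inv_mul_le_one₀ (by positivity)]
    linarith
  have hne : ∀ z : H, ((‖z‖ + 1 : ℝ) : ℂ) ≠ 0 := by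
    intro z
    exact_mod_cast (by positivity : (‖z‖ + 1 : ℝ) ≠ 0)
  have := unit _ _ (hb x) (hb y)
  rw [map_smul, inner_smul_left, inner_smul_right] at this
  have hx := hne x
  have hy := hne y
  simpa only [mul_eq_zero, map_eq_zero, inv_eq_zero, hx, hy, false_or] using this

/-- The trace norm `‖T‖ = sup |tr (T K)| = tr |T|`. -/
instance : NormedAddCommGroup (TraceClassOp H) :=
  NormedAddCommGroup.induced (TraceClassOp H) (lp (fun _ : ContractionPair H => ℂ) ∞) (toLp H)
    (toLp_injective H)

instance : NormedSpace ℂ (TraceClassOp H) :=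
  NormedSpace.induced ℂ (TraceClassOp H) (lp (fun _ : ContractionPair H => ℂ) ∞) (toLp H)

theorem norm_eq (T : TraceClassOp H) : ‖T‖ = ‖toLp H T‖ := rfl

end TraceClassOp

/-- The trace `∑ ⟨e_i, T e_i⟩` of an operator. -/
def opTrace (b : HilbertBasis ι ℂ H) (T : H →L[ℂ] H) : ℂ :=
  ∑' i, inner ℂ (b i) (T (b i))

open scoped Classical in
/-- `z` is the Fredholm determinant of `P = 1 + A`, `A` of trace class: the limit of the
determinants of the finite sections `(⟨e_i, P e_j⟩)`, `i, j ∈ s`, over the finite subsets `s` of the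
orthonormal basis. -/
def IsFredholmDet (b : HilbertBasis ι ℂ H) (P : H →L[ℂ] H) (z : ℂ) : Prop :=
  Filter.Tendsto
    (fun s : Finset ι => Matrix.det (Matrix.of fun i j : s => inner ℂ (b i) (P (b j))))
    Filter.atTop (nhds z)

/-! ### The block sum of operators -/

/-- A partition of the index set `ι` into two copies of itself. -/
structure Splitting (ι : Type*) where
  even : ι → ι
  odd : ι → ι
  even_inj : Function.Injective even
  odd_inj : Function.Injective odd
  even_ne_odd : ∀ i j, even i ≠ odd j
  mem_or : ∀ k, k ∈ Set.range even ∨ k ∈ Set.range odd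

/-- The splitting `k ↦ 2 k`, `k ↦ 2 k + 1` of the natural numbers. -/
def natSplitting : Splitting ℕ where
  even k := 2 * k
  odd k := 2 * k + 1
  even_inj i j h := by simp only at h; omega
  odd_inj i j h := by simp only at h; omega
  even_ne_odd i j := by omega
  mem_or k := by
    rcases Nat.even_or_odd' k with ⟨c, h | h⟩
    · exact Or.inl ⟨c, h.symm⟩
    · exact Or.inr ⟨c, h.symm⟩

/-- The splitting `k ↦ 2 k`, `k ↦ 2 k + 1` of the integers. -/
def intSplitting : Splitting ℤ where
  even k := 2 * k
  odd k := 2 * k + 1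
  even_inj i j h := by simp only at h; omega
  odd_inj i j h := by simp only at h; omega
  even_ne_odd i j := by omega
  mem_or k := by
    rcases Int.even_or_odd' k with ⟨c, h | h⟩
    · exact Or.inl ⟨c, h.symm⟩
    · exact Or.inr ⟨c, h.symm⟩

/-- The first component `V₀*` of the unitary `ρ = (V₀*, V₁*) : H → H ⊕ H`, with
`ρ e_{2k} = (e_k, 0)` and `ρ e_{2k+1} = (0, e_k)`. -/
def rho₀ (s : Splitting ι) (b : HilbertBasis ι ℂ H) : H →L[ℂ] H :=
  star (basisShift b s.even s.even_inj)

/-- The second component `V₁*` of the unitary `ρ = (V₀*, V₁*) : H → H ⊕ H`. -/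
def rho₁ (s : Splitting ι) (b : HilbertBasis ι ℂ H) : H →L[ℂ] H :=
  star (basisShift b s.odd s.odd_inj)

/-- The block sum `A ⊞ B = ρ* (A ⊕ B) ρ`. -/
def blockSum (s : Splitting ι) (b : HilbertBasis ι ℂ H) (A B : H →L[ℂ] H) : H →L[ℂ] H :=
  star (rho₀ s b) * A * rho₀ s b + star (rho₁ s b) * B * rho₁ s b

section BlockSum

variable (s : Splitting ι) (b : HilbertBasis ι ℂ H)

theorem rho₀_mul_star : rho₀ s b * star (rho₀ s b) = 1 := by
  rw [rho₀, star_star, star_basisShift_mul_self]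

theorem rho₁_mul_star : rho₁ s b * star (rho₁ s b) = 1 := by
  rw [rho₁, star_star, star_basisShift_mul_self]

theorem op_ext {S T : H →L[ℂ] H} (h : ∀ i, S (b i) = T (b i)) : S = T := by
  refine ContinuousLinearMap.ext_on
    (Submodule.dense_iff_topologicalClosure_eq_top.2 b.dense_span) ?_
  rintro _ ⟨i, rfl⟩
  exact h i

theorem rho₀_even (i : ι) : rho₀ s b (b (s.even i)) = b i :=
  basisShift_adjoint_basis_apply _ _ _ _

theorem rho₁_odd (i : ι) : rho₁ s b (b (s.odd i)) = b i :=
  basisShift_adjoint_basis_apply _ _ _ _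

theorem rho₀_odd (i : ι) : rho₀ s b (b (s.odd i)) = 0 := by
  apply basisShift_adjoint_basis_of_notMem
  rintro ⟨j, hj⟩
  exact s.even_ne_odd _ _ hj

theorem rho₁_even (i : ι) : rho₁ s b (b (s.even i)) = 0 := by
  apply basisShift_adjoint_basis_of_notMem
  rintro ⟨j, hj⟩
  exact s.even_ne_odd _ _ hj.symm

theorem star_rho₀_basis (i : ι) : star (rho₀ s b) (b i) = b (s.even i) := by
  rw [rho₀, star_star, basisShift_basis]

theorem star_rho₁_basis (i : ι) : star (rho₁ s b) (b i) = b (s.odd i) := by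
  rw [rho₁, star_star, basisShift_basis]

theorem rho₀_mul_star_rho₁ : rho₀ s b * star (rho₁ s b) = 0 := by
  apply op_ext b
  intro i
  rw [mul_apply_eq_comp, star_rho₁_basis, rho₀_odd]
  rfl

theorem rho₁_mul_star_rho₀ : rho₁ s b * star (rho₀ s b) = 0 := by
  apply op_ext b
  intro i
  rw [mul_apply_eq_comp, star_rho₀_basis, rho₁_even]
  rfl

theorem star_rho_mul_add : star (rho₀ s b) * rho₀ s b + star (rho₁ s b) * rho₁ s b = 1 := by
  apply op_ext b
  intro i
  rw [add_apply, mul_apply_eq_comp, mul_apply_eq_comp]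
  rcases s.mem_or i with ⟨k, rfl⟩ | ⟨k, rfl⟩
  · rw [rho₀_even, rho₁_even, star_rho₀_basis, map_zero, add_zero]
    rfl
  · rw [rho₀_odd, rho₁_odd, star_rho₁_basis, map_zero, zero_add]
    rfl

theorem norm_rho₀_le : ‖rho₀ s b‖ ≤ 1 := norm_star_basisShift_le _ _ _

theorem norm_rho₁_le : ‖rho₁ s b‖ ≤ 1 := norm_star_basisShift_le _ _ _

theorem blockSum_add (A A' B B' : H →L[ℂ] H) :
    blockSum s b (A + A') (B + B') = blockSum s b A B + blockSum s b A' B' := by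
  simp only [blockSum]
  noncomm_ring

theorem blockSum_sub (A A' B B' : H →L[ℂ] H) :
    blockSum s b (A - A') (B - B') = blockSum s b A B - blockSum s b A' B' := by
  simp only [blockSum]
  noncomm_ring

theorem blockSum_one : blockSum s b 1 1 = 1 := by
  simp only [blockSum, mul_one]
  exact star_rho_mul_add s b

theorem blockSum_mul (A A' B B' : H →L[ℂ] H) :
    blockSum s b A B * blockSum s b A' B' = blockSum s b (A * A') (B * B') := by
  have h00 := rho₀_mul_star s b
  have h11 := rho₁_mul_star s b
  have h01 := rho₀_mul_star_rho₁ s b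
  have h10 := rho₁_mul_star_rho₀ s b
  simp only [blockSum]
  generalize rho₀ s b = R at *
  generalize rho₁ s b = S at *
  generalize hR : star R = R' at *
  generalize hS : star S = S' at *
  have e1 : R' * A * R * (R' * A' * R) = R' * A * (R * R') * A' * R := by noncomm_ring
  have e2 : R' * A * R * (S' * B' * S) = R' * A * (R * S') * B' * S := by noncomm_ring
  have e3 : S' * B * S * (R' * A' * R) = S' * B * (S * R') * A' * R := by noncomm_ring
  have e4 : S' * B * S * (S' * B' * S) = S' * B * (S * S') * B' * S := by noncomm_ring
  rw [add_mul, mul_add, mul_add, e1, e2, e3, e4, h00, h01, h10, h11]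
  noncomm_ring

theorem blockSum_star (A B : H →L[ℂ] H) :
    star (blockSum s b A B) = blockSum s b (star A) (star B) := by
  simp only [blockSum, star_add, star_mul, star_star, mul_assoc]

/-- Conjugation `D ↦ R* D R` of a Hilbert-Schmidt operator by a component `R` of `ρ`. -/
theorem hs_conj (φ : ι → ι) (hφ : Function.Injective φ) (D : H →L[ℂ] H)
    (hD : IsHilbertSchmidt b D) :
    HasSum (fun i => ‖(basisShift b φ hφ * D * star (basisShift b φ hφ)) (b i)‖ ^ (2 : ℝ))
      (∑' i, ‖D (b i)‖ ^ (2 : ℝ)) := by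
  have h2 : (0 : ℝ) < (2 : ℝ≥0∞).toReal := by simp
  have hs : Summable fun i => ‖D (b i)‖ ^ (2 : ℝ) := by
    simpa using hD.summable h2
  have := hs.hasSum
  rw [← hφ.hasSum_iff]
  · convert this using 2 with i
    simp only [Function.comp_apply, mul_apply_eq_comp, basisShift_adjoint_basis_apply,
      norm_basisShift_apply]
  · intro i hi
    simp [mul_apply_eq_comp, basisShift_adjoint_basis_of_notMem b φ hφ i hi]

theorem isHilbertSchmidt_conj (φ : ι → ι) (hφ : Function.Injective φ) (D : H →L[ℂ] H)
    (hD : IsHilbertSchmidt b D) :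
    IsHilbertSchmidt b (basisShift b φ hφ * D * star (basisShift b φ hφ)) := by
  apply memℓp_gen
  simpa using (hs_conj b φ hφ D hD).summable

theorem isHilbertSchmidt_blockSum (A B : H →L[ℂ] H) (hA : IsHilbertSchmidt b A)
    (hB : IsHilbertSchmidt b B) : IsHilbertSchmidt b (blockSum s b A B) := by
  simp only [blockSum, rho₀, rho₁, star_star]
  exact (hsSubmodule b).add_mem (isHilbertSchmidt_conj b _ _ A hA)
    (isHilbertSchmidt_conj b _ _ B hB)

/-- Conjugation by an index shift on Hilbert-Schmidt operators. -/
def hsConj (φ : ι → ι) (hφ : Function.Injective φ) : HSOp b →L[ℂ] HSOp b :=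
  LinearMap.mkContinuous
    { toFun D := ⟨_, isHilbertSchmidt_conj b φ hφ (HSOp.op b D) D.2⟩
      map_add' S T := by
        apply Subtype.ext
        change basisShift b φ hφ * (HSOp.op b (S + T)) * star (basisShift b φ hφ) =
          basisShift b φ hφ * (HSOp.op b S) * star (basisShift b φ hφ) +
          basisShift b φ hφ * (HSOp.op b T) * star (basisShift b φ hφ)
        rw [map_add, mul_add, add_mul]
      map_smul' c T := by
        apply Subtype.ext
        change basisShift b φ hφ * (HSOp.op b (c • T)) * star (basisShift b φ hφ) =
          c • (basisShift b φ hφ * (HSOp.op b T) * star (basisShift b φ hφ))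
        rw [map_smul, mul_smul_comm, smul_mul_assoc] }
    1 (by
      intro D
      rw [one_mul]
      have h2 : (0 : ℝ) < (2 : ℝ≥0∞).toReal := by simp
      rw [HSOp.norm_eq, HSOp.norm_eq, lp.norm_eq_tsum_rpow h2, lp.norm_eq_tsum_rpow h2]
      have := (hs_conj b φ hφ (HSOp.op b D) D.2).tsum_eq
      apply le_of_eq
      congr 1)

/-- The block sum as a bounded operator on pairs of Hilbert-Schmidt operators. -/
def hsBlockSum : (HSOp b × HSOp b) →L[ℂ] HSOp b :=
  (hsConj b s.even s.even_inj).coprod (hsConj b s.odd s.odd_inj)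

theorem op_hsBlockSum (S T : HSOp b) :
    HSOp.op b (hsBlockSum s b (S, T)) = blockSum s b (HSOp.op b S) (HSOp.op b T) := by
  simp only [blockSum, rho₀, rho₁, star_star]
  rfl

theorem tracePairing_conj (V : H →L[ℂ] H) (hV : ‖star V‖ ≤ 1) (T : H →L[ℂ] H)
    (j : ContractionPair H) :
    ∃ j', tracePairing (V * T * star V) j = tracePairing T j' := by
  obtain ⟨n, ⟨⟨Φ, Ψ⟩, hΦ, hΨ⟩⟩ := j
  have h : ∀ Θ : EuclideanSpace ℂ (Fin n) →L[ℂ] H, ‖Θ‖ ≤ 1 → ‖star V ∘L Θ‖ ≤ 1 := by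
    intro Θ hΘ
    calc ‖star V ∘L Θ‖ ≤ ‖star V‖ * ‖Θ‖ := ContinuousLinearMap.opNorm_comp_le _ _
      _ ≤ 1 * 1 := by gcongr
      _ = 1 := one_mul 1
  refine ⟨⟨n, ⟨(star V ∘L Φ, star V ∘L Ψ), h Φ hΦ, h Ψ hΨ⟩⟩, ?_⟩
  simp only [tracePairing, mul_apply_eq_comp, ContinuousLinearMap.comp_apply,
    ContinuousLinearMap.star_eq_adjoint, ContinuousLinearMap.adjoint_inner_left]

theorem isTraceClass_conj (V : H →L[ℂ] H) (hV : ‖star V‖ ≤ 1) (T : H →L[ℂ] H)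
    (hT : IsTraceClass T) : IsTraceClass (V * T * star V) := by
  apply memℓp_infty
  obtain ⟨C, hC⟩ := hT.bddAbove
  refine ⟨C, ?_⟩
  rintro _ ⟨j, rfl⟩
  obtain ⟨j', hj'⟩ := tracePairing_conj V hV T j
  simp only [hj']
  exact hC ⟨j', rfl⟩

theorem isTraceClass_blockSum (A B : H →L[ℂ] H) (hA : IsTraceClass A)
    (hB : IsTraceClass B) : IsTraceClass (blockSum s b A B) := by
  have h0 := isTraceClass_conj (star (rho₀ s b)) (by rw [star_star]; exact norm_rho₀_le s b) A hA
  have h1 := isTraceClass_conj (star (rho₁ s b)) (by rw [star_star]; exact norm_rho₁_le s b) B hB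
  rw [star_star] at h0 h1
  exact (traceClassSubmodule H).add_mem h0 h1

/-- Conjugation by a contraction on trace class operators. -/
def traceConj (V : H →L[ℂ] H) (hV : ‖star V‖ ≤ 1) : TraceClassOp H →L[ℂ] TraceClassOp H :=
  LinearMap.mkContinuous
    { toFun D := ⟨_, isTraceClass_conj V hV (TraceClassOp.op H D) D.2⟩
      map_add' S T := by
        apply Subtype.ext
        change V * (TraceClassOp.op H (S + T)) * star V =
          V * (TraceClassOp.op H S) * star V + V * (TraceClassOp.op H T) * star V
        rw [map_add, mul_add, add_mul]
      map_smul' c T := by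
        apply Subtype.ext
        change V * (TraceClassOp.op H (c • T)) * star V = c • (V * (TraceClassOp.op H T) * star V)
        rw [map_smul, mul_smul_comm, smul_mul_assoc] }
    1 (by
      intro D
      rw [one_mul, TraceClassOp.norm_eq, TraceClassOp.norm_eq]
      refine lp.norm_le_of_forall_le (norm_nonneg _) fun j => ?_
      obtain ⟨j', hj'⟩ := tracePairing_conj V hV (TraceClassOp.op H D) j
      change ‖tracePairing (V * (TraceClassOp.op H D) * star V) j‖ ≤ _
      rw [hj']
      exact lp.norm_apply_le_norm (by simp) (TraceClassOp.toLp H D) j')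

/-- The block sum as a bounded operator on pairs of trace class operators. -/
def traceBlockSum : (TraceClassOp H × TraceClassOp H) →L[ℂ] TraceClassOp H :=
  (traceConj (basisShift b s.even s.even_inj) (norm_star_basisShift_le _ _ _)).coprod
    (traceConj (basisShift b s.odd s.odd_inj) (norm_star_basisShift_le _ _ _))

theorem op_traceBlockSum (S T : TraceClassOp H) :
    TraceClassOp.op H (traceBlockSum s b (S, T)) =
      blockSum s b (TraceClassOp.op H S) (TraceClassOp.op H T) := by
  simp only [blockSum, rho₀, rho₁, star_star]
  rfl

end BlockSum

end Operators

/-! ### The group `U¹` -/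

section UnitaryGroup

variable (H : Type*) [NormedAddCommGroup H] [InnerProductSpace ℂ H] [CompleteSpace H]

/-- The group `U¹` of unitary operators `P` with `P - 1` of trace class. -/
structure U1 where
  op : H →L[ℂ] H
  unitary : op ∈ unitary (H →L[ℂ] H)
  traceClass : IsTraceClass (op - 1)

variable {H}

/-- The inclusion `P ↦ P - 1` of `U¹` into `L¹`, which defines the topology and the smooth structure
of `U¹`. -/
def U1.emb (P : U1 H) : TraceClassOp H := ⟨P.op - 1, P.traceClass⟩

variable (H) in
/-- The base point of `U¹`. -/
def U1.base : U1 H where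
  op := 1
  unitary := one_mem _
  traceClass := by rw [sub_self]; exact (traceClassSubmodule H).zero_mem

/-- The block sum on `U¹`. -/
def U1.blockSum (b : HilbertBasis ℕ ℂ H) (P Q : U1 H) : U1 H where
  op := DiffK.blockSum natSplitting b P.op Q.op
  unitary := by
    have hP := Unitary.mem_iff.1 P.unitary
    have hQ := Unitary.mem_iff.1 Q.unitary
    rw [Unitary.mem_iff, blockSum_star, blockSum_mul, blockSum_mul, hP.1, hP.2, hQ.1, hQ.2,
      blockSum_one]
    exact ⟨rfl, rfl⟩
  traceClass := by
    rw [← blockSum_one natSplitting b, ← blockSum_sub]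
    exact isTraceClass_blockSum _ _ _ _ P.traceClass Q.traceClass

theorem U1.emb_blockSum (b : HilbertBasis ℕ ℂ H) (P Q : U1 H) :
    (U1.blockSum b P Q).emb = traceBlockSum natSplitting b (P.emb, Q.emb) := by
  apply Subtype.ext
  change DiffK.blockSum natSplitting b P.op Q.op - 1 =
    TraceClassOp.op H (traceBlockSum natSplitting b (P.emb, Q.emb))
  rw [op_traceBlockSum]
  change _ = DiffK.blockSum natSplitting b (P.op - 1) (Q.op - 1)
  rw [blockSum_sub, blockSum_one]

end UnitaryGroup

/-! ### The restricted Grassmannian -/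

section Grassmannian

variable {H : Type*} [NormedAddCommGroup H] [InnerProductSpace ℂ H] [CompleteSpace H]

/-- `H₊`, the closed span of the basis vectors `e_i` with `0 ≤ i`. -/
def Hplus (b : HilbertBasis ℤ ℂ H) : Submodule ℂ H :=
  (Submodule.span ℂ (b '' {i | 0 ≤ i})).topologicalClosure

theorem isClosed_Hplus (b : HilbertBasis ℤ ℂ H) : IsClosed (Hplus b : Set H) :=
  Submodule.isClosed_topologicalClosure _

/-- The orthogonal projection of `H` onto a closed subspace `W`, as an operator on `H`. -/
def orthProj (W : Submodule ℂ H) (hW : IsClosed (W : Set H)) : H →L[ℂ] H :=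
  haveI : CompleteSpace W := hW.completeSpace_coe
  W.starProjection

/-- The orthogonal projection `π₊` onto `H₊`. -/
def piPlus (b : HilbertBasis ℤ ℂ H) : H →L[ℂ] H := orthProj (Hplus b) (isClosed_Hplus b)

/-- The orthogonal projection `π₋` onto `H₋`, the orthogonal complement of `H₊`. -/
def piMinus (b : HilbertBasis ℤ ℂ H) : H →L[ℂ] H := 1 - piPlus b

theorem orthProj_mem (W : Submodule ℂ H) (hW : IsClosed (W : Set H)) (x : H) :
    orthProj W hW x ∈ W := by
  have : CompleteSpace W := hW.completeSpace_coe
  exact W.starProjection_apply_mem x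

/-- The map `π₊ : W → H₊`. -/
def plusMap (b : HilbertBasis ℤ ℂ H) (W : Submodule ℂ H) : W →ₗ[ℂ] Hplus b :=
  ((piPlus b).toLinearMap.comp W.subtype).codRestrict (Hplus b)
    (fun x => orthProj_mem (Hplus b) (isClosed_Hplus b) x)

/-- A linear map (below: a bounded operator between Hilbert spaces) with finite-dimensional kernel
and cokernel; its range is then automatically closed. -/
def IsFredholm {V V' : Type*} [AddCommGroup V] [Module ℂ V] [AddCommGroup V'] [Module ℂ V']
    (T : V →ₗ[ℂ] V') : Prop :=
  FiniteDimensional ℂ (LinearMap.ker T) ∧ FiniteDimensional ℂ (V' ⧸ LinearMap.range T)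

/-- The restricted Grassmannian: the closed subspaces `W` of `H` such that `π₊ : W → H₊` is a
Fredholm operator and `π₋ : W → H₋` is a Hilbert-Schmidt operator. (An operator on `W` is
Hilbert-Schmidt if and only if its extension by zero on the orthogonal complement of `W` is.) -/
structure GrRes (b : HilbertBasis ℤ ℂ H) where
  carrier : Submodule ℂ H
  closed : IsClosed (carrier : Set H)
  fredholm : IsFredholm (plusMap b carrier)
  hilbertSchmidt : IsHilbertSchmidt b (piMinus b * orthProj carrier closed)

section Projections

variable (W : Submodule ℂ H) (hW : IsClosed (W : Set H))

theorem orthProj_eq_self {x : H} (hx : x ∈ W) : orthProj W hW x = x := by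
  have : CompleteSpace W := hW.completeSpace_coe
  exact Submodule.starProjection_eq_self_iff.2 hx

theorem orthProj_isSelfAdjoint : IsSelfAdjoint (orthProj W hW) := by
  have : CompleteSpace W := hW.completeSpace_coe
  exact isSelfAdjoint_starProjection W

theorem orthProj_inner (x y : H) :
    inner ℂ (orthProj W hW x) y = inner ℂ x (orthProj W hW y) := by
  have h := orthProj_isSelfAdjoint W hW
  rw [← ContinuousLinearMap.adjoint_inner_left, ← ContinuousLinearMap.star_eq_adjoint, h.star_eq]

theorem orthProj_mul_self : orthProj W hW * orthProj W hW = orthProj W hW := by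
  ext x
  rw [mul_apply_eq_comp, orthProj_eq_self W hW (orthProj_mem W hW x)]

theorem orthProj_unique (x y : H) (hy : y ∈ W) (h : ∀ w ∈ W, inner ℂ (x - y) w = 0) :
    orthProj W hW x = y := by
  have : CompleteSpace W := hW.completeSpace_coe
  exact Submodule.eq_starProjection_of_mem_of_inner_eq_zero hy h

theorem inner_sub_orthProj (x w : H) (hw : w ∈ W) : inner ℂ (x - orthProj W hW x) w = 0 := by
  have : CompleteSpace W := hW.completeSpace_coe
  exact Submodule.starProjection_inner_eq_zero x w hw

theorem norm_orthProj_le (x : H) : ‖orthProj W hW x‖ ≤ ‖x‖ := by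
  have : CompleteSpace W := hW.completeSpace_coe
  exact W.norm_starProjection_apply_le x

end Projections

section Plus

variable (b : HilbertBasis ℤ ℂ H)

theorem basis_mem_Hplus {i : ℤ} (hi : 0 ≤ i) : b i ∈ Hplus b :=
  Submodule.le_topologicalClosure _ (Submodule.subset_span ⟨i, hi, rfl⟩)

theorem inner_basis_Hplus {i : ℤ} (hi : ¬ 0 ≤ i) {x : H} (hx : x ∈ Hplus b) :
    inner ℂ (b i) x = 0 := by
  have hle : Hplus b ≤ (Submodule.span ℂ {b i})ᗮ := by
    refine Submodule.topologicalClosure_minimal _ ?_ (Submodule.isClosed_orthogonal _)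
    rw [Submodule.span_le]
    rintro _ ⟨j, hj, rfl⟩
    rw [SetLike.mem_coe, Submodule.mem_orthogonal_singleton_iff_inner_right]
    apply b.orthonormal.2
    rintro rfl
    exact hi hj
  exact Submodule.mem_orthogonal_singleton_iff_inner_right.1 (hle hx)

theorem piPlus_basis_of_nonneg {i : ℤ} (hi : 0 ≤ i) : piPlus b (b i) = b i :=
  orthProj_eq_self _ _ (basis_mem_Hplus b hi)

theorem piPlus_basis_of_neg {i : ℤ} (hi : ¬ 0 ≤ i) : piPlus b (b i) = 0 := by
  apply orthProj_unique _ _ _ _ (Submodule.zero_mem _)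
  intro w hw
  rw [sub_zero]
  exact inner_basis_Hplus b hi hw

theorem piPlus_comm_rho₀ : piPlus b * rho₀ intSplitting b = rho₀ intSplitting b * piPlus b := by
  apply op_ext b
  intro i
  simp only [mul_apply_eq_comp]
  rcases intSplitting.mem_or i with ⟨k, rfl⟩ | ⟨k, rfl⟩
  · rw [rho₀_even]
    by_cases hk : 0 ≤ k
    · rw [piPlus_basis_of_nonneg b hk, piPlus_basis_of_nonneg b, rho₀_even]
      change 0 ≤ 2 * k
      omega
    · rw [piPlus_basis_of_neg b hk, piPlus_basis_of_neg b, map_zero]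
      change ¬ 0 ≤ 2 * k
      omega
  · rw [rho₀_odd]
    by_cases hk : 0 ≤ k
    · rw [map_zero, piPlus_basis_of_nonneg b, rho₀_odd]
      change 0 ≤ 2 * k + 1
      omega
    · rw [map_zero, piPlus_basis_of_neg b, map_zero]
      change ¬ 0 ≤ 2 * k + 1
      omega

theorem piPlus_comm_rho₁ : piPlus b * rho₁ intSplitting b = rho₁ intSplitting b * piPlus b := by
  apply op_ext b
  intro i
  simp only [mul_apply_eq_comp]
  rcases intSplitting.mem_or i with ⟨k, rfl⟩ | ⟨k, rfl⟩
  · rw [rho₁_even]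
    by_cases hk : 0 ≤ k
    · rw [map_zero, piPlus_basis_of_nonneg b, rho₁_even]
      change 0 ≤ 2 * k
      omega
    · rw [map_zero, piPlus_basis_of_neg b, map_zero]
      change ¬ 0 ≤ 2 * k
      omega
  · rw [rho₁_odd]
    by_cases hk : 0 ≤ k
    · rw [piPlus_basis_of_nonneg b hk, piPlus_basis_of_nonneg b, rho₁_odd]
      change 0 ≤ 2 * k + 1
      omega
    · rw [piPlus_basis_of_neg b hk, piPlus_basis_of_neg b, map_zero]
      change ¬ 0 ≤ 2 * k + 1
      omega

theorem piPlus_isSelfAdjoint : IsSelfAdjoint (piPlus b) := orthProj_isSelfAdjoint _ _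

theorem blockSum_piPlus : blockSum intSplitting b (piPlus b) (piPlus b) = piPlus b := by
  simp only [blockSum]
  rw [mul_assoc, mul_assoc, piPlus_comm_rho₀, piPlus_comm_rho₁, ← mul_assoc, ← mul_assoc,
    ← add_mul, star_rho_mul_add, one_mul]

theorem blockSum_piMinus : blockSum intSplitting b (piMinus b) (piMinus b) = piMinus b := by
  rw [piMinus, blockSum_sub, blockSum_one, blockSum_piPlus]

end Plus

section Difference

variable (b : HilbertBasis ℤ ℂ H)

theorem hasSum_norm_sq (x : H) : HasSum (fun i => ‖inner ℂ (b i) x‖ ^ 2) (‖x‖ ^ 2) := by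
  have h2 : (0 : ℝ) < (2 : ℝ≥0∞).toReal := by simp
  have := lp.hasSum_norm h2 (b.repr x)
  simpa [b.repr_apply_apply] using this

theorem isHilbertSchmidt_iff (T : H →L[ℂ] H) :
    IsHilbertSchmidt b T ↔ Summable fun i => ‖T (b i)‖ ^ 2 := by
  have h2 : (0 : ℝ) < (2 : ℝ≥0∞).toReal := by simp
  rw [IsHilbertSchmidt, memℓp_gen_iff h2]
  simp

theorem summable_swap (a : ℤ × ℤ → ℝ) (ha : 0 ≤ a) (h1 : ∀ i, Summable fun j => a (i, j))
    (h2 : Summable fun i => ∑' j, a (i, j)) : Summable fun j => ∑' i, a (i, j) := by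
  have h := (summable_prod_of_nonneg ha).2 ⟨h1, h2⟩
  exact ((summable_prod_of_nonneg (f := fun p : ℤ × ℤ => a p.swap) (fun p => ha p.swap)).1
    h.prod_symm).2

theorem isHilbertSchmidt_star (T : H →L[ℂ] H) (hT : IsHilbertSchmidt b T) :
    IsHilbertSchmidt b (star T) := by
  rw [isHilbertSchmidt_iff] at hT ⊢
  have h := summable_swap (fun p => ‖(inner ℂ (b p.2) (T (b p.1)) : ℂ)‖ ^ 2) (fun p => sq_nonneg _)
    (fun i => (hasSum_norm_sq b (T (b i))).summable)
    (by
      refine hT.congr fun i => ?_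
      exact (hasSum_norm_sq b (T (b i))).tsum_eq.symm)
  refine h.congr fun j => ?_
  rw [← (hasSum_norm_sq b (star T (b j))).tsum_eq]
  refine tsum_congr fun i => ?_
  rw [ContinuousLinearMap.star_eq_adjoint, ContinuousLinearMap.adjoint_inner_right,
    norm_inner_symm]

theorem isHilbertSchmidt_of_finite_range (T : H →L[ℂ] H) (G : Submodule ℂ H)
    [FiniteDimensional ℂ G] (hG : IsClosed (G : Set H)) :
    IsHilbertSchmidt b (orthProj G hG * T) := by
  have : CompleteSpace G := hG.completeSpace_coe
  rw [isHilbertSchmidt_iff]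
  let c := stdOrthonormalBasis ℂ G
  have key : ∀ x : H, ‖orthProj G hG x‖ ^ 2 = ∑ k, ‖inner ℂ (c k : H) x‖ ^ 2 := by
    intro x
    have h1 : ‖orthProj G hG x‖ = ‖(⟨orthProj G hG x, orthProj_mem G hG x⟩ : G)‖ := rfl
    rw [h1, ← c.sum_sq_norm_inner_right]
    refine Finset.sum_congr rfl fun k _ => ?_
    rw [Submodule.coe_inner, ← orthProj_inner, orthProj_eq_self G hG (c k).2]
  simp only [mul_apply_eq_comp, key]
  refine summable_sum fun k _ => ?_
  have := (hasSum_norm_sq b (star T (c k))).summable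
  convert this using 2 with i
  rw [ContinuousLinearMap.star_eq_adjoint, ContinuousLinearMap.adjoint_inner_right]
  rw [norm_inner_symm]

/-- A finite-dimensional complement of the range of `π₊ : W → H₊`. -/
theorem exists_complement (W : Submodule ℂ H) (h : IsFredholm (plusMap b W)) :
    ∃ G : Submodule ℂ H, FiniteDimensional ℂ G ∧
      ∀ y ∈ Hplus b, ∃ w ∈ W, ∃ g ∈ G, y = piPlus b w + g := by
  obtain ⟨C, hC⟩ := Submodule.exists_isCompl (LinearMap.range (plusMap b W))
  have := h.2
  have : FiniteDimensional ℂ C :=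
    (Submodule.quotientEquivOfIsCompl _ _ hC).finiteDimensional
  refine ⟨C.map (Hplus b).subtype, inferInstance, fun y hy => ?_⟩
  have : (⟨y, hy⟩ : Hplus b) ∈ LinearMap.range (plusMap b W) ⊔ C := by
    rw [hC.sup_eq_top]
    trivial
  obtain ⟨_, ⟨w, rfl⟩, g, hg, hwg⟩ := Submodule.mem_sup.1 this
  exact ⟨w, w.2, g, ⟨g, hg, rfl⟩, (congrArg Subtype.val hwg).symm⟩

/-- For `W` in the restricted Grassmannian, `π_W - π₊` is a Hilbert-Schmidt operator. -/
theorem isHilbertSchmidt_sub (W : Submodule ℂ H) (hW : IsClosed (W : Set H))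
    (hF : IsFredholm (plusMap b W)) (hHS : IsHilbertSchmidt b (piMinus b * orthProj W hW)) :
    IsHilbertSchmidt b (orthProj W hW - piPlus b) := by
  obtain ⟨G, hGfin, hG⟩ := exists_complement b W hF
  have hGc : IsClosed (G : Set H) := G.closed_of_finiteDimensional
  have : CompleteSpace W := hW.completeSpace_coe
  have : CompleteSpace G := hGc.completeSpace_coe
  have : CompleteSpace (Hplus b) := (isClosed_Hplus b).completeSpace_coe
  -- the surjection `W × G → H₊`, `(w, g) ↦ π₊ (w + g)`
  let S : (W × G) →L[ℂ] Hplus b :=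
    ((Hplus b).orthogonalProjectionOnto ∘L W.subtypeL).coprod
      ((Hplus b).orthogonalProjectionOnto ∘L G.subtypeL)
  have hS : Function.Surjective S := by
    rintro ⟨y, hy⟩
    obtain ⟨w, hw, g, hg, hwg⟩ := hG y hy
    refine ⟨(⟨w, hw⟩, ⟨g, hg⟩), Subtype.ext ?_⟩
    have h1 : ((S (⟨w, hw⟩, ⟨g, hg⟩) : Hplus b) : H) = piPlus b w + piPlus b g := rfl
    have h2 := congrArg (piPlus b) hwg
    rw [map_add, piPlus, orthProj_eq_self _ _ hy,
      orthProj_eq_self _ _ (orthProj_mem _ _ _)] at h2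
    rw [h1]
    exact h2.symm
  obtain ⟨C, hCpos, hC⟩ := S.exists_preimage_norm_le hS
  have bound : ∀ y ∈ Hplus b, ‖y‖ ≤ C * (‖orthProj W hW y‖ + ‖orthProj G hGc y‖) := by
    intro y hy
    obtain ⟨⟨w, g⟩, hwg, hn⟩ := hC ⟨y, hy⟩
    have h1 : y = piPlus b w + piPlus b g := (congrArg Subtype.val hwg).symm
    have hw : ‖(w : H)‖ ≤ C * ‖y‖ := (norm_fst_le (w, g)).trans hn
    have hg : ‖(g : H)‖ ≤ C * ‖y‖ := (norm_snd_le (w, g)).trans hn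
    have h2 : inner ℂ y y = inner ℂ (orthProj W hW y) (w : H) + inner ℂ (orthProj G hGc y) (g : H) := by
      have h0 : inner ℂ y y = inner ℂ y (piPlus b w + piPlus b g) := by rw [← h1]
      rw [h0, inner_add_right, piPlus, ← orthProj_inner, ← orthProj_inner,
        orthProj_eq_self _ _ hy, orthProj_inner W, orthProj_inner G, orthProj_eq_self W hW w.2,
        orthProj_eq_self G hGc g.2]
    have h3 : ‖y‖ * ‖y‖ ≤ ‖orthProj W hW y‖ * ‖(w : H)‖ + ‖orthProj G hGc y‖ * ‖(g : H)‖ := by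
      calc ‖y‖ * ‖y‖ = ‖(inner ℂ y y : ℂ)‖ := by
            rw [inner_self_eq_norm_sq_to_K, norm_pow, RCLike.norm_ofReal, abs_norm, sq]
        _ ≤ _ := by
          rw [h2]
          exact (norm_add_le _ _).trans (add_le_add (norm_inner_le_norm _ _) (norm_inner_le_norm _ _))
    by_cases hy0 : ‖y‖ = 0
    · rw [hy0]
      positivity
    · have hypos : 0 < ‖y‖ := lt_of_le_of_ne (norm_nonneg _) (Ne.symm hy0)
      have h4 : ‖y‖ * ‖y‖ ≤ (C * (‖orthProj W hW y‖ + ‖orthProj G hGc y‖)) * ‖y‖ := by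
        calc _ ≤ _ := h3
          _ ≤ ‖orthProj W hW y‖ * (C * ‖y‖) + ‖orthProj G hGc y‖ * (C * ‖y‖) := by gcongr
          _ = _ := by ring
      exact le_of_mul_le_mul_right h4 hypos
  -- the estimate for the component of `y` orthogonal to `W`
  let D := piMinus b * orthProj W hW
  let F := orthProj G hGc * (piPlus b * (1 - orthProj W hW))
  have est : ∀ y ∈ Hplus b, ‖y - orthProj W hW y‖ ≤ (C + 1) * (‖D y‖ + ‖F y‖) := by
    intro y hy
    set z := y - orthProj W hW y with hz
    have hyp : piPlus b y = y := orthProj_eq_self _ _ hy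
    have hzm : z - piPlus b z = - D y := by
      change z - piPlus b z = - (orthProj W hW y - piPlus b (orthProj W hW y))
      rw [hz, map_sub, hyp]
      abel
    have hWz : orthProj W hW z = 0 := by
      rw [hz, map_sub, orthProj_eq_self W hW (orthProj_mem W hW y), sub_self]
    have hu : orthProj W hW (piPlus b z) = orthProj W hW (D y) := by
      have : piPlus b z = z + D y := by
        rw [← sub_eq_iff_eq_add']
        rw [← neg_sub, hzm, neg_neg]
      rw [this, map_add, hWz, zero_add]
    have hF' : orthProj G hGc (piPlus b z) = F y := rfl
    have h1 := bound (piPlus b z) (orthProj_mem _ _ _)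
    rw [hu, hF'] at h1
    have h2 : z = piPlus b z + (- D y) := by rw [← hzm]; abel
    calc ‖z‖ = ‖piPlus b z + (- D y)‖ := by rw [← h2]
      _ ≤ ‖piPlus b z‖ + ‖D y‖ := by
        refine (norm_add_le _ _).trans ?_
        rw [norm_neg]
      _ ≤ C * (‖D y‖ + ‖F y‖) + ‖D y‖ := by
        have := norm_orthProj_le W hW (D y)
        gcongr
        exact h1.trans (by gcongr)
      _ ≤ (C + 1) * (‖D y‖ + ‖F y‖) := by
        have := norm_nonneg (F y)
        linarith
  have hD : Summable fun i => ‖D (b i)‖ ^ 2 := (isHilbertSchmidt_iff b D).1 hHS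
  have hFs : Summable fun i => ‖F (b i)‖ ^ 2 :=
    (isHilbertSchmidt_iff b F).1 (isHilbertSchmidt_of_finite_range b _ G hGc)
  have hperp : IsHilbertSchmidt b ((1 - orthProj W hW) * piPlus b) := by
    rw [isHilbertSchmidt_iff]
    refine Summable.of_nonneg_of_le (fun i => by positivity) (fun i => ?_)
      ((hD.add hFs).mul_left (2 * (C + 1) ^ 2))
    rw [mul_apply_eq_comp]
    by_cases hi : 0 ≤ i
    · rw [piPlus_basis_of_nonneg b hi]
      have h1 := est (b i) (basis_mem_Hplus b hi)
      change ‖b i - orthProj W hW (b i)‖ ^ 2 ≤ _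
      calc ‖b i - orthProj W hW (b i)‖ ^ 2 ≤ ((C + 1) * (‖D (b i)‖ + ‖F (b i)‖)) ^ 2 := by gcongr
        _ = (C + 1) ^ 2 * (‖D (b i)‖ + ‖F (b i)‖) ^ 2 := by ring
        _ ≤ (C + 1) ^ 2 * (2 * (‖D (b i)‖ ^ 2 + ‖F (b i)‖ ^ 2)) := by
          gcongr
          nlinarith [sq_nonneg (‖D (b i)‖ - ‖F (b i)‖)]
        _ = _ := by ring
    · rw [piPlus_basis_of_neg b hi, map_zero, norm_zero]
      have : 0 ≤ 2 * (C + 1) ^ 2 * (‖D (b i)‖ ^ 2 + ‖F (b i)‖ ^ 2) := by positivity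
      simpa using this
  have hadj : IsHilbertSchmidt b (orthProj W hW * piMinus b) := by
    have := isHilbertSchmidt_star b _ hHS
    rw [star_mul, (orthProj_isSelfAdjoint W hW).star_eq] at this
    have hm : star (piMinus b) = piMinus b := by
      rw [piMinus, star_sub, star_one, (piPlus_isSelfAdjoint b).star_eq]
    rwa [hm] at this
  have hEq : orthProj W hW - piPlus b =
      orthProj W hW * piMinus b - (1 - orthProj W hW) * piPlus b := by
    rw [piMinus]
    noncomm_ring
  rw [hEq]
  exact (hsSubmodule b).sub_mem hadj hperp

end Difference

namespace GrRes

variable {b : HilbertBasis ℤ ℂ H}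

/-- The orthogonal projection `π_W`. -/
def proj (W : GrRes b) : H →L[ℂ] H := orthProj W.carrier W.closed

/-- The inclusion `W ↦ π_W - π₊` into `L²`, which defines the topology and the smooth structure of
the restricted Grassmannian: it is a closed embedded submanifold of the Hilbert space `L²`. -/
def emb (W : GrRes b) : HSOp b :=
  ⟨W.proj - piPlus b, isHilbertSchmidt_sub b W.carrier W.closed W.fredholm W.hilbertSchmidt⟩

instance : TopologicalSpace (GrRes b) := TopologicalSpace.induced emb inferInstance

variable (b) in
/-- The base point `H₊` of the restricted Grassmannian. -/
def base : GrRes b where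
  carrier := Hplus b
  closed := isClosed_Hplus b
  fredholm := by
    have h : plusMap b (Hplus b) = LinearMap.id := by
      ext x
      exact orthProj_eq_self _ (isClosed_Hplus b) x.2
    rw [IsFredholm, h, LinearMap.ker_id, LinearMap.range_id]
    exact ⟨inferInstance, inferInstance⟩
  hilbertSchmidt := by
    have h : piMinus b * orthProj (Hplus b) (isClosed_Hplus b) = 0 := by
      rw [piMinus, sub_mul, one_mul, piPlus, orthProj_mul_self, sub_self]
    rw [h]
    exact (hsSubmodule b).zero_mem

end GrRes

section GrBlockSum

variable (b : HilbertBasis ℤ ℂ H)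

/-- The subspace `ρ* (W ⊕ V)`. -/
def subspaceSum (W V : Submodule ℂ H) : Submodule ℂ H :=
  W.comap (rho₀ intSplitting b).toLinearMap ⊓ V.comap (rho₁ intSplitting b).toLinearMap

theorem mem_subspaceSum (W V : Submodule ℂ H) (x : H) :
    x ∈ subspaceSum b W V ↔ rho₀ intSplitting b x ∈ W ∧ rho₁ intSplitting b x ∈ V := Iff.rfl

theorem isClosed_subspaceSum (W V : Submodule ℂ H) (hW : IsClosed (W : Set H))
    (hV : IsClosed (V : Set H)) : IsClosed (subspaceSum b W V : Set H) :=
  (hW.preimage (rho₀ intSplitting b).continuous).inter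
    (hV.preimage (rho₁ intSplitting b).continuous)

theorem rho₀_combine (x y : H) : rho₀ intSplitting b
    (star (rho₀ intSplitting b) x + star (rho₁ intSplitting b) y) = x := by
  have h0 := congrArg (fun T : H →L[ℂ] H => T x) (rho₀_mul_star intSplitting b)
  have h1 := congrArg (fun T : H →L[ℂ] H => T y) (rho₀_mul_star_rho₁ intSplitting b)
  simp only [mul_apply_eq_comp] at h0 h1
  rw [map_add, h0, h1]
  simp

theorem rho₁_combine (x y : H) : rho₁ intSplitting b
    (star (rho₀ intSplitting b) x + star (rho₁ intSplitting b) y) = y := by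
  have h0 := congrArg (fun T : H →L[ℂ] H => T x) (rho₁_mul_star_rho₀ intSplitting b)
  have h1 := congrArg (fun T : H →L[ℂ] H => T y) (rho₁_mul_star intSplitting b)
  simp only [mul_apply_eq_comp] at h0 h1
  rw [map_add, h0, h1]
  simp

theorem combine_rho (x : H) : star (rho₀ intSplitting b) (rho₀ intSplitting b x) +
    star (rho₁ intSplitting b) (rho₁ intSplitting b x) = x :=
  congrArg (fun T : H →L[ℂ] H => T x) (star_rho_mul_add intSplitting b)

theorem orthProj_subspaceSum (W V : Submodule ℂ H) (hW : IsClosed (W : Set H))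
    (hV : IsClosed (V : Set H)) :
    orthProj (subspaceSum b W V) (isClosed_subspaceSum b W V hW hV) =
      blockSum intSplitting b (orthProj W hW) (orthProj V hV) := by
  ext x
  apply orthProj_unique
  · rw [mem_subspaceSum]
    change rho₀ intSplitting b (star (rho₀ intSplitting b) _ + star (rho₁ intSplitting b) _) ∈ W ∧
      rho₁ intSplitting b (star (rho₀ intSplitting b) _ + star (rho₁ intSplitting b) _) ∈ V
    rw [rho₀_combine, rho₁_combine]
    exact ⟨orthProj_mem _ _ _, orthProj_mem _ _ _⟩
  · intro w hw
    rw [mem_subspaceSum] at hw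
    set R := rho₀ intSplitting b with hR
    set S := rho₁ intSplitting b with hS
    have h : x - blockSum intSplitting b (orthProj W hW) (orthProj V hV) x =
        star R (R x - orthProj W hW (R x)) + star S (S x - orthProj V hV (S x)) := by
      have h1 := combine_rho b x
      have h2 : blockSum intSplitting b (orthProj W hW) (orthProj V hV) x =
        star R (orthProj W hW (R x)) + star S (orthProj V hV (S x)) := rfl
      rw [h2, map_sub, map_sub]
      nth_rewrite 1 [← h1]
      abel
    rw [h, inner_add_left, ContinuousLinearMap.star_eq_adjoint, ContinuousLinearMap.star_eq_adjoint,
      ContinuousLinearMap.adjoint_inner_left, ContinuousLinearMap.adjoint_inner_left,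
      inner_sub_orthProj W hW _ _ hw.1, inner_sub_orthProj V hV _ _ hw.2, add_zero]

theorem piPlus_rho₀ (x : H) :
    piPlus b (rho₀ intSplitting b x) = rho₀ intSplitting b (piPlus b x) :=
  congrArg (fun T : H →L[ℂ] H => T x) (piPlus_comm_rho₀ b)

theorem piPlus_rho₁ (x : H) :
    piPlus b (rho₁ intSplitting b x) = rho₁ intSplitting b (piPlus b x) :=
  congrArg (fun T : H →L[ℂ] H => T x) (piPlus_comm_rho₁ b)

theorem combine_mem_Hplus (x y : H) (hx : x ∈ Hplus b) (hy : y ∈ Hplus b) :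
    star (rho₀ intSplitting b) x + star (rho₁ intSplitting b) y ∈ Hplus b := by
  have h : piPlus b (star (rho₀ intSplitting b) x + star (rho₁ intSplitting b) y) =
      star (rho₀ intSplitting b) x + star (rho₁ intSplitting b) y := by
    rw [← combine_rho b (piPlus b _), ← piPlus_rho₀, ← piPlus_rho₁, rho₀_combine, rho₁_combine,
      piPlus, orthProj_eq_self _ _ hx, orthProj_eq_self _ _ hy]
  rw [← h]
  exact orthProj_mem _ _ _

theorem isFredholm_subspaceSum (W V : Submodule ℂ H) (hW : IsFredholm (plusMap b W))
    (hV : IsFredholm (plusMap b V)) : IsFredholm (plusMap b (subspaceSum b W V)) := by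
  have hW1 := hW.1
  have hW2 := hW.2
  have hV1 := hV.1
  have hV2 := hV.2
  constructor
  · let f₀ : LinearMap.ker (plusMap b (subspaceSum b W V)) →ₗ[ℂ] LinearMap.ker (plusMap b W) :=
      { toFun x := ⟨⟨rho₀ intSplitting b x.1.1, x.1.2.1⟩, by
          rw [LinearMap.mem_ker]
          apply Subtype.ext
          change piPlus b (rho₀ intSplitting b x.1.1) = 0
          have : piPlus b x.1.1 = 0 := congrArg Subtype.val (LinearMap.mem_ker.1 x.2)
          rw [piPlus_rho₀, this, map_zero]⟩
        map_add' x y := by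
          apply Subtype.ext
          apply Subtype.ext
          exact map_add (rho₀ intSplitting b) _ _
        map_smul' c x := by
          apply Subtype.ext
          apply Subtype.ext
          exact map_smul (rho₀ intSplitting b) _ _ }
    let f₁ : LinearMap.ker (plusMap b (subspaceSum b W V)) →ₗ[ℂ] LinearMap.ker (plusMap b V) :=
      { toFun x := ⟨⟨rho₁ intSplitting b x.1.1, x.1.2.2⟩, by
          rw [LinearMap.mem_ker]
          apply Subtype.ext
          change piPlus b (rho₁ intSplitting b x.1.1) = 0
          have : piPlus b x.1.1 = 0 := congrArg Subtype.val (LinearMap.mem_ker.1 x.2)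
          rw [piPlus_rho₁, this, map_zero]⟩
        map_add' x y := by
          apply Subtype.ext
          apply Subtype.ext
          exact map_add (rho₁ intSplitting b) _ _
        map_smul' c x := by
          apply Subtype.ext
          apply Subtype.ext
          exact map_smul (rho₁ intSplitting b) _ _ }
    refine FiniteDimensional.of_injective (f₀.prod f₁) ?_
    rw [injective_iff_map_eq_zero]
    intro x hx
    have h0 : rho₀ intSplitting b x.1.1 = 0 :=
      congrArg (fun z => z.1.1.1) hx
    have h1 : rho₁ intSplitting b x.1.1 = 0 :=
      congrArg (fun z => z.2.1.1) hx
    apply Subtype.ext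
    apply Subtype.ext
    change x.1.1 = 0
    rw [← combine_rho b x.1.1, h0, h1, map_zero, map_zero, add_zero]
  · let f : (Hplus b × Hplus b) →ₗ[ℂ] Hplus b :=
      { toFun x := ⟨_, combine_mem_Hplus b x.1 x.2 x.1.2 x.2.2⟩
        map_add' x y := by
          apply Subtype.ext
          change star (rho₀ intSplitting b) (x.1.1 + y.1.1) +
            star (rho₁ intSplitting b) (x.2.1 + y.2.1) =
            (star (rho₀ intSplitting b) x.1.1 + star (rho₁ intSplitting b) x.2.1) +
            (star (rho₀ intSplitting b) y.1.1 + star (rho₁ intSplitting b) y.2.1)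
          rw [map_add, map_add]
          abel
        map_smul' c x := by
          apply Subtype.ext
          change star (rho₀ intSplitting b) (c • x.1.1) + star (rho₁ intSplitting b) (c • x.2.1) =
            c • (star (rho₀ intSplitting b) x.1.1 + star (rho₁ intSplitting b) x.2.1)
          rw [map_smul, map_smul, smul_add] }
    have hf : ∀ x ∈ (LinearMap.range (plusMap b W)).prod (LinearMap.range (plusMap b V)),
        f x ∈ LinearMap.range (plusMap b (subspaceSum b W V)) := by
      rintro ⟨_, _⟩ ⟨⟨w, rfl⟩, ⟨v, rfl⟩⟩
      refine ⟨⟨star (rho₀ intSplitting b) w.1 + star (rho₁ intSplitting b) v.1, ?_⟩, ?_⟩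
      · rw [mem_subspaceSum, rho₀_combine, rho₁_combine]
        exact ⟨w.2, v.2⟩
      · apply Subtype.ext
        change piPlus b (star (rho₀ intSplitting b) w.1 + star (rho₁ intSplitting b) v.1) =
          star (rho₀ intSplitting b) (piPlus b w.1) + star (rho₁ intSplitting b) (piPlus b v.1)
        rw [← combine_rho b (piPlus b _), ← piPlus_rho₀, ← piPlus_rho₁, rho₀_combine, rho₁_combine]
    let q := (LinearMap.range (plusMap b (subspaceSum b W V))).mkQ.comp f
    have hq : Function.Surjective q := by
      intro z
      obtain ⟨y, rfl⟩ := Submodule.mkQ_surjective _ z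
      have h0 : rho₀ intSplitting b y.1 ∈ Hplus b := by
        have := piPlus_rho₀ b y.1
        rw [piPlus, orthProj_eq_self _ _ y.2] at this
        rw [← this]
        exact orthProj_mem _ _ _
      have h1 : rho₁ intSplitting b y.1 ∈ Hplus b := by
        have := piPlus_rho₁ b y.1
        rw [piPlus, orthProj_eq_self _ _ y.2] at this
        rw [← this]
        exact orthProj_mem _ _ _
      refine ⟨(⟨_, h0⟩, ⟨_, h1⟩), ?_⟩
      change Submodule.mkQ _ _ = _
      congr 1
      exact Subtype.ext (combine_rho b y.1)
    have hfin : FiniteDimensional ℂ ((Hplus b × Hplus b) ⧸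
        (LinearMap.range (plusMap b W)).prod (LinearMap.range (plusMap b V))) := by
      let g := ((LinearMap.range (plusMap b W)).mkQ.prodMap (LinearMap.range (plusMap b V)).mkQ)
      have hg : LinearMap.ker g =
          (LinearMap.range (plusMap b W)).prod (LinearMap.range (plusMap b V)) := by
        rw [LinearMap.ker_prodMap, Submodule.ker_mkQ, Submodule.ker_mkQ]
      rw [← hg]
      exact FiniteDimensional.of_injective _ (LinearMap.ker_eq_bot.1 (Submodule.ker_liftQ_eq_bot' _ g rfl))
    refine Module.Finite.of_surjective (Submodule.liftQ
      ((LinearMap.range (plusMap b W)).prod (LinearMap.range (plusMap b V))) q ?_) ?_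
    · intro x hx
      rw [LinearMap.mem_ker]
      exact (Submodule.Quotient.mk_eq_zero _).2 (hf x hx)
    · intro z
      obtain ⟨x, rfl⟩ := hq z
      exact ⟨Submodule.Quotient.mk x, rfl⟩

variable {b}

/-- The block sum `W ⊞ V = ρ* (W ⊕ V)` on the restricted Grassmannian. -/
def GrRes.blockSum (W V : GrRes b) : GrRes b where
  carrier := subspaceSum b W.carrier V.carrier
  closed := isClosed_subspaceSum b _ _ W.closed V.closed
  fredholm := isFredholm_subspaceSum b _ _ W.fredholm V.fredholm
  hilbertSchmidt := by
    rw [orthProj_subspaceSum b _ _ W.closed V.closed, ← blockSum_piMinus, blockSum_mul]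
    exact isHilbertSchmidt_blockSum _ _ _ _ W.hilbertSchmidt V.hilbertSchmidt

theorem GrRes.emb_blockSum (W V : GrRes b) :
    (W.blockSum V).emb = hsBlockSum intSplitting b (W.emb, V.emb) := by
  apply Subtype.ext
  change orthProj (subspaceSum b W.carrier V.carrier) _ - piPlus b =
    HSOp.op b (hsBlockSum intSplitting b (W.emb, V.emb))
  rw [op_hsBlockSum, orthProj_subspaceSum b _ _ W.closed V.closed]
  change _ = DiffK.blockSum intSplitting b (W.proj - piPlus b) (V.proj - piPlus b)
  rw [blockSum_sub, blockSum_piPlus]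
  rfl

theorem GrRes.continuous_blockSum :
    Continuous fun p : GrRes b × GrRes b => p.1.blockSum p.2 := by
  rw [continuous_induced_rng]
  have h : (GrRes.emb ∘ fun p : GrRes b × GrRes b => p.1.blockSum p.2) =
      fun p => hsBlockSum intSplitting b (p.1.emb, p.2.emb) := funext fun p => emb_blockSum _ _
  rw [h]
  have he : Continuous (GrRes.emb (b := b)) := continuous_induced_dom
  exact (hsBlockSum intSplitting b).continuous.comp
    ((he.comp continuous_fst).prodMk (he.comp continuous_snd))

end GrBlockSum

end Grassmannian

/-! ### Exact differential forms on a manifold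

Forms are complex valued; a real form is exact if and only if it is exact as a complex form. -/

section Forms

variable {E : Type*} [NormedAddCommGroup E] [NormedSpace ℝ E]
variable {M : Type*} [TopologicalSpace M] [ChartedSpace E M]

/-- The expression of a `k`-form `η` on `M` in the chart at `x₀`. -/
def chartForm {k : ℕ} (η : ∀ x : M, TangentSpace 𝓘(ℝ, E) x [⋀^Fin k]→L[ℝ] ℂ) (x₀ : M) (y : E) :
    E [⋀^Fin k]→L[ℝ] ℂ :=
  (η ((extChartAt 𝓘(ℝ, E) x₀).symm y)).compContinuousLinearMap
    (mfderiv 𝓘(ℝ, E) 𝓘(ℝ, E) (extChartAt 𝓘(ℝ, E) x₀).symm y)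

/-- A `k`-form is smooth if its expression in every chart is. -/
def IsSmoothForm {k : ℕ} (η : ∀ x : M, TangentSpace 𝓘(ℝ, E) x [⋀^Fin k]→L[ℝ] ℂ) : Prop :=
  ∀ x₀ : M, ContDiffOn ℝ ∞ (chartForm η x₀) (extChartAt 𝓘(ℝ, E) x₀).target

/-- The exterior derivative of a `k`-form, computed at `x` in the chart at `x`. -/
def extDerivForm {k : ℕ} (η : ∀ x : M, TangentSpace 𝓘(ℝ, E) x [⋀^Fin k]→L[ℝ] ℂ) (x : M) :
    TangentSpace 𝓘(ℝ, E) x [⋀^Fin (k + 1)]→L[ℝ] ℂ :=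
  (extDeriv (chartForm η x) (extChartAt 𝓘(ℝ, E) x x)).compContinuousLinearMap
    (mfderiv 𝓘(ℝ, E) 𝓘(ℝ, E) (extChartAt 𝓘(ℝ, E) x) x)

/-- A `k`-form `α`, given by its values, is exact: `α = d η` for a smooth `(k - 1)`-form `η`, and
`α = 0` if `k = 0`. -/
def IsExactForm : (k : ℕ) → (∀ x : M, (Fin k → TangentSpace 𝓘(ℝ, E) x) → ℂ) → Prop
  | 0, α => ∀ x v, α x v = 0
  | k + 1, α => ∃ η : ∀ x : M, TangentSpace 𝓘(ℝ, E) x [⋀^Fin k]→L[ℝ] ℂ,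
      IsSmoothForm η ∧ ∀ x v, α x v = extDerivForm η x v

end Forms

/-! ### Smooth maps into a classifying space and Chern-Simons homotopies

In this section `X` is a subset of a normed space `V` (up to a translation), with inclusion `emb`,
and a form of degree `m` on `X` is given by its values `ch x A`, `A : Fin m → V` a family of tangent
vectors. -/

section ChernSimons

variable (E : Type*) [NormedAddCommGroup E] [NormedSpace ℝ E]
variable (M : Type*) [TopologicalSpace M] [ChartedSpace E M]
variable {X : Type*} {V : Type*} [NormedAddCommGroup V] [NormedSpace ℝ V] (emb : X → V)

/-- The smooth maps from the manifold `M` (modelled on `E`, without boundary) to `X`. -/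
def SmoothMap : Type _ :=
  {f : M → X // ContMDiff 𝓘(ℝ, E) 𝓘(ℝ, V) ∞ (emb ∘ f)}

variable {E M}

/-- `H` is a smooth homotopy `M × [0, 1] → X`; the values outside `[0, 1]` are irrelevant. -/
def IsSmoothHomotopy (E : Type*) [NormedAddCommGroup E] [NormedSpace ℝ E] {M : Type*}
    [TopologicalSpace M] [ChartedSpace E M] (emb : X → V) (H : M × ℝ → X) : Prop :=
  ContMDiffOn (𝓘(ℝ, E).prod 𝓘(ℝ, ℝ)) 𝓘(ℝ, V) ∞ (emb ∘ H) (Set.univ ×ˢ Set.Icc (0 : ℝ) 1)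

/-- The derivative of a homotopy `M × [0, 1] → X` at `(x, t)` in the direction `(v, r)`. -/
def homotopyDeriv (H : M × ℝ → X) (x : M) (t : ℝ) (v : TangentSpace 𝓘(ℝ, E) x) (r : ℝ) : V :=
  (mfderivWithin (𝓘(ℝ, E).prod 𝓘(ℝ, ℝ)) 𝓘(ℝ, V) (emb ∘ H) (Set.univ ×ˢ Set.Icc (0 : ℝ) 1) (x, t) :
    E × ℝ →L[ℝ] V) (v, r)

/-- The Chern-Simons form `∫_I H_t* ch` (integration over the fibre) of degree `m` of a homotopy,
for a form `ch` of degree `m + 1` on `X`. -/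
def csForm {m : ℕ} (ch : X → (Fin (m + 1) → V) → ℂ) (H : M × ℝ → X) (x : M)
    (v : Fin m → TangentSpace 𝓘(ℝ, E) x) : ℂ :=
  ∫ t in (0 : ℝ)..1, ch (H (x, t))
    (Fin.cons (homotopyDeriv (E := E) emb H x t 0 1) fun i => homotopyDeriv (E := E) emb H x t (v i) 0)

/-- `f` and `g` are Chern-Simons homotopic with respect to the form `∑ ch j` on `X`, `ch j` of
degree `deg j + 1`: there is a smooth homotopy from `f` to `g` whose Chern-Simons form is exact. -/
def CSHomotopic {deg : ℕ → ℕ} (ch : ∀ j, X → (Fin (deg j + 1) → V) → ℂ)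
    (f g : SmoothMap E M emb) : Prop :=
  ∃ H : M × ℝ → X, IsSmoothHomotopy E emb H ∧
    (∀ x, H (x, 0) = f.1 x) ∧ (∀ x, H (x, 1) = g.1 x) ∧
    ∀ j, IsExactForm (E := E) (deg j) (csForm (E := E) emb (ch j) H)

end ChernSimons

/-! ### The universal Chern character forms -/

section ChernForms

variable {H : Type*} [NormedAddCommGroup H] [InnerProductSpace ℂ H] [CompleteSpace H]

/-- The component of degree `2 k - 1`, `k = j + 1`, of the universal odd Chern character form on
`U¹`: `(i / 2 π) ^ k * (-1) ^ (k - 1) * (k - 1)! / (2 k - 1)! * tr ((P⁻¹ dP) ^ (2 k - 1))`,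
`P⁻¹ dP` the Maurer-Cartan form. -/
def chOdd (b : HilbertBasis ℕ ℂ H) (j : ℕ) (P : U1 H) (A : Fin (2 * j + 1) → TraceClassOp H) : ℂ :=
  (Complex.I / (2 * Real.pi)) ^ (j + 1) * ((-1) ^ j * j.factorial / (2 * j + 1).factorial) *
    ∑ σ : Equiv.Perm (Fin (2 * j + 1)), ((Equiv.Perm.sign σ : ℤ) : ℂ) *
      opTrace b (List.ofFn fun l : Fin (2 * j + 1) =>
        star P.op * TraceClassOp.op H (A (σ l))).prod

/-- The component of degree `2 k`, `k = j + 1`, of the universal even Chern character form on the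
restricted Grassmannian: `(i / 2 π) ^ k / k! * tr (Ω ^ k)` with the curvature `Ω = π_W dπ_W dπ_W`.
(The component of degree `0`, the virtual dimension, does not contribute to Chern-Simons forms.) -/
def chEven (b : HilbertBasis ℤ ℂ H) (j : ℕ) (W : GrRes b) (A : Fin (2 * j + 1 + 1) → HSOp b) : ℂ :=
  (Complex.I / (2 * Real.pi)) ^ (j + 1) / (j + 1).factorial *
    ∑ σ : Equiv.Perm (Fin (2 * j + 1 + 1)), ((Equiv.Perm.sign σ : ℤ) : ℂ) *
      opTrace b (List.ofFn fun l : Fin (j + 1) =>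
        W.proj * HSOp.op b (A (σ ⟨2 * l.1, by omega⟩)) *
          HSOp.op b (A (σ ⟨2 * l.1 + 1, by omega⟩))).prod

end ChernForms

/-! ### K-theory and differential K-theory -/

section KTheory

variable {H : Type*} [NormedAddCommGroup H] [InnerProductSpace ℂ H] [CompleteSpace H]
variable (b : HilbertBasis ℤ ℂ H) (c : HilbertBasis ℕ ℂ H)
variable (E : Type*) [NormedAddCommGroup E] [NormedSpace ℝ E]
variable (M : Type*) [TopologicalSpace M] [ChartedSpace E M]

/-- `Map(M, Gr_res)`. -/
abbrev EvenMap : Type _ := SmoothMap E M (GrRes.emb (b := b))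

/-- `Map(M, U¹)`. -/
abbrev OddMap (H : Type*) [NormedAddCommGroup H] [InnerProductSpace ℂ H] [CompleteSpace H]
    (E : Type*) [NormedAddCommGroup E] [NormedSpace ℝ E] (M : Type*) [TopologicalSpace M]
    [ChartedSpace E M] : Type _ := SmoothMap E M (U1.emb (H := H))

variable {b E M}

/-- The block sum of two maps to the restricted Grassmannian. -/
def EvenMap.blockSum (f g : EvenMap b E M) : EvenMap b E M :=
  ⟨fun x => (f.1 x).blockSum (g.1 x), by
    have h : (GrRes.emb ∘ fun x => (f.1 x).blockSum (g.1 x)) =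
        ((hsBlockSum intSplitting b).restrictScalars ℝ) ∘
          fun x => ((GrRes.emb ∘ f.1) x, (GrRes.emb ∘ g.1) x) :=
      funext fun x => GrRes.emb_blockSum _ _
    rw [h]
    exact (ContinuousLinearMap.contMDiff _).comp (f.2.prodMk_space g.2)⟩

/-- The block sum of two maps to `U¹`. -/
def OddMap.blockSum (f g : OddMap H E M) : OddMap H E M :=
  ⟨fun x => U1.blockSum c (f.1 x) (g.1 x), by
    have h : (U1.emb ∘ fun x => U1.blockSum c (f.1 x) (g.1 x)) =
        ((traceBlockSum natSplitting c).restrictScalars ℝ) ∘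
          fun x => ((U1.emb ∘ f.1) x, (U1.emb ∘ g.1) x) :=
      funext fun x => U1.emb_blockSum _ _ _
    rw [h]
    exact (ContinuousLinearMap.contMDiff _).comp (f.2.prodMk_space g.2)⟩

variable (b E M) in
/-- The constant map to the base point `H₊`. -/
def EvenMap.base : EvenMap b E M := ⟨fun _ => GrRes.base b, contMDiff_const⟩

variable (H E M) in
/-- The constant map to the base point `1`. -/
def OddMap.base : OddMap H E M := ⟨fun _ => U1.base H, contMDiff_const⟩

/-- The continuous map underlying a smooth map to the restricted Grassmannian. -/
def EvenMap.toContinuousMap (f : EvenMap b E M) : C(M, GrRes b) :=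
  ⟨f.1, continuous_induced_rng.2 f.2.continuous⟩

variable (b E M) in
/-- The set `K̂⁰(M)`: smooth maps to the restricted Grassmannian up to the equivalence relation
generated by Chern-Simons homotopy and by stabilization `f ∼ f ⊞ const`. -/
def KHat0 : Type _ :=
  Quot fun f g : EvenMap b E M =>
    CSHomotopic GrRes.emb (deg := fun j => 2 * j + 1) (chEven b) f g ∨
      g = f.blockSum (EvenMap.base b E M)

variable (E M) in
/-- The set `K̂¹(M)`: smooth maps to `U¹` up to the equivalence relation generated by Chern-Simons
homotopy and by stabilization `f ∼ f ⊞ const`. -/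
def KHat1 : Type _ :=
  Quot fun f g : OddMap H E M =>
    CSHomotopic U1.emb (deg := fun j => 2 * j) (chOdd c) f g ∨
      g = OddMap.blockSum c f (OddMap.base H E M)

/-- The class of a map in `K̂⁰(M)`. -/
def KHat0.mk (f : EvenMap b E M) : KHat0 b E M := Quot.mk _ f

/-- The class of a map in `K̂¹(M)`. -/
def KHat1.mk (f : OddMap H E M) : KHat1 c E M := Quot.mk _ f

end KTheory

section TopologicalKTheory

variable {H : Type*} [NormedAddCommGroup H] [InnerProductSpace ℂ H] [CompleteSpace H]
variable (b : HilbertBasis ℤ ℂ H) (M : Type*) [TopologicalSpace M]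

/-- The set `K⁰(M) = [M, Gr_res]` of homotopy classes of continuous maps to the restricted
Grassmannian. -/
def K0 : Type _ :=
  Quotient (Setoid.mk (ContinuousMap.Homotopic (X := M) (Y := GrRes b))
    ContinuousMap.Homotopic.equivalence)

variable {b M}

/-- The class of a map in `K⁰(M)`. -/
def K0.mk (f : C(M, GrRes b)) : K0 b M := Quotient.mk _ f

/-- The block sum of two continuous maps to the restricted Grassmannian. -/
def K0.blockSum (f g : C(M, GrRes b)) : C(M, GrRes b) :=
  ⟨fun x => (f x).blockSum (g x), GrRes.continuous_blockSum.comp (f.continuous.prodMk g.continuous)⟩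

end TopologicalKTheory

/-- The point, as the manifold `ℝ⁰`. -/
abbrev Point : Type := EuclideanSpace ℝ (Fin 0)

end

end DiffK

namespace DiffK

open scoped ContDiff Manifold ENNReal

noncomputable section

set_option linter.unusedSectionVars false

/-! ### Determinants of contractions -/

section Matrices

variable {κ : Type*} [Fintype κ] [DecidableEq κ]

-- Hadamard's inequality. The eigenvalues `λ` of `Gᴴ G` are nonnegative and their sum is at most the
-- size of the matrix. By `λ ≤ exp (λ - 1)`, used in place of the inequality of means, their product
-- is at most `exp (∑ (λ - 1)) ≤ 1`.
open scoped ComplexOrder in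
theorem norm_det_le_one_of_col (G : Matrix κ κ ℂ) (hG : ∀ j, ∑ i, ‖G i j‖ ^ 2 ≤ 1) :
    ‖G.det‖ ≤ 1 := by
  have hpos : (Matrix.conjTranspose G * G).PosSemidef := Matrix.posSemidef_conjTranspose_mul_self G
  have hH := hpos.isHermitian
  have hdet : ((‖G.det‖ ^ 2 : ℝ) : ℂ) = ((∏ i, hH.eigenvalues i : ℝ) : ℂ) := by
    have h := hH.det_eq_prod_eigenvalues
    rw [Matrix.det_mul, Matrix.det_conjTranspose] at h
    rw [Complex.ofReal_pow, ← Complex.conj_mul', Complex.ofReal_prod]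
    exact h
  have htr : ∑ i, hH.eigenvalues i ≤ Fintype.card κ := by
    have h := hH.trace_eq_sum_eigenvalues
    have h2 : (Matrix.conjTranspose G * G).trace = ((∑ j, ∑ i, ‖G i j‖ ^ 2 : ℝ) : ℂ) := by
      simp only [Matrix.trace, Matrix.diag_apply, Matrix.mul_apply, Matrix.conjTranspose_apply]
      push_cast
      refine Finset.sum_congr rfl fun j _ => Finset.sum_congr rfl fun i _ => ?_
      exact Complex.conj_mul' _
    rw [h2] at h
    have h3 : ∑ j, ∑ i, ‖G i j‖ ^ 2 = ∑ i, hH.eigenvalues i := by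
      apply Complex.ofReal_injective
      rw [h]
      simp
    rw [← h3]
    calc ∑ j, ∑ i, ‖G i j‖ ^ 2 ≤ ∑ _j : κ, (1 : ℝ) := Finset.sum_le_sum fun j _ => hG j
      _ = Fintype.card κ := by simp
  have hprod : ∏ i, hH.eigenvalues i ≤ 1 := by
    calc ∏ i, hH.eigenvalues i ≤ ∏ i, Real.exp (hH.eigenvalues i - 1) := by
          refine Finset.prod_le_prod (fun i _ => hpos.eigenvalues_nonneg i) fun i _ => ?_
          have := Real.add_one_le_exp (hH.eigenvalues i - 1)
          linarith
      _ = Real.exp (∑ i, (hH.eigenvalues i - 1)) := (Real.exp_sum _ _).symm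
      _ ≤ 1 := by
          rw [Real.exp_le_one_iff, Finset.sum_sub_distrib]
          simp
          linarith
  have h1 : ‖G.det‖ ^ 2 ≤ 1 := by
    rw [Complex.ofReal_injective hdet]
    exact hprod
  exact (sq_le_one_iff₀ (norm_nonneg _)).1 h1

/-- The matrix `C` acts on Euclidean space with operator norm at most `1`. -/
def IsContraction (C : Matrix κ κ ℂ) : Prop :=
  ‖Matrix.toEuclideanCLM (n := κ) (𝕜 := ℂ) C‖ ≤ 1

theorem IsContraction.mul {C D : Matrix κ κ ℂ} (hC : IsContraction C) (hD : IsContraction D) :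
    IsContraction (C * D) := by
  rw [IsContraction, map_mul]
  exact (norm_mul_le _ _).trans (mul_le_one₀ hC (norm_nonneg _) hD)

theorem IsContraction.lineMap {C D : Matrix κ κ ℂ} (hC : IsContraction C) (hD : IsContraction D)
    {t : ℝ} (h0 : 0 ≤ t) (h1 : t ≤ 1) : IsContraction (C + (t : ℂ) • (D - C)) := by
  have h : C + (t : ℂ) • (D - C) = ((1 - t : ℝ) : ℂ) • C + (t : ℂ) • D := by
    push_cast
    rw [smul_sub, sub_smul, one_smul]
    abel
  rw [IsContraction, h, map_add, map_smul, map_smul]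
  refine (norm_add_le _ _).trans ?_
  rw [norm_smul, norm_smul, Complex.norm_real, Complex.norm_real, Real.norm_of_nonneg h0,
    Real.norm_of_nonneg (by linarith)]
  have hC' : ‖Matrix.toEuclideanCLM (n := κ) (𝕜 := ℂ) C‖ ≤ 1 := hC
  have hD' : ‖Matrix.toEuclideanCLM (n := κ) (𝕜 := ℂ) D‖ ≤ 1 := hD
  nlinarith

theorem isContraction_one : IsContraction (1 : Matrix κ κ ℂ) := by
  rw [IsContraction, map_one]
  exact ContinuousLinearMap.norm_id_le

/-- Matrix entries against unit vectors `u`, `x` suffice. Let `U` be unitary with `u` as column `k`.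
Then `⟨u, adj C x⟩` is, up to the phase `det U`, the `k`-th coordinate of `adj (C U) x`. By Cramer's
rule this is the determinant of `C U` with column `k` replaced by `x`. All columns have norm at most
one, so Hadamard applies. -/
theorem IsContraction.adjugate {C : Matrix κ κ ℂ} (hC : IsContraction C) :
    IsContraction C.adjugate := by
  have key : ∀ x u : EuclideanSpace ℂ κ, ‖x‖ = 1 → ‖u‖ = 1 →
      ‖inner ℂ u (Matrix.toEuclideanCLM (n := κ) (𝕜 := ℂ) C.adjugate x)‖ ≤ 1 := by
    intro x u hx hu
    have hne : Nonempty κ := by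
      by_contra h
      rw [not_nonempty_iff] at h
      have : u = 0 := Subsingleton.elim _ _
      simp [this] at hu
    obtain ⟨k⟩ := hne
    have ho : Orthonormal ℂ (({k} : Set κ).domRestrict fun _ : κ => u) := by
      rw [orthonormal_iff_ite]
      rintro ⟨i, hi⟩ ⟨j, hj⟩
      obtain rfl : i = k := hi
      obtain rfl : j = i := hj
      simp [inner_self_eq_norm_sq_to_K, Set.domRestrict_apply, hu]
    obtain ⟨v, hv⟩ := ho.exists_orthonormalBasis_extension_of_card_eq (by simp)
    have hvk : v k = u := hv k rfl
    let U : Matrix κ κ ℂ := Matrix.of fun i j => v j i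
    have hUU : Matrix.conjTranspose U * U = 1 := by
      ext i j
      rw [Matrix.mul_apply, Matrix.one_apply]
      have := orthonormal_iff_ite.1 v.orthonormal i j
      rw [← this, PiLp.inner_apply]
      refine Finset.sum_congr rfl fun l _ => ?_
      simp [U, mul_comm]
    have hdetU : ‖U.det‖ = 1 := by
      have h := congrArg Matrix.det hUU
      rw [Matrix.det_mul, Matrix.det_conjTranspose, Matrix.det_one] at h
      have h2 := congrArg norm h
      rw [norm_mul, norm_star, norm_one] at h2
      nlinarith [norm_nonneg U.det]
    have hadj : U.adjugate = U.det • Matrix.conjTranspose U := by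
      calc U.adjugate = (Matrix.conjTranspose U * U) * U.adjugate := by rw [hUU, one_mul]
        _ = Matrix.conjTranspose U * (U * U.adjugate) := by rw [mul_assoc]
        _ = U.det • Matrix.conjTranspose U := by
            rw [Matrix.mul_adjugate, mul_smul_comm, mul_one]
    have h1 : ((C * U).adjugate.mulVec x) k =
        U.det * inner ℂ u (Matrix.toEuclideanCLM (n := κ) (𝕜 := ℂ) C.adjugate x) := by
      rw [Matrix.adjugate_mul_distrib, hadj, Matrix.smul_mul, Matrix.smul_mulVec, Pi.smul_apply,
        smul_eq_mul, ← Matrix.mulVec_mulVec, ← hvk, PiLp.inner_apply]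
      congr 1
      refine Finset.sum_congr rfl fun l _ => ?_
      simp [U, mul_comm]
    have h2 : ‖((C * U).adjugate.mulVec x) k‖ ≤ 1 := by
      rw [← Matrix.cramer_eq_adjugate_mulVec, Matrix.cramer_apply]
      apply norm_det_le_one_of_col
      intro j
      by_cases hj : j = k
      · subst hj
        have := EuclideanSpace.norm_sq_eq x
        rw [hx] at this
        simp only [Matrix.updateCol_self]
        linarith
      · simp only [Matrix.updateCol_ne hj]
        have h3 := (Matrix.toEuclideanCLM (n := κ) (𝕜 := ℂ) C).le_opNorm (v j)
        rw [v.orthonormal.1 j, mul_one] at h3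
        have h4 := pow_le_one₀ (norm_nonneg _) (h3.trans hC) (n := 2)
        rw [EuclideanSpace.norm_sq_eq] at h4
        refine le_trans (le_of_eq ?_) h4
        refine Finset.sum_congr rfl fun i _ => ?_
        rfl
    rw [h1, norm_mul, hdetU, one_mul] at h2
    exact h2
  refine ContinuousLinearMap.opNorm_le_bound _ zero_le_one fun x => ?_
  rw [one_mul]
  set y := Matrix.toEuclideanCLM (n := κ) (𝕜 := ℂ) C.adjugate x with hy
  by_cases hx : ‖x‖ = 0
  · have : x = 0 := norm_eq_zero.1 hx
    simp [hy, this]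
  by_cases hy0 : ‖y‖ = 0
  · rw [hy0]
    exact norm_nonneg _
  have h := key (((‖x‖⁻¹ : ℝ) : ℂ) • x) (((‖y‖⁻¹ : ℝ) : ℂ) • y)
    (by rw [norm_smul, Complex.norm_real, norm_inv, norm_norm, inv_mul_cancel₀ hx])
    (by rw [norm_smul, Complex.norm_real, norm_inv, norm_norm, inv_mul_cancel₀ hy0])
  rw [map_smul, ← hy, inner_smul_left, inner_smul_right, inner_self_eq_norm_sq_to_K, norm_mul,
    norm_mul, RCLike.norm_conj, Complex.norm_real, Complex.norm_real, norm_inv, norm_inv, norm_norm,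
    norm_norm, norm_pow, RCLike.norm_ofReal, abs_norm] at h
  have hxp : 0 < ‖x‖ := lt_of_le_of_ne (norm_nonneg _) (Ne.symm hx)
  have h5 : ‖y‖⁻¹ * (‖x‖⁻¹ * ‖y‖ ^ 2) = ‖y‖ / ‖x‖ := by
    field_simp
  rw [h5, div_le_one hxp] at h
  exact h

/-- Jacobi's formula. Differentiating the Leibniz expansion replaces one row at a time by the row of
`D`, and Cramer's rule turns the sum of these determinants into a trace against the adjugate. -/
theorem hasDerivAt_det_line (N D : Matrix κ κ ℂ) (t : ℝ) :
    HasDerivAt (fun s : ℝ => (N + (s : ℂ) • D).det)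
      ((D * (N + (t : ℂ) • D).adjugate).trace) t := by
  have h : ∀ i j, HasDerivAt (fun s : ℝ => (N + (s : ℂ) • D) i j) (D i j) t := by
    intro i j
    have := ((Complex.ofRealCLM.hasDerivAt (x := t)).mul_const (D i j)).const_add (N i j)
    simpa using this
  have h1 : HasDerivAt (fun s : ℝ => (N + (s : ℂ) • D).det)
      (∑ i, ((N + (t : ℂ) • D).updateRow i (D i)).det) t := by
    simp only [Matrix.det_apply]
    rw [Finset.sum_comm]
    refine HasDerivAt.fun_sum fun σ _ => ?_
    rw [← Finset.smul_sum]
    refine HasDerivAt.const_smul _ ?_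
    have h2 := HasDerivAt.fun_finsetProd (u := Finset.univ) (x := t)
      (f := fun i (s : ℝ) => (N + (s : ℂ) • D) (σ i) i) (f' := fun i => D (σ i) i)
      (fun i _ => h (σ i) i)
    refine h2.congr_deriv ?_
    symm
    rw [← Equiv.sum_comp σ]
    refine Finset.sum_congr rfl fun i _ => ?_
    rw [← Finset.mul_prod_erase Finset.univ _ (Finset.mem_univ i), Matrix.updateRow_self,
      smul_eq_mul, mul_comm]
    congr 1
    refine Finset.prod_congr rfl fun j hj => ?_
    rw [Matrix.updateRow_ne (fun hh => (Finset.ne_of_mem_erase hj) (σ.injective hh))]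
  refine h1.congr_deriv ?_
  symm
  simp only [Matrix.trace, Matrix.diag_apply]
  refine Finset.sum_congr rfl fun i _ => ?_
  rw [← Matrix.cramer_transpose_apply, Matrix.cramer_eq_adjugate_mulVec, ← Matrix.adjugate_transpose,
    Matrix.mulVec_transpose, Matrix.mul_apply]
  rfl

/-- If `|tr (D K)| ≤ r` for all contractions `K`, then the determinants of two contractions with
difference `D` differ by at most `r`. -/
theorem norm_det_sub_det_le {M N : Matrix κ κ ℂ} (hM : IsContraction M) (hN : IsContraction N)
    {r : ℝ} (hr : ∀ K : Matrix κ κ ℂ, IsContraction K → ‖((M - N) * K).trace‖ ≤ r) :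
    ‖M.det - N.det‖ ≤ r := by
  -- Mean value inequality on the segment from `N` to `M`: contractions form a convex set, and the
  -- derivative pairs `M - N` with an adjugate, which is a contraction.
  have h := norm_image_sub_le_of_norm_deriv_le_segment_01'
    (f := fun s : ℝ => (N + (s : ℂ) • (M - N)).det) (C := r)
    (fun t _ => (hasDerivAt_det_line N (M - N) t).hasDerivWithinAt)
    (fun t ht => hr _ (hN.lineMap hM ht.1 ht.2.le).adjugate)
  simpa using h

/-- The second order expansion of the determinant at `1`. -/
theorem norm_det_sub_one_sub_trace_le {A : Matrix κ κ ℂ} (hA : IsContraction (1 + A)) {r : ℝ}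
    (hr : ∀ K : Matrix κ κ ℂ, ‖(A * K).trace‖ ≤
      r * ‖Matrix.toEuclideanCLM (n := κ) (𝕜 := ℂ) K‖)
    (hr' : ‖Matrix.toEuclideanCLM (n := κ) (𝕜 := ℂ) A‖ ≤ r) :
    ‖(1 + A).det - 1 - A.trace‖ ≤ 2 * r ^ 2 := by
  have hr0 : 0 ≤ r := (norm_nonneg _).trans hr'
  have hc : ∀ t : ℝ, 0 ≤ t → t ≤ 1 → IsContraction (1 + (t : ℂ) • A) := by
    intro t h0 h1
    have := isContraction_one.lineMap hA h0 h1
    rwa [add_sub_cancel_left] at this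
  have hd : ∀ t : ℝ, 0 ≤ t → t ≤ 1 → ‖(1 + (t : ℂ) • A).det - 1‖ ≤ r := by
    intro t h0 h1
    have := norm_det_sub_det_le (hc t h0 h1) isContraction_one (r := r) (fun K hK => by
      rw [add_sub_cancel_left, Matrix.smul_mul, Matrix.trace_smul, norm_smul, Complex.norm_real,
        Real.norm_of_nonneg h0]
      have h2 := hr K
      have h3 : ‖Matrix.toEuclideanCLM (n := κ) (𝕜 := ℂ) K‖ ≤ 1 := hK
      calc t * ‖(A * K).trace‖ ≤ 1 * (r * 1) := by gcongr; exact h2.trans (by gcongr)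
        _ = r := by ring)
    rwa [Matrix.det_one] at this
  have hadj : ∀ t : ℝ, 0 ≤ t → t ≤ 1 →
      ‖Matrix.toEuclideanCLM (n := κ) (𝕜 := ℂ) ((1 + (t : ℂ) • A).adjugate - 1)‖ ≤ 2 * r := by
    intro t h0 h1
    set C := 1 + (t : ℂ) • A with hC
    -- Follows from `adj C * C = det C`; each of the two terms has norm at most `r`.
    have h2 : C.adjugate - 1 = (C.det - 1) • (1 : Matrix κ κ ℂ) - C.adjugate * ((t : ℂ) • A) := by
      have h3 : (t : ℂ) • A = C - 1 := by rw [hC]; abel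
      rw [h3, mul_sub, Matrix.adjugate_mul, mul_one, sub_smul, one_smul]
      abel
    rw [h2, map_sub, map_smul, map_mul, map_smul, map_one]
    have h4 : ‖Matrix.toEuclideanCLM (n := κ) (𝕜 := ℂ) C.adjugate‖ ≤ 1 := (hc t h0 h1).adjugate
    have h5 : ‖(1 : EuclideanSpace ℂ κ →L[ℂ] EuclideanSpace ℂ κ)‖ ≤ 1 :=
      ContinuousLinearMap.norm_id_le
    calc _ ≤ ‖C.det - 1‖ * ‖(1 : EuclideanSpace ℂ κ →L[ℂ] EuclideanSpace ℂ κ)‖ +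
          ‖Matrix.toEuclideanCLM (n := κ) (𝕜 := ℂ) C.adjugate‖ *
            (t * ‖Matrix.toEuclideanCLM (n := κ) (𝕜 := ℂ) A‖) := by
          refine (norm_sub_le _ _).trans (add_le_add (norm_smul _ _).le ?_)
          refine (norm_mul_le _ _).trans ?_
          rw [norm_smul, Complex.norm_real, Real.norm_of_nonneg h0]
      _ ≤ r * 1 + 1 * (1 * r) := by
          gcongr
          exact hd t h0 h1
      _ = 2 * r := by ring
  -- Removing the linear term leaves the derivative `tr (A (adj - 1))`, which is of second order in
  -- `r`.
  have h := norm_image_sub_le_of_norm_deriv_le_segment_01'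
    (f := fun s : ℝ => (1 + (s : ℂ) • A).det - (s : ℂ) * A.trace) (C := 2 * r ^ 2)
    (f' := fun t => (A * (1 + (t : ℂ) • A).adjugate).trace - 1 * A.trace)
    (fun t _ => ((hasDerivAt_det_line 1 A t).sub
      ((Complex.ofRealCLM.hasDerivAt (x := t)).mul_const A.trace)).hasDerivWithinAt)
    (fun t ht => by
      have h1 : (A * (1 + (t : ℂ) • A).adjugate).trace - 1 * A.trace =
          (A * ((1 + (t : ℂ) • A).adjugate - 1)).trace := by
        rw [mul_sub, Matrix.trace_sub, mul_one, one_mul]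
      rw [h1]
      calc _ ≤ r * _ := hr _
        _ ≤ r * (2 * r) := by gcongr; exact hadj t ht.1 ht.2.le
        _ = _ := by ring)
  have h6 : (1 + A).det - 1 - A.trace = ((1 + ((1 : ℝ) : ℂ) • A).det - ((1 : ℝ) : ℂ) * A.trace) -
      ((1 + ((0 : ℝ) : ℂ) • A).det - ((0 : ℝ) : ℂ) * A.trace) := by
    simp
    ring
  rw [h6]
  exact h

end Matrices

/-! ### Hilbert–Schmidt operators as a two-sided ideal -/

section HilbertSchmidt

variable {H : Type*} [NormedAddCommGroup H] [InnerProductSpace ℂ H] [CompleteSpace H]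
variable {H' : Type*} [NormedAddCommGroup H'] [InnerProductSpace ℂ H'] [CompleteSpace H']
variable {K : Type*} [NormedAddCommGroup K] [InnerProductSpace ℂ K] [CompleteSpace K]
variable {ι ι' κ : Type*}

theorem hasSum_sq_norm_inner (b : HilbertBasis ι ℂ H) (x : H) :
    HasSum (fun i => ‖inner ℂ (b i) x‖ ^ 2) (‖x‖ ^ 2) := by
  have h2 : (0 : ℝ) < (2 : ℝ≥0∞).toReal := by simp
  have := lp.hasSum_norm h2 (b.repr x)
  simpa [b.repr_apply_apply] using this

theorem tsum_enorm_inner_sq (b : HilbertBasis ι ℂ H) (x : H) :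
    ∑' i, ‖inner ℂ (b i) x‖ₑ ^ 2 = ‖x‖ₑ ^ 2 := by
  have h := hasSum_sq_norm_inner b x
  have h2 := ENNReal.ofReal_tsum_of_nonneg (fun i => sq_nonneg ‖inner ℂ (b i) x‖) h.summable
  rw [h.tsum_eq] at h2
  simpa [ENNReal.ofReal_pow] using h2.symm

/-- The square of the Hilbert-Schmidt norm, as an extended number. -/
def hsSq (b : HilbertBasis ι ℂ H) (T : H →L[ℂ] K) : ℝ≥0∞ := ∑' i, ‖T (b i)‖ₑ ^ 2

/-- Parseval turns both sides into the double sum of `|⟨c j, T (b i)⟩|²`. With values in `ℝ≥0∞` the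
order of summation can be exchanged without any summability. -/
theorem hsSq_adjoint (b : HilbertBasis ι ℂ H) (c : HilbertBasis κ ℂ K) (T : H →L[ℂ] K) :
    hsSq c (ContinuousLinearMap.adjoint T) = hsSq b T := by
  simp only [hsSq, ← tsum_enorm_inner_sq b (ContinuousLinearMap.adjoint T _),
    ← tsum_enorm_inner_sq c (T _)]
  rw [ENNReal.tsum_comm]
  refine tsum_congr fun i => tsum_congr fun j => ?_
  rw [ContinuousLinearMap.adjoint_inner_right, ← ofReal_norm, ← ofReal_norm, norm_inner_symm]

theorem hsSq_comp_left (b : HilbertBasis ι ℂ H) (S : K →L[ℂ] H') (T : H →L[ℂ] K) :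
    hsSq b (S ∘L T) ≤ ‖S‖ₑ ^ 2 * hsSq b T := by
  rw [hsSq, hsSq, ← ENNReal.tsum_mul_left]
  refine ENNReal.tsum_le_tsum fun i => ?_
  rw [← mul_pow]
  gcongr
  exact S.le_opENorm _

/-- Adjoints reduce right multiplication to left multiplication; the basis `d` serves only this
passage. -/
theorem hsSq_comp_right (b : HilbertBasis ι ℂ H) (c : HilbertBasis ι' ℂ H')
    (d : HilbertBasis κ ℂ K) (T : H →L[ℂ] K) (R : H' →L[ℂ] H) :
    hsSq c (T ∘L R) ≤ ‖R‖ₑ ^ 2 * hsSq b T := by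
  rw [← hsSq_adjoint c d, ← hsSq_adjoint b d, ContinuousLinearMap.adjoint_comp]
  refine (hsSq_comp_left _ _ _).trans ?_
  gcongr
  rw [← ofReal_norm, ← ofReal_norm, LinearIsometryEquiv.norm_map]

theorem isHilbertSchmidt_iff_hsSq (b : HilbertBasis ι ℂ H) (T : H →L[ℂ] H) :
    IsHilbertSchmidt b T ↔ hsSq b T ≠ ⊤ := by
  have h2 : (0 : ℝ) < (2 : ℝ≥0∞).toReal := by simp
  rw [IsHilbertSchmidt, memℓp_gen_iff h2, hsSq]
  have h : ∀ i, ‖T (b i)‖ₑ ^ 2 = ((‖T (b i)‖₊ ^ 2 : NNReal) : ℝ≥0∞) := by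
    intro i
    rw [ENNReal.coe_pow]
    rfl
  simp only [h]
  rw [ENNReal.tsum_coe_ne_top_iff_summable, ← NNReal.summable_coe]
  simp

theorem IsHilbertSchmidt.star' {b : HilbertBasis ι ℂ H} {T : H →L[ℂ] H}
    (hT : IsHilbertSchmidt b T) : IsHilbertSchmidt b (star T) := by
  rw [isHilbertSchmidt_iff_hsSq] at hT ⊢
  rwa [ContinuousLinearMap.star_eq_adjoint, hsSq_adjoint b]

theorem IsHilbertSchmidt.mul_left {b : HilbertBasis ι ℂ H} {T : H →L[ℂ] H}
    (hT : IsHilbertSchmidt b T) (S : H →L[ℂ] H) : IsHilbertSchmidt b (S * T) := by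
  rw [isHilbertSchmidt_iff_hsSq] at hT ⊢
  exact ne_top_of_le_ne_top (ENNReal.mul_ne_top (by simp) hT) (hsSq_comp_left b S T)

theorem IsHilbertSchmidt.mul_right {b : HilbertBasis ι ℂ H} {T : H →L[ℂ] H}
    (hT : IsHilbertSchmidt b T) (S : H →L[ℂ] H) : IsHilbertSchmidt b (T * S) := by
  rw [isHilbertSchmidt_iff_hsSq] at hT ⊢
  exact ne_top_of_le_ne_top (ENNReal.mul_ne_top (by simp) hT) (hsSq_comp_right b b b T S)

end HilbertSchmidt

/-! ### Trace class operators: ideal property, trace, rank one operators -/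

section TraceClass

variable {H : Type*} [NormedAddCommGroup H] [InnerProductSpace ℂ H] [CompleteSpace H]
variable {ι κ : Type*} [Fintype κ] [DecidableEq κ]

theorem norm_tracePairing_le (T : TraceClassOp H) (j : ContractionPair H) :
    ‖tracePairing (TraceClassOp.op H T) j‖ ≤ ‖T‖ :=
  lp.norm_apply_le_norm (by simp) (TraceClassOp.toLp H T) j

/-- A trace class operator as an element of `L¹`. -/
def TraceClassOp.mk (T : H →L[ℂ] H) (hT : IsTraceClass T) : TraceClassOp H := ⟨T, hT⟩

theorem TraceClassOp.op_mk (T : H →L[ℂ] H) (hT : IsTraceClass T) :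
    TraceClassOp.op H (TraceClassOp.mk T hT) = T := rfl

theorem isTraceClass_of_bound {T : H →L[ℂ] H} {C : ℝ} (h : ∀ j, ‖tracePairing T j‖ ≤ C) :
    IsTraceClass T := by
  apply memℓp_infty
  exact ⟨C, by rintro _ ⟨j, rfl⟩; exact h j⟩

theorem TraceClassOp.norm_le_of_bound {T : TraceClassOp H} {C : ℝ} (hC : 0 ≤ C)
    (h : ∀ j, ‖tracePairing (TraceClassOp.op H T) j‖ ≤ C) : ‖T‖ ≤ C :=
  lp.norm_le_of_forall_le hC h

/-- The trace norm is defined by contractions from `ℂⁿ`; reindexing and homogeneity extend the bound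
to any finite index type and any bounded maps. -/
theorem TraceClassOp.norm_pairing_le (T : TraceClassOp H) (Φ Ψ : EuclideanSpace ℂ κ →L[ℂ] H) :
    ‖∑ k, inner ℂ (Ψ (EuclideanSpace.single k 1))
      (TraceClassOp.op H T (Φ (EuclideanSpace.single k 1)))‖ ≤ ‖Ψ‖ * ‖Φ‖ * ‖T‖ := by
  have key : ∀ Φ Ψ : EuclideanSpace ℂ κ →L[ℂ] H, ‖Φ‖ ≤ 1 → ‖Ψ‖ ≤ 1 →
      ‖∑ k, inner ℂ (Ψ (EuclideanSpace.single k 1))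
        (TraceClassOp.op H T (Φ (EuclideanSpace.single k 1)))‖ ≤ ‖T‖ := by
    intro Φ Ψ hΦ hΨ
    let e := (Fintype.equivFin κ).symm
    let L : EuclideanSpace ℂ (Fin (Fintype.card κ)) →L[ℂ] EuclideanSpace ℂ κ :=
      (LinearIsometryEquiv.piLpCongrLeft 2 ℂ ℂ e).toContinuousLinearEquiv.toContinuousLinearMap
    have hL : ‖L‖ ≤ 1 := (LinearIsometryEquiv.piLpCongrLeft 2 ℂ ℂ e).toLinearIsometry.norm_toContinuousLinearMap_le
    have hb : ∀ Θ : EuclideanSpace ℂ κ →L[ℂ] H, ‖Θ‖ ≤ 1 → ‖Θ ∘L L‖ ≤ 1 := fun Θ hΘ =>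
      (ContinuousLinearMap.opNorm_comp_le _ _).trans (mul_le_one₀ hΘ (norm_nonneg _) hL)
    have h := norm_tracePairing_le T ⟨_, ⟨(Φ ∘L L, Ψ ∘L L), hb Φ hΦ, hb Ψ hΨ⟩⟩
    have hs : ∀ i, L (EuclideanSpace.single i 1) = EuclideanSpace.single (e i) 1 := fun i =>
      LinearIsometryEquiv.piLpCongrLeft_single e i 1
    simp only [tracePairing, ContinuousLinearMap.comp_apply, hs] at h
    rwa [Equiv.sum_comp e (fun k => inner ℂ (Ψ (EuclideanSpace.single k 1))
      (TraceClassOp.op H T (Φ (EuclideanSpace.single k 1))))] at h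
  by_cases hΦ : ‖Φ‖ = 0
  · have : Φ = 0 := norm_eq_zero.1 hΦ
    simp [this]
  by_cases hΨ : ‖Ψ‖ = 0
  · have : Ψ = 0 := norm_eq_zero.1 hΨ
    simp [this]
  have hn : ∀ Θ : EuclideanSpace ℂ κ →L[ℂ] H, ‖Θ‖ ≠ 0 → ‖((‖Θ‖⁻¹ : ℝ) : ℂ) • Θ‖ ≤ 1 := by
    intro Θ hΘ
    rw [norm_smul, Complex.norm_real, norm_inv, norm_norm, inv_mul_cancel₀ hΘ]
  have h := key _ _ (hn Φ hΦ) (hn Ψ hΨ)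
  simp only [smul_apply, map_smul, inner_smul_left, inner_smul_right,
    ← mul_assoc, ← Finset.mul_sum, norm_mul, RCLike.norm_conj, Complex.norm_real, norm_inv,
    norm_norm] at h
  have hΦ' : 0 < ‖Φ‖ := lt_of_le_of_ne (norm_nonneg _) (Ne.symm hΦ)
  have hΨ' : 0 < ‖Ψ‖ := lt_of_le_of_ne (norm_nonneg _) (Ne.symm hΨ)
  rw [← mul_inv, inv_mul_le_iff₀ (by positivity)] at h
  linarith [mul_comm ‖Φ‖ ‖Ψ‖, h]

/-- The one-dimensional case of the pairing, that is, the trace against a rank one operator. -/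
theorem TraceClassOp.norm_inner_le (T : TraceClassOp H) (x y : H) :
    ‖inner ℂ y (TraceClassOp.op H T x)‖ ≤ ‖y‖ * ‖x‖ * ‖T‖ := by
  let Φ : H → (EuclideanSpace ℂ (Fin 1) →L[ℂ] H) := fun z =>
    (EuclideanSpace.proj (0 : Fin 1) : EuclideanSpace ℂ (Fin 1) →L[ℂ] ℂ).smulRight z
  have hΦ : ∀ z, ‖Φ z‖ ≤ ‖z‖ := by
    intro z
    refine ContinuousLinearMap.opNorm_le_bound _ (norm_nonneg _) fun v => ?_
    have h1 : ‖v 0‖ ≤ ‖v‖ := PiLp.norm_apply_le v 0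
    have : ‖Φ z v‖ = ‖v 0‖ * ‖z‖ := by simp [Φ, norm_smul]
    rw [this, mul_comm]
    gcongr
  have h := T.norm_pairing_le (Φ x) (Φ y)
  have h2 : ∀ z, Φ z (EuclideanSpace.single 0 1) = z := by
    intro z
    simp [Φ]
  rw [Fin.sum_univ_one, h2, h2] at h
  refine h.trans ?_
  gcongr <;> exact hΦ _

theorem TraceClassOp.norm_op_le (T : TraceClassOp H) : ‖TraceClassOp.op H T‖ ≤ ‖T‖ := by
  refine ContinuousLinearMap.opNorm_le_bound _ (norm_nonneg _) fun x => ?_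
  have h := T.norm_inner_le x (TraceClassOp.op H T x)
  rw [inner_self_eq_norm_sq_to_K, norm_pow, RCLike.norm_ofReal, abs_norm] at h
  by_cases h0 : ‖TraceClassOp.op H T x‖ = 0
  · rw [h0]
    positivity
  · have hp : 0 < ‖TraceClassOp.op H T x‖ := lt_of_le_of_ne (norm_nonneg _) (Ne.symm h0)
    have : ‖TraceClassOp.op H T x‖ * ‖TraceClassOp.op H T x‖ ≤
      ‖TraceClassOp.op H T x‖ * (‖T‖ * ‖x‖) := by nlinarith
    exact le_of_mul_le_mul_left this hp

variable (H) in
/-- The inclusion of the trace class operators into the bounded operators. -/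
def TraceClassOp.opL : TraceClassOp H →L[ℂ] (H →L[ℂ] H) :=
  LinearMap.mkContinuous (TraceClassOp.op H) 1 fun T => by
    rw [one_mul]
    exact T.norm_op_le

theorem TraceClassOp.opL_apply (T : TraceClassOp H) :
    TraceClassOp.opL H T = TraceClassOp.op H T := rfl

theorem TraceClassOp.op_injective : Function.Injective (TraceClassOp.op H) :=
  Subtype.val_injective

/-- The bounded factor is absorbed by the pair: `B T` against `(Φ, Ψ)` is `T` against `(Φ, B* Ψ)`.
With its mirror image this makes `L¹` a two-sided ideal. -/
theorem norm_tracePairing_mul_left_le (B : H →L[ℂ] H) (T : TraceClassOp H) (j : ContractionPair H) :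
    ‖tracePairing (B * TraceClassOp.op H T) j‖ ≤ ‖B‖ * ‖T‖ := by
  obtain ⟨n, ⟨⟨Φ, Ψ⟩, hΦ, hΨ⟩⟩ := j
  have h := T.norm_pairing_le Φ (star B ∘L Ψ)
  simp only [ContinuousLinearMap.comp_apply, ContinuousLinearMap.star_eq_adjoint,
    ContinuousLinearMap.adjoint_inner_left] at h
  refine h.trans ?_
  have h2 : ‖ContinuousLinearMap.adjoint B ∘L Ψ‖ ≤ ‖B‖ * 1 := by
    refine (ContinuousLinearMap.opNorm_comp_le _ _).trans ?_
    rw [LinearIsometryEquiv.norm_map]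
    gcongr
  calc _ ≤ (‖B‖ * 1) * 1 * ‖T‖ := by gcongr
    _ = _ := by ring

theorem norm_tracePairing_mul_right_le (B : H →L[ℂ] H) (T : TraceClassOp H)
    (j : ContractionPair H) : ‖tracePairing (TraceClassOp.op H T * B) j‖ ≤ ‖B‖ * ‖T‖ := by
  obtain ⟨n, ⟨⟨Φ, Ψ⟩, hΦ, hΨ⟩⟩ := j
  have h := T.norm_pairing_le (B ∘L Φ) Ψ
  refine h.trans ?_
  have h2 : ‖B ∘L Φ‖ ≤ ‖B‖ * 1 := by
    refine (ContinuousLinearMap.opNorm_comp_le _ _).trans ?_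
    gcongr
  calc _ ≤ 1 * (‖B‖ * 1) * ‖T‖ := by gcongr
    _ = _ := by ring

theorem IsTraceClass.mul_left {T : H →L[ℂ] H} (hT : IsTraceClass T) (B : H →L[ℂ] H) :
    IsTraceClass (B * T) :=
  isTraceClass_of_bound (norm_tracePairing_mul_left_le B ⟨T, hT⟩)

theorem IsTraceClass.mul_right {T : H →L[ℂ] H} (hT : IsTraceClass T) (B : H →L[ℂ] H) :
    IsTraceClass (T * B) :=
  isTraceClass_of_bound (norm_tracePairing_mul_right_le B ⟨T, hT⟩)

theorem IsTraceClass.add {S T : H →L[ℂ] H} (hS : IsTraceClass S) (hT : IsTraceClass T) :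
    IsTraceClass (S + T) := (traceClassSubmodule H).add_mem hS hT

theorem IsTraceClass.smul {T : H →L[ℂ] H} (c : ℂ) (hT : IsTraceClass T) :
    IsTraceClass (c • T) := (traceClassSubmodule H).smul_mem c hT

variable (H) in
/-- The product `(B, T) ↦ B T` of a bounded and a trace class operator. -/
def TraceClassOp.mulL : (H →L[ℂ] H) →L[ℂ] TraceClassOp H →L[ℂ] TraceClassOp H :=
  LinearMap.mkContinuous₂
    (LinearMap.mk₂ ℂ (fun B T => (⟨B * TraceClassOp.op H T, IsTraceClass.mul_left T.2 B⟩ : TraceClassOp H))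
      (fun B B' T => Subtype.ext (add_mul B B' _))
      (fun c B T => Subtype.ext (smul_mul_assoc c B _))
      (fun B T T' => Subtype.ext (mul_add B _ _))
      (fun c B T => Subtype.ext (mul_smul_comm c B _))) 1
    (fun B T => by
      rw [one_mul]
      exact TraceClassOp.norm_le_of_bound (by positivity) (norm_tracePairing_mul_left_le B T))

variable (H) in
/-- The product `(B, T) ↦ T B` of a bounded and a trace class operator. -/
def TraceClassOp.mulR : (H →L[ℂ] H) →L[ℂ] TraceClassOp H →L[ℂ] TraceClassOp H :=
  LinearMap.mkContinuous₂
    (LinearMap.mk₂ ℂ (fun B T => (⟨TraceClassOp.op H T * B, IsTraceClass.mul_right T.2 B⟩ : TraceClassOp H))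
      (fun B B' T => Subtype.ext (mul_add _ B B'))
      (fun c B T => Subtype.ext (mul_smul_comm c _ B))
      (fun B T T' => Subtype.ext (add_mul _ _ B))
      (fun c B T => Subtype.ext (smul_mul_assoc c _ B))) 1
    (fun B T => by
      rw [one_mul]
      exact TraceClassOp.norm_le_of_bound (by positivity) (norm_tracePairing_mul_right_le B T))

theorem TraceClassOp.op_mulL (B : H →L[ℂ] H) (T : TraceClassOp H) :
    TraceClassOp.op H (TraceClassOp.mulL H B T) = B * TraceClassOp.op H T := rfl

theorem TraceClassOp.op_mulR (B : H →L[ℂ] H) (T : TraceClassOp H) :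
    TraceClassOp.op H (TraceClassOp.mulR H B T) = TraceClassOp.op H T * B := rfl

theorem TraceClassOp.norm_mulL_le (B : H →L[ℂ] H) (T : TraceClassOp H) :
    ‖TraceClassOp.mulL H B T‖ ≤ ‖B‖ * ‖T‖ :=
  TraceClassOp.norm_le_of_bound (by positivity) (norm_tracePairing_mul_left_le B T)

theorem IsTraceClass.star' {T : H →L[ℂ] H} (hT : IsTraceClass T) : IsTraceClass (star T) := by
  refine isTraceClass_of_bound (C := ‖TraceClassOp.mk T hT‖) ?_
  rintro ⟨n, ⟨⟨Φ, Ψ⟩, hΦ, hΨ⟩⟩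
  have h := norm_tracePairing_le (TraceClassOp.mk T hT) ⟨n, ⟨⟨Ψ, Φ⟩, hΨ, hΦ⟩⟩
  refine le_trans (le_of_eq ?_) h
  rw [← RCLike.norm_conj]
  simp only [tracePairing, map_sum]
  congr 1
  refine Finset.sum_congr rfl fun i _ => ?_
  rw [inner_conj_symm, ContinuousLinearMap.star_eq_adjoint, ContinuousLinearMap.adjoint_inner_left]
  rfl

/-- The inclusion of the coordinate subspace spanned by finitely many vectors of a basis. -/
def coordIncl (b : HilbertBasis ι ℂ H) (s : Finset ι) : EuclideanSpace ℂ s →L[ℂ] H :=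
  ∑ i : s, (EuclideanSpace.proj i : EuclideanSpace ℂ s →L[ℂ] ℂ).smulRight (b i)

theorem coordIncl_apply (b : HilbertBasis ι ℂ H) (s : Finset ι) (x : EuclideanSpace ℂ s) :
    coordIncl b s x = ∑ i : s, x i • b i := by
  simp [coordIncl]

theorem coordIncl_single [DecidableEq ι] (b : HilbertBasis ι ℂ H) (s : Finset ι) (i : s) :
    coordIncl b s (EuclideanSpace.single i 1) = b i := by
  rw [coordIncl_apply, Finset.sum_eq_single i]
  · simp
  · intro j _ hj
    simp [hj]
  · simp

theorem inner_coordIncl (b : HilbertBasis ι ℂ H) (s : Finset ι) (x y : EuclideanSpace ℂ s) :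
    inner ℂ (coordIncl b s x) (coordIncl b s y) = inner ℂ x y := by
  have ho : Orthonormal ℂ (fun i : s => b i) := b.orthonormal.comp _ Subtype.val_injective
  rw [coordIncl_apply, coordIncl_apply, ho.inner_sum, PiLp.inner_apply]
  refine Finset.sum_congr rfl fun i _ => ?_
  simp [mul_comm]

theorem norm_coordIncl_apply (b : HilbertBasis ι ℂ H) (s : Finset ι) (x : EuclideanSpace ℂ s) :
    ‖coordIncl b s x‖ = ‖x‖ := by
  rw [@norm_eq_sqrt_re_inner ℂ, @norm_eq_sqrt_re_inner ℂ, inner_coordIncl]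

theorem norm_coordIncl_le (b : HilbertBasis ι ℂ H) (s : Finset ι) : ‖coordIncl b s‖ ≤ 1 :=
  ContinuousLinearMap.opNorm_le_bound _ zero_le_one fun x => by rw [norm_coordIncl_apply, one_mul]

/-- A diagonal matrix of phases turns every diagonal entry into its absolute value, so the whole sum
is a single trace pairing with a finite rank contraction. -/
theorem TraceClassOp.sum_norm_inner_basis_le (b : HilbertBasis ι ℂ H) (T : TraceClassOp H)
    (s : Finset ι) : ∑ i ∈ s, ‖inner ℂ (b i) (TraceClassOp.op H T (b i))‖ ≤ ‖T‖ := by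
  classical
  let z : s → ℂ := fun i => inner ℂ (b i) (TraceClassOp.op H T (b i))
  -- When `z i = 0`, division by zero makes `u i = 0`, which still has modulus at most one.
  let u : s → ℂ := fun i => starRingEnd ℂ (z i) / ‖z i‖
  have hu : ∀ i, ‖u i‖ ≤ 1 := by
    intro i
    simp only [u, norm_div, RCLike.norm_conj, Complex.norm_real, norm_norm]
    exact div_self_le_one _
  have huz : ∀ i, u i * z i = ‖z i‖ := by
    intro i
    by_cases h : z i = 0
    · simp [h]
    · have h2 : (‖z i‖ : ℂ) ≠ 0 := by exact_mod_cast norm_ne_zero_iff.2 h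
      simp only [u]
      rw [div_mul_eq_mul_div, Complex.conj_mul', sq, mul_div_assoc, div_self h2, mul_one]
  let D := Matrix.toEuclideanCLM (n := s) (𝕜 := ℂ) (Matrix.diagonal u)
  have hD : ‖D‖ ≤ 1 := by
    refine ContinuousLinearMap.opNorm_le_bound _ zero_le_one fun x => ?_
    rw [one_mul, EuclideanSpace.norm_eq, EuclideanSpace.norm_eq]
    apply Real.sqrt_le_sqrt
    refine Finset.sum_le_sum fun i _ => ?_
    have : (D x) i = u i * x i := by
      change (Matrix.diagonal u).mulVec x i = _
      rw [Matrix.mulVec_diagonal]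
    rw [this, norm_mul]
    have := mul_le_of_le_one_left (norm_nonneg (x i)) (hu i)
    gcongr
  have hDs : ∀ i, D (EuclideanSpace.single i 1) = u i • EuclideanSpace.single i 1 := by
    intro i
    ext j
    change (Matrix.diagonal u).mulVec _ j = _
    rw [Matrix.mulVec_diagonal]
    by_cases h : j = i
    · subst h
      simp
    · simp [h]
  have h := T.norm_pairing_le (coordIncl b s ∘L D) (coordIncl b s)
  simp only [ContinuousLinearMap.comp_apply, hDs, map_smul, coordIncl_single,
    inner_smul_right] at h
  have h1 : ∑ i : s, u i * inner ℂ (b i) (TraceClassOp.op H T (b i)) =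
      ((∑ i ∈ s, ‖inner ℂ (b i) (TraceClassOp.op H T (b i))‖ : ℝ) : ℂ) := by
    rw [Complex.ofReal_sum, ← Finset.sum_coe_sort s]
    exact Finset.sum_congr rfl fun i _ => huz i
  rw [h1, Complex.norm_real, Real.norm_of_nonneg (Finset.sum_nonneg fun i _ => norm_nonneg _)] at h
  refine h.trans ?_
  have h3 : ‖coordIncl b s ∘L D‖ ≤ 1 :=
    (ContinuousLinearMap.opNorm_comp_le _ _).trans
      (mul_le_one₀ (norm_coordIncl_le b s) (norm_nonneg _) hD)
  calc _ ≤ 1 * 1 * ‖T‖ := by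
        gcongr
        exact norm_coordIncl_le b s
    _ = ‖T‖ := by ring

theorem TraceClassOp.summable_norm_inner (b : HilbertBasis ι ℂ H) (T : TraceClassOp H) :
    Summable fun i => ‖inner ℂ (b i) (TraceClassOp.op H T (b i))‖ :=
  summable_of_sum_le (fun _ => norm_nonneg _) (T.sum_norm_inner_basis_le b)

theorem IsTraceClass.summable_inner (b : HilbertBasis ι ℂ H) {T : H →L[ℂ] H}
    (hT : IsTraceClass T) : Summable fun i => inner ℂ (b i) (T (b i)) :=
  (TraceClassOp.summable_norm_inner b ⟨T, hT⟩).of_norm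

/-- The trace as a bounded linear functional on the trace class operators. -/
def TraceClassOp.traceL (b : HilbertBasis ι ℂ H) : TraceClassOp H →L[ℂ] ℂ :=
  LinearMap.mkContinuous
    { toFun T := opTrace b (TraceClassOp.op H T)
      map_add' S T := by
        simp only [opTrace, map_add, add_apply, inner_add_right]
        exact (IsTraceClass.summable_inner b S.2).tsum_add (IsTraceClass.summable_inner b T.2)
      map_smul' c T := by
        simp only [opTrace, map_smul, smul_apply, inner_smul_right, RingHom.id_apply, smul_eq_mul]
        exact tsum_mul_left }
    1 (fun T => by
      rw [one_mul]
      change ‖∑' i, _‖ ≤ _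
      refine (norm_tsum_le_tsum_norm (T.summable_norm_inner b)).trans ?_
      exact (T.summable_norm_inner b).tsum_le_of_sum_le (T.sum_norm_inner_basis_le b))

theorem TraceClassOp.traceL_apply (b : HilbertBasis ι ℂ H) (T : TraceClassOp H) :
    TraceClassOp.traceL b T = opTrace b (TraceClassOp.op H T) := rfl

theorem opTrace_add (b : HilbertBasis ι ℂ H) {S T : H →L[ℂ] H} (hS : IsTraceClass S)
    (hT : IsTraceClass T) : opTrace b (S + T) = opTrace b S + opTrace b T :=
  map_add (TraceClassOp.traceL b) ⟨S, hS⟩ ⟨T, hT⟩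

/-- Its pairing with `(Φ, Ψ)` collapses to the single number `⟨y, Φ Ψ* x⟩`. -/
theorem isTraceClass_rankOne (x y : H) : IsTraceClass (InnerProductSpace.rankOne ℂ x y) := by
  refine isTraceClass_of_bound (C := ‖x‖ * ‖y‖) ?_
  rintro ⟨n, ⟨⟨Φ, Ψ⟩, hΦ, hΨ⟩⟩
  have h : tracePairing (InnerProductSpace.rankOne ℂ x y) ⟨n, ⟨⟨Φ, Ψ⟩, hΦ, hΨ⟩⟩ =
      inner ℂ y (Φ (ContinuousLinearMap.adjoint Ψ x)) := by
    have h2 := (EuclideanSpace.basisFun (Fin n) ℂ).sum_repr (ContinuousLinearMap.adjoint Ψ x)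
    conv_rhs => rw [← h2]
    simp only [tracePairing, map_sum, inner_sum, map_smul, inner_smul_right]
    refine Finset.sum_congr rfl fun i _ => ?_
    rw [OrthonormalBasis.repr_apply_apply, InnerProductSpace.rankOne_apply, inner_smul_right,
      EuclideanSpace.basisFun_apply, ContinuousLinearMap.adjoint_inner_right, mul_comm]
  rw [h]
  calc _ ≤ ‖y‖ * ‖Φ (ContinuousLinearMap.adjoint Ψ x)‖ := norm_inner_le_norm _ _
    _ ≤ ‖y‖ * (1 * (1 * ‖x‖)) := by
        gcongr
        refine (Φ.le_of_opNorm_le hΦ _).trans ?_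
        gcongr
        refine (ContinuousLinearMap.adjoint Ψ).le_of_opNorm_le ?_ _
        rwa [LinearIsometryEquiv.norm_map]
    _ = _ := by ring

end TraceClass

/-! ### Trace norm convergence of finite sections -/

section Approximation

variable {H : Type*} [NormedAddCommGroup H] [InnerProductSpace ℂ H] [CompleteSpace H]
variable {ι : Type*}

/-- The Hilbert-Schmidt norm. -/
def hsNorm (b : HilbertBasis ι ℂ H) (T : H →L[ℂ] H) : ℝ := Real.sqrt (hsSq b T).toReal

/-- The left side is the squared Hilbert–Schmidt norm of `C ∘ Φ`, computed in the standard basis of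
`ℂⁿ`. -/
theorem sum_norm_sq_comp_le (b : HilbertBasis ι ℂ H) {C : H →L[ℂ] H} (hC : IsHilbertSchmidt b C)
    {n : ℕ} (Φ : EuclideanSpace ℂ (Fin n) →L[ℂ] H) (hΦ : ‖Φ‖ ≤ 1) :
    ∑ k, ‖C (Φ (EuclideanSpace.single k 1))‖ ^ 2 ≤ (hsSq b C).toReal := by
  have h := hsSq_comp_right b (EuclideanSpace.basisFun (Fin n) ℂ).toHilbertBasis b C Φ
  have h1 : ‖Φ‖ₑ ^ 2 ≤ 1 := by
    refine pow_le_one₀ (by simp) ?_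
    rw [← ofReal_norm]
    exact ENNReal.ofReal_le_one.2 hΦ
  have h2 : hsSq (EuclideanSpace.basisFun (Fin n) ℂ).toHilbertBasis (C ∘L Φ) ≤ hsSq b C :=
    h.trans (mul_le_of_le_one_left (by simp) h1)
  have h3 := ENNReal.toReal_mono ((isHilbertSchmidt_iff_hsSq b C).1 hC) h2
  refine le_trans (le_of_eq ?_) h3
  rw [hsSq, tsum_fintype, ENNReal.toReal_sum (by simp)]
  simp

/-- Moving `B*` across the inner product leaves a Cauchy–Schwarz sum. Thus the trace norm of `B* C`
is controlled by two Hilbert–Schmidt norms. -/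
theorem norm_tracePairing_star_mul_le (b : HilbertBasis ι ℂ H) {B C : H →L[ℂ] H}
    (hB : IsHilbertSchmidt b B) (hC : IsHilbertSchmidt b C) (j : ContractionPair H) :
    ‖tracePairing (star B * C) j‖ ≤ hsNorm b B * hsNorm b C := by
  obtain ⟨n, ⟨⟨Φ, Ψ⟩, hΦ, hΨ⟩⟩ := j
  simp only [tracePairing, mul_apply_eq_comp, ContinuousLinearMap.star_eq_adjoint,
    ContinuousLinearMap.adjoint_inner_right]
  have h1 : ‖∑ k, inner ℂ (B (Ψ (EuclideanSpace.single k 1))) (C (Φ (EuclideanSpace.single k 1)))‖ ≤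
      ∑ k, ‖B (Ψ (EuclideanSpace.single k 1))‖ * ‖C (Φ (EuclideanSpace.single k 1))‖ :=
    (norm_sum_le _ _).trans (Finset.sum_le_sum fun k _ => norm_inner_le_norm _ _)
  refine h1.trans ?_
  rw [hsNorm, hsNorm, ← Real.sqrt_mul ENNReal.toReal_nonneg]
  apply Real.le_sqrt_of_sq_le
  refine (Finset.sum_mul_sq_le_sq_mul_sq _ _ _).trans ?_
  have hb := sum_norm_sq_comp_le b hB Ψ hΨ
  have hc := sum_norm_sq_comp_le b hC Φ hΦ
  gcongr

/-- As `h(T)` is self-adjoint with square `|T|`, the sum of the `‖h(T) b_i‖²` is a sum of diagonal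
entries of `|T|`. If the sign function were continuous, `|T| = sgn(T) T` would bound this by the
trace norm of `T`; a continuous approximation of the sign does so up to an error. -/
theorem isHilbertSchmidt_cfc_of_sq_eq_abs (b : HilbertBasis ι ℂ H) {T : H →L[ℂ] H}
    (hT : IsTraceClass T) (hsa : IsSelfAdjoint T) {h : ℝ → ℝ} (hc : Continuous h)
    (hh : ∀ x, h x * h x = |x|) : IsHilbertSchmidt b (cfc h T) := by
  have hsum : ∀ s : Finset ι, ∑ i ∈ s, ‖cfc h T (b i)‖ ^ 2 ≤ ‖TraceClassOp.mk T hT‖ := by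
    intro s
    have hsq : ∀ i, ‖cfc h T (b i)‖ ^ 2 = (inner ℂ (b i) (cfc (fun x : ℝ => |x|) T (b i))).re := by
      intro i
      have h1 : cfc (fun x : ℝ => |x|) T = cfc h T * cfc h T := by
        rw [← cfc_mul h h T hc.continuousOn hc.continuousOn]
        simp only [hh]
      have h2 : IsSelfAdjoint (cfc h T) := cfc_predicate h T
      rw [h1, mul_apply_eq_comp, ← h2.star_eq, ContinuousLinearMap.star_eq_adjoint,
        ContinuousLinearMap.adjoint_inner_right, ← ContinuousLinearMap.star_eq_adjoint, h2.star_eq,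
        inner_self_eq_norm_sq_to_K]
      norm_cast
    have hε : ∀ ε : ℝ, 0 < ε → ∑ i ∈ s, ‖cfc h T (b i)‖ ^ 2 ≤
        ‖TraceClassOp.mk T hT‖ + s.card * ε := by
      intro ε hε
      -- A continuous substitute for the sign, bounded by one; `k x * x` differs from `|x|` by `|x|
      -- ε / (|x| + ε) ≤ ε`.
      let k : ℝ → ℝ := fun x => x / (|x| + ε)
      have hkc : Continuous k :=
        continuous_id.div (continuous_abs.add continuous_const) fun x => by positivity
      have hk1 : ‖cfc k T‖ ≤ 1 := by
        refine norm_cfc_le zero_le_one fun x _ => ?_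
        simp only [k, norm_div, Real.norm_eq_abs]
        rw [abs_of_pos (by positivity : 0 < |x| + ε), div_le_one (by positivity)]
        linarith
      have hdiff : ‖cfc (fun x : ℝ => |x|) T - cfc k T * T‖ ≤ ε := by
        have h1 : cfc k T * T = cfc (fun x => k x * x) T := by
          rw [cfc_mul k (fun x => x) T hkc.continuousOn continuousOn_id, cfc_id' ℝ T]
        rw [h1, ← cfc_sub (fun x : ℝ => |x|) (fun x => k x * x) T continuous_abs.continuousOn
          (hkc.mul continuous_id).continuousOn]
        refine norm_cfc_le hε.le fun x _ => ?_
        have h2 : |x| - k x * x = |x| / (|x| + ε) * ε := by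
          have h3 : x * x = |x| * |x| := (abs_mul_abs_self x).symm
          have h4 : |x| + ε ≠ 0 := by positivity
          simp only [k]
          rw [div_mul_eq_mul_div, h3]
          field_simp
          ring
        rw [h2, Real.norm_eq_abs, abs_of_nonneg (by positivity)]
        have : |x| / (|x| + ε) ≤ 1 := by
          rw [div_le_one (by positivity)]
          linarith
        nlinarith
      have hS := TraceClassOp.sum_norm_inner_basis_le b
        (TraceClassOp.mulL H (cfc k T) (TraceClassOp.mk T hT)) s
      have hS' := (hS.trans (TraceClassOp.norm_mulL_le _ _)).trans
        (mul_le_of_le_one_left (norm_nonneg _) hk1)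
      have hi : ∀ i, ‖cfc h T (b i)‖ ^ 2 ≤
          ‖inner ℂ (b i) (TraceClassOp.op H (TraceClassOp.mulL H (cfc k T) (TraceClassOp.mk T hT))
            (b i))‖ + ε := by
        intro i
        rw [hsq, TraceClassOp.op_mulL, TraceClassOp.op_mk]
        have h5 : cfc (fun x : ℝ => |x|) T = cfc k T * T + (cfc (fun x : ℝ => |x|) T - cfc k T * T) := by
          abel
        rw [h5, add_apply, inner_add_right, Complex.add_re]
        refine add_le_add (Complex.re_le_norm _) ((Complex.re_le_norm _).trans ?_)
        refine (norm_inner_le_norm _ _).trans ?_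
        rw [b.orthonormal.1 i, one_mul]
        refine (ContinuousLinearMap.le_opNorm _ _).trans ?_
        rw [b.orthonormal.1 i, mul_one]
        exact hdiff
      calc _ ≤ ∑ i ∈ s, (_ + ε) := Finset.sum_le_sum fun i _ => hi i
        _ ≤ _ := by
          rw [Finset.sum_add_distrib, Finset.sum_const, nsmul_eq_mul]
          gcongr
    -- The error `s.card * ε` is harmless because `s` is fixed while `ε` tends to zero.
    refine le_of_forall_pos_le_add fun δ hδ => ?_
    have := hε (δ / (s.card + 1)) (by positivity)
    refine this.trans ?_
    gcongr
    rw [mul_div_assoc', div_le_iff₀ (by positivity)]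
    nlinarith
  have h2 : (0 : ℝ) < (2 : ℝ≥0∞).toReal := by simp
  rw [IsHilbertSchmidt, memℓp_gen_iff h2]
  simpa using summable_of_sum_le (fun i => by positivity) hsum

/-- A self-adjoint trace class operator is a product of two Hilbert-Schmidt operators. -/
theorem IsTraceClass.exists_factorization (b : HilbertBasis ι ℂ H) {T : H →L[ℂ] H}
    (hT : IsTraceClass T) (hsa : IsSelfAdjoint T) :
    ∃ B C, IsHilbertSchmidt b B ∧ IsHilbertSchmidt b C ∧ T = star B * C := by
  -- `f` is the even root `√|x|` and `g` the odd root `sgn(x) √|x|`, both continuous. They satisfy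
  -- `f² = g² = |x|` and `f g = x`, which avoids the polar decomposition.
  let f : ℝ → ℝ := fun x => Real.sqrt |x|
  let g : ℝ → ℝ := fun x => Real.sqrt (max x 0) - Real.sqrt (max (-x) 0)
  have hf : Continuous f := Real.continuous_sqrt.comp continuous_abs
  have hg : Continuous g :=
    (Real.continuous_sqrt.comp (continuous_id.max continuous_const)).sub
      (Real.continuous_sqrt.comp (continuous_neg.max continuous_const))
  have hff : ∀ x, f x * f x = |x| := fun x => Real.mul_self_sqrt (abs_nonneg x)
  have hgg : ∀ x, g x * g x = |x| := by
    intro x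
    rcases le_total 0 x with hx | hx
    · simp only [g, max_eq_left hx, max_eq_right (neg_nonpos.2 hx), Real.sqrt_zero, sub_zero,
        abs_of_nonneg hx]
      exact Real.mul_self_sqrt hx
    · simp only [g, max_eq_right hx, max_eq_left (neg_nonneg.2 hx), Real.sqrt_zero, zero_sub,
        abs_of_nonpos hx, neg_mul_neg]
      exact Real.mul_self_sqrt (neg_nonneg.2 hx)
  have hfg : ∀ x, f x * g x = x := by
    intro x
    rcases le_total 0 x with hx | hx
    · simp only [f, g, max_eq_left hx, max_eq_right (neg_nonpos.2 hx), Real.sqrt_zero, sub_zero,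
        abs_of_nonneg hx]
      exact Real.mul_self_sqrt hx
    · simp only [f, g, max_eq_right hx, max_eq_left (neg_nonneg.2 hx), Real.sqrt_zero, zero_sub,
        abs_of_nonpos hx, mul_neg]
      rw [Real.mul_self_sqrt (neg_nonneg.2 hx), neg_neg]
  refine ⟨cfc f T, cfc g T, isHilbertSchmidt_cfc_of_sq_eq_abs b hT hsa hf hff,
    isHilbertSchmidt_cfc_of_sq_eq_abs b hT hsa hg hgg, ?_⟩
  have h2 : IsSelfAdjoint (cfc f T) := cfc_predicate f T
  rw [h2.star_eq, ← cfc_mul f g T hf.continuousOn hg.continuousOn]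
  simp only [hfg]
  exact (cfc_id' ℝ T).symm

/-- The orthogonal projection onto the span of finitely many vectors of a basis. -/
def coordProj (b : HilbertBasis ι ℂ H) (s : Finset ι) : H →L[ℂ] H :=
  ∑ i ∈ s, InnerProductSpace.rankOne ℂ (b i) (b i)

theorem coordProj_apply (b : HilbertBasis ι ℂ H) (s : Finset ι) (x : H) :
    coordProj b s x = ∑ i ∈ s, inner ℂ (b i) x • b i := by
  simp [coordProj]

theorem inner_coordProj [DecidableEq ι] (b : HilbertBasis ι ℂ H) (s : Finset ι) (i : ι) (x : H) :
    inner ℂ (b i) (coordProj b s x) = if i ∈ s then inner ℂ (b i) x else 0 := by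
  rw [coordProj_apply, inner_sum]
  simp [inner_smul_right, orthonormal_iff_ite.1 b.orthonormal]

theorem coordProj_basis [DecidableEq ι] (b : HilbertBasis ι ℂ H) (s : Finset ι) (i : ι) :
    coordProj b s (b i) = if i ∈ s then b i else 0 := by
  apply ext_basis b
  intro j
  rw [inner_coordProj]
  by_cases hj : j = i
  · subst hj
    by_cases h : j ∈ s <;> simp [h]
  · have : inner ℂ (b j) (b i) = 0 := b.orthonormal.2 hj
    by_cases h : i ∈ s <;> simp [h, this]

theorem coordProj_isSelfAdjoint (b : HilbertBasis ι ℂ H) (s : Finset ι) :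
    IsSelfAdjoint (coordProj b s) := by
  classical
  rw [IsSelfAdjoint]
  apply op_ext b
  intro i
  apply ext_basis b
  intro j
  rw [ContinuousLinearMap.star_eq_adjoint, ContinuousLinearMap.adjoint_inner_right,
    coordProj_basis, inner_coordProj]
  by_cases hj : j = i
  · subst hj
    by_cases h : j ∈ s <;> simp [h]
  · have : inner ℂ (b j) (b i) = 0 := b.orthonormal.2 hj
    by_cases h : j ∈ s <;> simp [h, this]

theorem coordProj_mul_self (b : HilbertBasis ι ℂ H) (s : Finset ι) :
    coordProj b s * coordProj b s = coordProj b s := by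
  classical
  apply op_ext b
  intro i
  rw [mul_apply_eq_comp, coordProj_basis]
  by_cases h : i ∈ s <;> simp [h, coordProj_basis]

theorem norm_sq_add_of_projection {p : H →L[ℂ] H} (hp : IsSelfAdjoint p) (hpp : p * p = p) (x y : H) :
    ‖p x + (1 - p) y‖ ^ 2 = ‖p x‖ ^ 2 + ‖(1 - p) y‖ ^ 2 := by
  have h : inner ℂ (p x) ((1 - p) y) = 0 := by
    have hp' : ContinuousLinearMap.adjoint p = p := hp.star_eq
    rw [← ContinuousLinearMap.adjoint_inner_right, hp', ← mul_apply_eq_comp, mul_sub, mul_one, hpp, sub_self, zero_apply, inner_zero_right]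
  have := norm_add_sq_eq_norm_sq_add_norm_sq_of_inner_eq_zero (𝕜 := ℂ) (p x) ((1 - p) y) h
  nlinarith

theorem norm_sq_eq_of_projection {p : H →L[ℂ] H} (hp : IsSelfAdjoint p) (hpp : p * p = p) (x : H) :
    ‖x‖ ^ 2 = ‖p x‖ ^ 2 + ‖(1 - p) x‖ ^ 2 := by
  rw [← norm_sq_add_of_projection hp hpp, sub_apply, one_apply_eq_self]
  congr 2
  abel

theorem norm_le_one_of_projection {p : H →L[ℂ] H} (hp : IsSelfAdjoint p) (hpp : p * p = p) :
    ‖p‖ ≤ 1 := by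
  refine ContinuousLinearMap.opNorm_le_bound _ zero_le_one fun x => ?_
  rw [one_mul]
  apply le_of_sq_le_sq _ (norm_nonneg _)
  have := norm_sq_eq_of_projection hp hpp x
  nlinarith [sq_nonneg ‖(1 - p) x‖]

theorem norm_one_sub_le_one_of_projection {p : H →L[ℂ] H} (hp : IsSelfAdjoint p) (hpp : p * p = p) :
    ‖1 - p‖ ≤ 1 := by
  refine ContinuousLinearMap.opNorm_le_bound _ zero_le_one fun x => ?_
  rw [one_mul]
  apply le_of_sq_le_sq _ (norm_nonneg _)
  have := norm_sq_eq_of_projection hp hpp x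
  nlinarith [sq_nonneg ‖p x‖]

/-- Relative to `p` the operator is block diagonal: `p P p` on the range of `p` and the identity on
the complement. Truncations of a unitary thus stay contractions, as the determinant estimates
require. -/
theorem norm_one_add_conj_projection_le {p P : H →L[ℂ] H} (hp : IsSelfAdjoint p) (hpp : p * p = p)
    (hP : ‖P‖ ≤ 1) : ‖1 + p * (P - 1) * p‖ ≤ 1 := by
  refine ContinuousLinearMap.opNorm_le_bound _ zero_le_one fun x => ?_
  rw [one_mul]
  apply le_of_sq_le_sq _ (norm_nonneg _)
  have h : (1 + p * (P - 1) * p) x = p (P (p x)) + (1 - p) x := by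
    have h1 : 1 + p * (P - 1) * p = p * P * p + (1 - p) := by
      rw [mul_sub, sub_mul, mul_one, hpp]
      abel
    rw [h1]
    rfl
  rw [h, norm_sq_add_of_projection hp hpp, norm_sq_eq_of_projection hp hpp x]
  have h2 : ‖p (P (p x))‖ ≤ ‖p x‖ := by
    calc _ ≤ 1 * ‖P (p x)‖ := p.le_of_opNorm_le (norm_le_one_of_projection hp hpp) _
      _ ≤ 1 * (1 * ‖p x‖) := by gcongr; exact P.le_of_opNorm_le hP _
      _ = _ := by ring
  gcongr

theorem hsNorm_mul_coordProj_le (b : HilbertBasis ι ℂ H) {T : H →L[ℂ] H}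
    (hT : IsHilbertSchmidt b T) (s : Finset ι) : hsNorm b (T * coordProj b s) ≤ hsNorm b T := by
  classical
  apply Real.sqrt_le_sqrt
  refine ENNReal.toReal_mono ((isHilbertSchmidt_iff_hsSq b T).1 hT) ?_
  refine ENNReal.tsum_le_tsum fun i => ?_
  rw [mul_apply_eq_comp, coordProj_basis]
  by_cases h : i ∈ s <;> simp [h]

/-- The squared norm is the part of the convergent series `∑ ‖T b_i‖²` outside `s`. -/
theorem tendsto_hsNorm_tail (b : HilbertBasis ι ℂ H) {T : H →L[ℂ] H}
    (hT : IsHilbertSchmidt b T) :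
    Filter.Tendsto (fun s => hsNorm b (T * (1 - coordProj b s))) Filter.atTop (nhds 0) := by
  classical
  have h := ENNReal.tendsto_tsum_compl_atTop_zero ((isHilbertSchmidt_iff_hsSq b T).1 hT)
  have h2 : ∀ s, hsSq b (T * (1 - coordProj b s)) = ∑' i : {i // i ∉ s}, ‖T (b i)‖ₑ ^ 2 := by
    intro s
    rw [hsSq]
    have h3 : ∀ i, ‖(T * (1 - coordProj b s)) (b i)‖ₑ ^ 2 =
        Set.indicator {i | i ∉ s} (fun i => ‖T (b i)‖ₑ ^ 2) i := by
      intro i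
      rw [mul_apply_eq_comp, sub_apply, one_apply_eq_self, coordProj_basis]
      by_cases h : i ∈ s <;> simp [h]
    simp only [h3]
    exact (tsum_subtype {i | i ∉ s} (fun i => ‖T (b i)‖ₑ ^ 2)).symm
  have h4 : Filter.Tendsto (fun s => (hsSq b (T * (1 - coordProj b s))).toReal) Filter.atTop
      (nhds 0) := by
    simp only [h2]
    simpa [Function.comp_def] using (ENNReal.continuousAt_toReal ENNReal.zero_ne_top).tendsto.comp h
  have h5 := (Real.continuous_sqrt.tendsto 0).comp h4
  rwa [Real.sqrt_zero] at h5

/-- The finite section `p T p` of a trace class operator. -/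
def TraceClassOp.compress (b : HilbertBasis ι ℂ H) (s : Finset ι) :
    TraceClassOp H →L[ℂ] TraceClassOp H :=
  (TraceClassOp.mulL H (coordProj b s)).comp (TraceClassOp.mulR H (coordProj b s))

theorem TraceClassOp.op_compress (b : HilbertBasis ι ℂ H) (s : Finset ι) (T : TraceClassOp H) :
    TraceClassOp.op H (TraceClassOp.compress b s T) =
      coordProj b s * TraceClassOp.op H T * coordProj b s := by
  rw [mul_assoc]
  rfl

theorem tendsto_compress_of_isSelfAdjoint (b : HilbertBasis ι ℂ H) (T : TraceClassOp H)
    (hsa : IsSelfAdjoint (TraceClassOp.op H T)) :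
    Filter.Tendsto (fun s => TraceClassOp.compress b s T) Filter.atTop (nhds T) := by
  obtain ⟨B, C, hB, hC, hBC⟩ := IsTraceClass.exists_factorization b T.2 hsa
  have hBC : TraceClassOp.op H T = star B * C := hBC
  rw [tendsto_iff_norm_sub_tendsto_zero]
  have hlim : Filter.Tendsto (fun s => hsNorm b (B * (1 - coordProj b s)) * hsNorm b C +
      hsNorm b B * hsNorm b (C * (1 - coordProj b s))) Filter.atTop (nhds 0) := by
    simpa using ((tendsto_hsNorm_tail b hB).mul_const (hsNorm b C)).add
      ((tendsto_hsNorm_tail b hC).const_mul (hsNorm b B))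
  refine squeeze_zero (fun _ => norm_nonneg _) (fun s => ?_) hlim
  rw [norm_sub_rev]
  set p := coordProj b s with hp
  have hps : star p = p := (coordProj_isSelfAdjoint b s).star_eq
  have hn : ∀ T : H →L[ℂ] H, 0 ≤ hsNorm b T := fun T => Real.sqrt_nonneg _
  refine TraceClassOp.norm_le_of_bound 
    (add_nonneg (mul_nonneg (hn _) (hn _)) (mul_nonneg (hn _) (hn _))) fun j => ?_
  -- This is `T - p T p = (1 - p) T + p T (1 - p)`, arranged so that each product contains one tail
  -- factor.
  have h : TraceClassOp.op H (T - TraceClassOp.compress b s T) =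
      star (B * (1 - p)) * C + star (B * p) * (C * (1 - p)) := by
    rw [map_sub, TraceClassOp.op_compress, hBC, star_mul, star_mul, star_sub, star_one, hps]
    noncomm_ring
  rw [h, tracePairing_add]
  refine (norm_add_le _ _).trans (add_le_add ?_ ?_)
  · exact norm_tracePairing_star_mul_le b (hB.mul_right _) hC j
  · refine (norm_tracePairing_star_mul_le b (hB.mul_right _) (hC.mul_right _) j).trans ?_
    have := hn (C * (1 - p))
    gcongr
    exact hsNorm_mul_coordProj_le b hB s

/-- The finite sections of a trace class operator converge in trace norm. -/
theorem tendsto_compress (b : HilbertBasis ι ℂ H) (T : TraceClassOp H) :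
    Filter.Tendsto (fun s => TraceClassOp.compress b s T) Filter.atTop (nhds T) := by
  let T' := TraceClassOp.mk _ (IsTraceClass.star' T.2)
  -- Real and imaginary parts: the factorization exists for self-adjoint operators, and compression
  -- is linear.
  let A : TraceClassOp H := (1 / 2 : ℂ) • (T + T')
  let B : TraceClassOp H := (-Complex.I / 2) • (T - T')
  have hs : TraceClassOp.op H T' = star (TraceClassOp.op H T) := rfl
  have hA : IsSelfAdjoint (TraceClassOp.op H A) := by
    rw [IsSelfAdjoint, map_smul, map_add, hs, star_smul, star_add, star_star, add_comm]
    congr 1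
    simp
  have hB : IsSelfAdjoint (TraceClassOp.op H B) := by
    rw [IsSelfAdjoint, map_smul, map_sub, hs, star_smul, star_sub, star_star, ← neg_sub, smul_neg,
      ← neg_smul]
    congr 1
    simp [neg_div]
  have hT : T = A + Complex.I • B := by
    simp only [A, B]
    have : Complex.I * (-Complex.I / 2) = 1 / 2 := by
      rw [mul_div_assoc', mul_neg, Complex.I_mul_I, neg_neg]
    rw [smul_smul, this, ← smul_add]
    have h2 : T + T' + (T - T') = (2 : ℂ) • T := by
      rw [two_smul]
      abel
    rw [h2, smul_smul]
    norm_num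
  clear_value A B
  have h := (tendsto_compress_of_isSelfAdjoint b A hA).add
    ((tendsto_compress_of_isSelfAdjoint b B hB).const_smul Complex.I)
  rw [← hT] at h
  refine h.congr fun s => ?_
  conv_rhs => rw [hT]
  rw [map_add, map_smul]

end Approximation

/-! ### Determinants of finite sections -/

section FredholmDeterminant

variable {H : Type*} [NormedAddCommGroup H] [InnerProductSpace ℂ H] [CompleteSpace H]
variable {ι : Type*}

/-- The matrix `(⟨e_i, P e_j⟩)`, `i, j ∈ s`. -/
def sectionMatrix (b : HilbertBasis ι ℂ H) (s : Finset ι) (P : H →L[ℂ] H) : Matrix s s ℂ :=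
  Matrix.of fun i j : s => inner ℂ (b i) (P (b j))

theorem sectionMatrix_apply (b : HilbertBasis ι ℂ H) (s : Finset ι) (P : H →L[ℂ] H) (i j : s) :
    sectionMatrix b s P i j = inner ℂ (b i) (P (b j)) := rfl

open scoped Classical in
/-- The determinant of a finite section. -/
def sectionDet (b : HilbertBasis ι ℂ H) (s : Finset ι) (P : H →L[ℂ] H) : ℂ :=
  (sectionMatrix b s P).det

theorem isFredholmDet_iff (b : HilbertBasis ι ℂ H) (P : H →L[ℂ] H) (z : ℂ) :
    IsFredholmDet b P z ↔ Filter.Tendsto (fun s => sectionDet b s P) Filter.atTop (nhds z) := Iff.rfl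

/-- Exchanges the classical decidability instance, chosen to agree with `IsFredholmDet`, for an
arbitrary one. -/
theorem sectionDet_eq [DecidableEq ι] (b : HilbertBasis ι ℂ H) (s : Finset ι) (P : H →L[ℂ] H) :
    sectionDet b s P = (sectionMatrix b s P).det := by
  rw [sectionDet]
  congr!

theorem sectionMatrix_sub (b : HilbertBasis ι ℂ H) (s : Finset ι) (P Q : H →L[ℂ] H) :
    sectionMatrix b s (P - Q) = sectionMatrix b s P - sectionMatrix b s Q := by
  ext i j
  simp [sectionMatrix_apply]

theorem sectionMatrix_one [DecidableEq ι] (b : HilbertBasis ι ℂ H) (s : Finset ι) :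
    sectionMatrix b s 1 = 1 := by
  ext i j
  rw [sectionMatrix_apply, one_apply_eq_self, orthonormal_iff_ite.1 b.orthonormal,
    Matrix.one_apply]
  by_cases h : i = j
  · rw [if_pos h, if_pos (congrArg _ h)]
  · rw [if_neg h, if_neg fun e => h (Subtype.ext e)]

/-- Multiplying sections only sums over intermediate vectors in `s`. The missing part `P (1 - p) Q`
is the defect of multiplicativity estimated in `U1.det_mul`. -/
theorem sectionMatrix_mul_coordProj [DecidableEq ι] (b : HilbertBasis ι ℂ H) (s : Finset ι)
    (P Q : H →L[ℂ] H) : sectionMatrix b s P * sectionMatrix b s Q =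
      sectionMatrix b s (P * coordProj b s * Q) := by
  ext i j
  rw [Matrix.mul_apply, sectionMatrix_apply, mul_apply_eq_comp, mul_apply_eq_comp, coordProj_apply,
    map_sum, inner_sum, ← Finset.sum_coe_sort s]
  refine Finset.sum_congr rfl fun k _ => ?_
  rw [map_smul, inner_smul_right, mul_comm]
  rfl

theorem toEuclideanCLM_sectionMatrix [DecidableEq ι] (b : HilbertBasis ι ℂ H) (s : Finset ι)
    (P : H →L[ℂ] H) : Matrix.toEuclideanCLM (n := s) (𝕜 := ℂ) (sectionMatrix b s P) =
      ContinuousLinearMap.adjoint (coordIncl b s) ∘L P ∘L coordIncl b s := by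
  ext x i
  have h1 : (Matrix.toEuclideanCLM (n := s) (𝕜 := ℂ) (sectionMatrix b s P) x) i =
      (sectionMatrix b s P).mulVec x i := rfl
  have h2 : ∀ y : EuclideanSpace ℂ s, y i = inner ℂ (EuclideanSpace.single i (1 : ℂ)) y := by
    intro y
    simp [EuclideanSpace.inner_single_left]
  rw [h1, h2, ContinuousLinearMap.comp_apply, ContinuousLinearMap.adjoint_inner_right,
    coordIncl_single, ContinuousLinearMap.comp_apply, coordIncl_apply, map_sum, inner_sum,
    Matrix.mulVec, dotProduct]
  refine Finset.sum_congr rfl fun k _ => ?_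
  rw [map_smul, inner_smul_right, sectionMatrix_apply, mul_comm]

theorem norm_toEuclideanCLM_sectionMatrix_le [DecidableEq ι] (b : HilbertBasis ι ℂ H)
    (s : Finset ι) (P : H →L[ℂ] H) :
    ‖Matrix.toEuclideanCLM (n := s) (𝕜 := ℂ) (sectionMatrix b s P)‖ ≤ ‖P‖ := by
  rw [toEuclideanCLM_sectionMatrix]
  have h := norm_coordIncl_le b s
  calc _ ≤ ‖ContinuousLinearMap.adjoint (coordIncl b s)‖ * (‖P‖ * ‖coordIncl b s‖) :=
        (ContinuousLinearMap.opNorm_comp_le _ _).trans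
          (mul_le_mul_of_nonneg_left (ContinuousLinearMap.opNorm_comp_le _ _) (norm_nonneg _))
    _ ≤ 1 * (‖P‖ * 1) := by
        rw [LinearIsometryEquiv.norm_map]
        gcongr
    _ = ‖P‖ := by ring

theorem isContraction_sectionMatrix [DecidableEq ι] (b : HilbertBasis ι ℂ H) (s : Finset ι)
    {P : H →L[ℂ] H} (hP : ‖P‖ ≤ 1) : IsContraction (sectionMatrix b s P) :=
  (norm_toEuclideanCLM_sectionMatrix_le b s P).trans hP

/-- The trace is the pairing of `T` with the coordinate inclusion, once composed with `K`; the bound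
is therefore independent of `s`. -/
theorem norm_trace_sectionMatrix_mul_le [DecidableEq ι] (b : HilbertBasis ι ℂ H) (s : Finset ι)
    (T : TraceClassOp H) (K : Matrix s s ℂ) :
    ‖(sectionMatrix b s (TraceClassOp.op H T) * K).trace‖ ≤
      ‖T‖ * ‖Matrix.toEuclideanCLM (n := s) (𝕜 := ℂ) K‖ := by
  have h := T.norm_pairing_le (coordIncl b s ∘L Matrix.toEuclideanCLM (n := s) (𝕜 := ℂ) K)
    (coordIncl b s)
  have h1 : (sectionMatrix b s (TraceClassOp.op H T) * K).trace =
      ∑ k, inner ℂ (coordIncl b s (EuclideanSpace.single k 1)) (TraceClassOp.op H T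
        ((coordIncl b s ∘L Matrix.toEuclideanCLM (n := s) (𝕜 := ℂ) K)
          (EuclideanSpace.single k 1))) := by
    simp only [Matrix.trace, Matrix.diag_apply, Matrix.mul_apply]
    refine Finset.sum_congr rfl fun k _ => ?_
    rw [coordIncl_single, ContinuousLinearMap.comp_apply, coordIncl_apply, map_sum, inner_sum]
    refine Finset.sum_congr rfl fun l _ => ?_
    rw [map_smul, inner_smul_right, sectionMatrix_apply, mul_comm]
    congr 1
    have : (Matrix.toEuclideanCLM (n := s) (𝕜 := ℂ) K (EuclideanSpace.single k 1)) l =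
      K.mulVec (Pi.single k 1) l := rfl
    rw [this, Matrix.mulVec_single_one]
    rfl
  rw [h1]
  refine h.trans ?_
  have h2 := norm_coordIncl_le b s
  calc _ ≤ 1 * (1 * ‖Matrix.toEuclideanCLM (n := s) (𝕜 := ℂ) K‖) * ‖T‖ := by
        gcongr
        exact (ContinuousLinearMap.opNorm_comp_le _ _).trans (by gcongr)
    _ = _ := by ring

/-- The Lipschitz estimate for the determinant, uniform in the section; this uniformity is what
makes limits over `s` possible. -/
theorem norm_sectionDet_sub_le (b : HilbertBasis ι ℂ H) (s : Finset ι) {P Q : H →L[ℂ] H}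
    (hP : ‖P‖ ≤ 1) (hQ : ‖Q‖ ≤ 1) (T : TraceClassOp H) (hT : P - Q = TraceClassOp.op H T) :
    ‖sectionDet b s P - sectionDet b s Q‖ ≤ ‖T‖ := by
  classical
  rw [sectionDet_eq, sectionDet_eq]
  refine norm_det_sub_det_le (isContraction_sectionMatrix b s hP)
    (isContraction_sectionMatrix b s hQ) fun K hK => ?_
  rw [← sectionMatrix_sub, hT]
  refine (norm_trace_sectionMatrix_mul_le b s T K).trans ?_
  exact mul_le_of_le_one_right (norm_nonneg _) hK

/-- Sylvester's identity `det (1 + U X) = det (1 + X U)` for the inclusion matrix `U` of `s` in `t`,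
which satisfies `Uᵀ U = 1`. It lets sections of different sizes be compared over the same index set.
-/
theorem sectionDet_compress (b : HilbertBasis ι ℂ H) {s t : Finset ι} (hst : s ⊆ t)
    (P : H →L[ℂ] H) : sectionDet b t (1 + coordProj b s * (P - 1) * coordProj b s) =
      sectionDet b s P := by
  classical
  rw [sectionDet_eq, sectionDet_eq]
  let U : Matrix t s ℂ := Matrix.of fun i k => if (i : ι) = k then 1 else 0
  have hU : Matrix.transpose U * U = 1 := by
    ext k l
    rw [Matrix.mul_apply, Matrix.one_apply, Finset.sum_eq_single ⟨k, hst k.2⟩]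
    · by_cases h : k = l
      · simp [U, h]
      · have : (k : ι) ≠ l := fun e => h (Subtype.ext e)
        simp [U, h, this]
    · intro i _ hi
      have : (i : ι) ≠ k := fun h => hi (Subtype.ext h)
      simp [U, this]
    · simp
  have h1 : sectionMatrix b t (1 + coordProj b s * (P - 1) * coordProj b s) =
      1 + U * (sectionMatrix b s (P - 1) * Matrix.transpose U) := by
    ext i j
    rw [Matrix.add_apply, ← sectionMatrix_one b t, sectionMatrix_apply, sectionMatrix_apply,
      add_apply, inner_add_right]
    congr 1
    rw [mul_apply_eq_comp, mul_apply_eq_comp, inner_coordProj, coordProj_basis, Matrix.mul_apply]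
    have h2 : ∀ k, (sectionMatrix b s (P - 1) * Matrix.transpose U) k j =
        if (j : ι) ∈ s then inner ℂ (b k) ((P - 1) (b j)) else 0 := by
      intro k
      rw [Matrix.mul_apply]
      split_ifs with hj
      · rw [Finset.sum_eq_single ⟨j, hj⟩]
        · simp [U, sectionMatrix_apply]
        · intro l _ hl
          have : (j : ι) ≠ l := fun h => hl (Subtype.ext h.symm)
          simp [U, this]
        · simp
      · refine Finset.sum_eq_zero fun l _ => ?_
        have : (j : ι) ≠ l := fun h => hj (h ▸ l.2)
        simp [U, this]
    simp only [h2]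
    by_cases hi : (i : ι) ∈ s
    · rw [if_pos hi, Finset.sum_eq_single ⟨i, hi⟩]
      · by_cases hj : (j : ι) ∈ s <;> simp [U, hj]
      · intro l _ hl
        have : (i : ι) ≠ l := fun h => hl (Subtype.ext h.symm)
        simp [U, this]
      · simp
    · rw [if_neg hi]
      symm
      refine Finset.sum_eq_zero fun l _ => ?_
      have : (i : ι) ≠ l := fun h => hi (h ▸ l.2)
      simp [U, this]
  rw [h1, Matrix.det_one_add_mul_comm, Matrix.mul_assoc, hU, Matrix.mul_one, sectionMatrix_sub, sectionMatrix_one]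
  congr 1
  abel

end FredholmDeterminant

/-! ### The Fredholm determinant on the group `U1` -/

section U1

variable {H : Type*} [NormedAddCommGroup H] [InnerProductSpace ℂ H] [CompleteSpace H]
variable {ι : Type*}

theorem norm_le_one_of_mem_unitary {P : H →L[ℂ] H} (hP : P ∈ unitary (H →L[ℂ] H)) : ‖P‖ ≤ 1 := by
  refine ContinuousLinearMap.opNorm_le_bound _ zero_le_one fun x => ?_
  rw [one_mul]
  apply le_of_sq_le_sq _ (norm_nonneg _)
  have h : inner ℂ (P x) (P x) = inner ℂ x x := by
    rw [← ContinuousLinearMap.adjoint_inner_right, ← ContinuousLinearMap.star_eq_adjoint,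
      ← mul_apply_eq_comp, (Unitary.mem_iff.1 hP).1, one_apply_eq_self]
  rw [inner_self_eq_norm_sq_to_K, inner_self_eq_norm_sq_to_K] at h
  exact le_of_eq (by exact_mod_cast h)

theorem U1.norm_op_le (P : U1 H) : ‖P.op‖ ≤ 1 := norm_le_one_of_mem_unitary P.unitary

theorem U1.star_mul_op (P : U1 H) : star P.op * P.op = 1 := (Unitary.mem_iff.1 P.unitary).1

theorem U1.op_mul_star (P : U1 H) : P.op * star P.op = 1 := (Unitary.mem_iff.1 P.unitary).2

theorem U1.op_emb (P : U1 H) : TraceClassOp.op H P.emb = P.op - 1 := rfl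

/-- The product of the group `U¹`. -/
def U1.mul (P Q : U1 H) : U1 H where
  op := P.op * Q.op
  unitary := mul_mem P.unitary Q.unitary
  traceClass := by
    have h : P.op * Q.op - 1 = (P.op - 1) * Q.op + (Q.op - 1) := by noncomm_ring
    rw [h]
    exact (P.traceClass.mul_right _).add Q.traceClass

/-- The inverse of the group `U¹`. -/
def U1.inv (P : U1 H) : U1 H where
  op := star P.op
  unitary := Unitary.star_mem P.unitary
  traceClass := by
    have h : star P.op - 1 = star (P.op - 1) := by simp
    rw [h]
    exact P.traceClass.star'

@[ext]
theorem U1.ext' {P Q : U1 H} (h : P.op = Q.op) : P = Q := by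
  cases P
  cases Q
  congr

/-- The section determinants form a Cauchy net. For `s ⊆ t` both are determinants over `t` of
contractions, by `sectionDet_compress`, and they differ by at most the trace norm of `P - 1` minus
its compression to `s`. -/
theorem U1.exists_fredholmDet (b : HilbertBasis ι ℂ H) (P : U1 H) :
    ∃ z, IsFredholmDet b P.op z := by
  classical
  apply cauchySeq_tendsto_of_complete
  rw [Metric.cauchySeq_iff']
  intro ε hε
  have h := tendsto_compress b P.emb
  rw [Metric.tendsto_atTop] at h
  obtain ⟨s, hs⟩ := h ε hε
  refine ⟨s, fun t hst => ?_⟩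
  change dist (sectionDet b t P.op) (sectionDet b s P.op) < ε
  rw [← sectionDet_compress b hst P.op, dist_eq_norm]
  refine lt_of_le_of_lt (norm_sectionDet_sub_le b t P.norm_op_le
    (norm_one_add_conj_projection_le (coordProj_isSelfAdjoint b s) (coordProj_mul_self b s)
      P.norm_op_le) (P.emb - TraceClassOp.compress b s P.emb) ?_) ?_
  · rw [map_sub, TraceClassOp.op_compress, U1.op_emb]
    abel
  · rw [← dist_eq_norm, dist_comm]
    exact hs s le_rfl

/-- The Fredholm determinant. -/
def U1.det (b : HilbertBasis ι ℂ H) (P : U1 H) : ℂ := (P.exists_fredholmDet b).choose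

theorem U1.isFredholmDet_det (b : HilbertBasis ι ℂ H) (P : U1 H) : IsFredholmDet b P.op (P.det b) :=
  (P.exists_fredholmDet b).choose_spec

theorem U1.det_eq_of_isFredholmDet {b : HilbertBasis ι ℂ H} {P : U1 H} {z : ℂ}
    (h : IsFredholmDet b P.op z) : P.det b = z :=
  tendsto_nhds_unique (P.isFredholmDet_det b) h

/-- The section of `P Q` and the product of the sections are contractions whose difference tends to
zero in trace norm, so their determinants have the same limit. -/
theorem U1.det_mul (b : HilbertBasis ι ℂ H) (P Q : U1 H) :
    (P.mul Q).det b = P.det b * Q.det b := by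
  classical
  apply U1.det_eq_of_isFredholmDet
  have h1 := (P.isFredholmDet_det b).mul (Q.isFredholmDet_det b)
  have h2 : Filter.Tendsto (fun s => sectionDet b s (P.mul Q).op -
      sectionDet b s P.op * sectionDet b s Q.op) Filter.atTop (nhds 0) := by
    rw [tendsto_zero_iff_norm_tendsto_zero]
    have h3 := tendsto_iff_norm_sub_tendsto_zero.1 (tendsto_compress b Q.emb)
    have h4 : Filter.Tendsto (fun s => ‖P.emb‖ * ‖TraceClassOp.compress b s Q.emb - Q.emb‖)
        Filter.atTop (nhds 0) := by
      simpa using h3.const_mul ‖P.emb‖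
    refine squeeze_zero (fun _ => norm_nonneg _) (fun s => ?_) h4
    set p := coordProj b s with hp
    have hpp : p * p = p := coordProj_mul_self b s
    have hpn : ‖1 - p‖ ≤ 1 := norm_one_sub_le_one_of_projection (coordProj_isSelfAdjoint b s) hpp
    -- This is `(P - 1) (1 - p) (Q - 1)`: since `(1 - p) p = 0`, the compression of `Q - 1` can be
    -- subtracted for free, and the remaining factor tends to zero in trace norm.
    let T := TraceClassOp.mulL H ((P.op - 1) * (1 - p)) (Q.emb - TraceClassOp.compress b s Q.emb)
    have hTn : ‖T‖ ≤ ‖P.emb‖ * ‖TraceClassOp.compress b s Q.emb - Q.emb‖ := by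
      refine (TraceClassOp.norm_mulL_le _ _).trans ?_
      rw [norm_sub_rev]
      gcongr
      calc ‖(P.op - 1) * (1 - p)‖ ≤ ‖P.op - 1‖ * 1 := (norm_mul_le _ _).trans (by gcongr)
        _ ≤ ‖P.emb‖ := by rw [mul_one]; exact P.emb.norm_op_le
    have hm : sectionMatrix b s (P.mul Q).op - sectionMatrix b s P.op * sectionMatrix b s Q.op =
        sectionMatrix b s (TraceClassOp.op H T) := by
      rw [sectionMatrix_mul_coordProj, ← sectionMatrix_sub]
      have h6 : (1 - p) * p = 0 := by rw [sub_mul, one_mul, hpp, sub_self]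
      have h7 : TraceClassOp.op H T = (P.op - 1) * (1 - p) * (Q.op - 1) := by
        rw [TraceClassOp.op_mulL, map_sub, TraceClassOp.op_compress, U1.op_emb, ← hp, mul_sub,
          mul_assoc p, mul_assoc _ (1 - p) (p * _), ← mul_assoc (1 - p), h6, zero_mul, mul_zero,
          sub_zero]
      -- Expansion of `P (1 - p) Q`. The last two terms have `1 - p` at one end and vanish between
      -- basis vectors indexed by `s`.
      have h5 : (P.mul Q).op - P.op * p * Q.op =
          TraceClassOp.op H T + ((1 - p) * Q.op + (P.op - 1) * (1 - p)) := by
        rw [h7]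
        change P.op * Q.op - P.op * p * Q.op = _
        noncomm_ring
      rw [h5]
      ext i j
      simp only [sectionMatrix_apply, add_apply, inner_add_right, mul_apply_eq_comp, sub_apply,
        one_apply_eq_self, hp, inner_coordProj, coordProj_basis, inner_sub_right, i.2, j.2, if_true,
        sub_self, map_zero, add_zero]
    rw [sectionDet_eq, sectionDet_eq, sectionDet_eq, ← Matrix.det_mul]
    refine norm_det_sub_det_le (isContraction_sectionMatrix b s (P.mul Q).norm_op_le)
      ((isContraction_sectionMatrix b s P.norm_op_le).mul
        (isContraction_sectionMatrix b s Q.norm_op_le)) fun K hK => ?_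
    rw [hm]
    refine (norm_trace_sectionMatrix_mul_le b s T K).trans ?_
    exact (mul_le_of_le_one_right (norm_nonneg _) hK).trans hTn
  have h9 := h2.add h1
  rw [zero_add] at h9
  refine h9.congr fun s => ?_
  exact sub_add_cancel _ _

/-- The matrix expansion holds on every section with a bound independent of the section, so it
survives the limit. It gives the derivative of the determinant at `1`. -/
theorem U1.norm_det_sub_le (b : HilbertBasis ι ℂ H) (P : U1 H) :
    ‖P.det b - 1 - opTrace b (P.op - 1)‖ ≤ 2 * ‖P.emb‖ ^ 2 := by
  classical
  have h1 : Filter.Tendsto (fun s : Finset ι => ∑ i ∈ s, inner ℂ (b i) ((P.op - 1) (b i)))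
      Filter.atTop (nhds (opTrace b (P.op - 1))) :=
    (IsTraceClass.summable_inner b P.traceClass).hasSum
  have h2 := (((P.isFredholmDet_det b).sub_const 1).sub h1).norm
  refine le_of_tendsto h2 (Filter.Eventually.of_forall fun s => ?_)
  change ‖sectionDet b s P.op - 1 - _‖ ≤ _
  have hM : sectionMatrix b s P.op = 1 + sectionMatrix b s (P.op - 1) := by
    rw [sectionMatrix_sub, sectionMatrix_one]
    abel
  have htr : ∑ i ∈ s, inner ℂ (b i) ((P.op - 1) (b i)) = (sectionMatrix b s (P.op - 1)).trace := by
    rw [← Finset.sum_coe_sort s]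
    rfl
  rw [sectionDet_eq, hM, htr]
  refine norm_det_sub_one_sub_trace_le ?_ ?_ ?_
  · rw [← hM]
    exact isContraction_sectionMatrix b s P.norm_op_le
  · exact norm_trace_sectionMatrix_mul_le b s P.emb
  · exact (norm_toEuclideanCLM_sectionMatrix_le b s _).trans P.emb.norm_op_le

end U1

/-! ### Forms and homotopies over the point -/

section ExactOnPoint

/-- In positive degree the zero form is a primitive; in degree zero exactness is vanishing by
definition. -/
theorem isExactForm_of_forall_eq_zero {k : ℕ}
    (α : ∀ x : Point, (Fin k → TangentSpace 𝓘(ℝ, Point) x) → ℂ) (h : ∀ x v, α x v = 0) :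
    IsExactForm (E := Point) k α := by
  cases k with
  | zero => exact h
  | succ k =>
    have hc : ∀ x₀ : Point, chartForm (E := Point) (k := k) (fun _ : Point => 0) x₀ = fun _ => 0 := by
      intro x₀
      funext y
      ext v
      rfl
    refine ⟨fun _ => 0, fun x₀ => ?_, fun x v => ?_⟩
    · rw [hc]
      exact contDiffOn_const
    · rw [h, extDerivForm, hc]
      have : extDeriv (fun _ : Point => (0 : Point [⋀^Fin k]→L[ℝ] ℂ)) = 0 := by
        funext y
        rw [extDeriv, fderiv_fun_const]
        ext v
        simp [ContinuousAlternatingMap.alternatizeUncurryFin_apply]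
      rw [this]
      rfl

variable {X : Type*} {V : Type*} [NormedAddCommGroup V] [NormedSpace ℝ V] {emb : X → V}

/-- The tangent space of the point is zero. Any Chern–Simons integrand with an argument from the
base vanishes for this reason. -/
theorem homotopyDeriv_zero_right (F : Point × ℝ → X) (x : Point) (t : ℝ)
    (v : TangentSpace 𝓘(ℝ, Point) x) : homotopyDeriv (E := Point) emb F x t v 0 = 0 := by
  have hv : v = (0 : Point) := Subsingleton.elim (α := Point) _ _
  subst hv
  exact map_zero (mfderivWithin (𝓘(ℝ, Point).prod 𝓘(ℝ, ℝ)) 𝓘(ℝ, V) (emb ∘ F)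
    (Set.univ ×ˢ Set.Icc (0 : ℝ) 1) (x, t) : Point × ℝ →L[ℝ] V)

theorem IsSmoothHomotopy.contDiffOn_prod {F : Point × ℝ → X} (h : IsSmoothHomotopy Point emb F) :
    ContDiffOn ℝ ∞ (emb ∘ F) (Set.univ ×ˢ Set.Icc (0 : ℝ) 1) := by
  rw [IsSmoothHomotopy, ← modelWithCornersSelf_prod, chartedSpaceSelf_prod,
    contMDiffOn_iff_contDiffOn] at h
  exact h

theorem IsSmoothHomotopy.contDiffOn {F : Point × ℝ → X} (h : IsSmoothHomotopy Point emb F)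
    (x : Point) : ContDiffOn ℝ ∞ (fun t => emb (F (x, t))) (Set.Icc (0 : ℝ) 1) :=
  h.contDiffOn_prod.comp (contDiff_prodMk_right x).contDiffOn fun _ ht => ⟨trivial, ht⟩

theorem isSmoothHomotopy_of_contDiff {γ : ℝ → X} (h : ContDiff ℝ ∞ (emb ∘ γ)) :
    IsSmoothHomotopy Point emb (fun p : Point × ℝ => γ p.2) := by
  rw [IsSmoothHomotopy, ← modelWithCornersSelf_prod, chartedSpaceSelf_prod,
    contMDiffOn_iff_contDiffOn]
  exact (h.comp contDiff_snd).contDiffOn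

/-- The chain rule along `s ↦ (x, s)` identifies the manifold derivative with the derivative of a
path, taken within the interval so that the endpoints are covered. -/
theorem IsSmoothHomotopy.homotopyDeriv_eq {F : Point × ℝ → X} (h : IsSmoothHomotopy Point emb F)
    (x : Point) {t : ℝ} (ht : t ∈ Set.Icc (0 : ℝ) 1) :
    homotopyDeriv (E := Point) emb F x t (0 : Point) 1 =
      derivWithin (fun t => emb (F (x, t))) (Set.Icc (0 : ℝ) 1) t := by
  have h1 : homotopyDeriv (E := Point) emb F x t (0 : Point) 1 =
      fderivWithin ℝ (emb ∘ F) (Set.univ ×ˢ Set.Icc (0 : ℝ) 1) (x, t) ((0 : Point), (1 : ℝ)) := by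
    change (mfderivWithin (𝓘(ℝ, Point).prod 𝓘(ℝ, ℝ)) 𝓘(ℝ, V) (emb ∘ F)
      (Set.univ ×ˢ Set.Icc (0 : ℝ) 1) (x, t) : Point × ℝ →L[ℝ] V) ((0 : Point), (1 : ℝ)) = _
    rw [← modelWithCornersSelf_prod, chartedSpaceSelf_prod, mfderivWithin_eq_fderivWithin]
    rfl
  rw [h1]
  have h2 := (h.contDiffOn_prod.differentiableOn (by simp) (x, t) ⟨trivial, ht⟩).hasFDerivWithinAt
  have h3 : HasDerivWithinAt (fun s : ℝ => (x, s)) ((0 : Point), (1 : ℝ)) (Set.Icc (0 : ℝ) 1) t :=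
    (hasDerivWithinAt_const t _ x).prodMk (hasDerivWithinAt_id t _)
  have h4 := h2.comp_hasDerivWithinAt t h3 fun _ hs => ⟨trivial, hs⟩
  exact (h4.derivWithin (uniqueDiffOn_Icc zero_lt_one t ht)).symm

end ExactOnPoint

/-! ### The determinant along a path -/

section PathDeterminant

variable {H : Type*} [NormedAddCommGroup H] [InnerProductSpace ℂ H] [CompleteSpace H]
variable {ι : Type*}

/-- The trace of the logarithmic derivative, `tr (P* T)`. -/
def logTrace (b : HilbertBasis ι ℂ H) (P : U1 H) (T : TraceClassOp H) : ℂ :=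
  TraceClassOp.traceL b (TraceClassOp.mulL H (star P.op) T)

theorem logTrace_eq (b : HilbertBasis ι ℂ H) (P : U1 H) (T : TraceClassOp H) :
    logTrace b P T = opTrace b (star P.op * TraceClassOp.op H T) := rfl

theorem U1.op_eq (P : U1 H) : P.op = 1 + TraceClassOp.opL H P.emb := by
  rw [TraceClassOp.opL_apply, U1.op_emb]
  abel

theorem U1.emb_inv_mul (P Q : U1 H) :
    (P.inv.mul Q).emb = TraceClassOp.mulL H (star P.op) (Q.emb - P.emb) := by
  apply TraceClassOp.op_injective
  rw [U1.op_emb, TraceClassOp.op_mulL, map_sub, U1.op_emb, U1.op_emb, sub_sub_sub_cancel_right,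
    mul_sub, U1.star_mul_op]
  rfl

theorem U1.mul_inv_mul (P Q : U1 H) : P.mul (P.inv.mul Q) = Q := by
  ext1
  change P.op * (star P.op * Q.op) = Q.op
  rw [← mul_assoc, U1.op_mul_star, one_mul]

/-- By multiplicativity `det γ(u) = det γ(t) · det (γ(t)⁻¹ γ(u))`, and the second factor is expanded
at `1` by `U1.norm_det_sub_le`. -/
theorem hasDerivWithinAt_det (b : HilbertBasis ι ℂ H) {γ : ℝ → U1 H} {s : Set ℝ} {t : ℝ}
    {T : TraceClassOp H} (h : HasDerivWithinAt (fun t => (γ t).emb) T s t) :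
    HasDerivWithinAt (fun t => (γ t).det b) ((γ t).det b * logTrace b (γ t) T) s t := by
  let L : TraceClassOp H →L[ℝ] TraceClassOp H :=
    (TraceClassOp.mulL H (star (γ t).op)).restrictScalars ℝ
  let tr : TraceClassOp H →L[ℝ] ℂ := (TraceClassOp.traceL b).restrictScalars ℝ
  have hf : HasDerivWithinAt (fun u => L ((γ u).emb - (γ t).emb)) (L T) s t :=
    L.hasFDerivAt.comp_hasDerivWithinAt t (h.sub_const _)
  have hg : HasDerivWithinAt (fun u => tr (L ((γ u).emb - (γ t).emb))) (tr (L T)) s t :=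
    tr.hasFDerivAt.comp_hasDerivWithinAt t hf
  have hbound : ∀ u, ‖((γ t).inv.mul (γ u)).det b - 1 - tr (L ((γ u).emb - (γ t).emb))‖ ≤
      2 * ‖L ((γ u).emb - (γ t).emb)‖ ^ 2 := by
    intro u
    have := ((γ t).inv.mul (γ u)).norm_det_sub_le b
    rwa [← U1.op_emb, ← TraceClassOp.traceL_apply, U1.emb_inv_mul] at this
  -- The remainder is bounded by twice the square of a quantity that is both `O(u - t)` and `o(1)`.
  have he : HasDerivWithinAt
      (fun u => ((γ t).inv.mul (γ u)).det b - 1 - tr (L ((γ u).emb - (γ t).emb))) 0 s t := by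
    have h0 : ((γ t).inv.mul (γ t)).det b - 1 - tr (L ((γ t).emb - (γ t).emb)) = 0 := by
      have := hbound t
      rw [sub_self, map_zero, norm_zero] at this
      rw [sub_self, map_zero, map_zero]
      simpa using this
    rw [hasDerivWithinAt_iff_isLittleO]
    simp only [h0, sub_zero, smul_zero]
    have h1 : (fun u => L ((γ u).emb - (γ t).emb)) =O[nhdsWithin t s] fun u => u - t := by
      have := hf.hasFDerivWithinAt.isBigO_sub
      simpa using this
    have h2 : (fun u => L ((γ u).emb - (γ t).emb)) =o[nhdsWithin t s] fun _ => (1 : ℝ) := by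
      rw [Asymptotics.isLittleO_one_iff]
      have := hf.continuousWithinAt.tendsto
      simpa using this
    have h3 := h2.norm_left.mul_isBigO h1.norm_left
    simp only [one_mul] at h3
    refine Asymptotics.IsBigO.trans_isLittleO ?_ h3
    refine Asymptotics.IsBigO.of_bound 2 (Filter.Eventually.of_forall fun u => ?_)
    refine (hbound u).trans (le_of_eq ?_)
    rw [norm_mul, norm_norm, sq]
  have hsum := ((he.add hg).add_const 1).const_mul ((γ t).det b)
  rw [zero_add] at hsum
  have key : ∀ u, (γ u).det b = (γ t).det b *
      (((γ t).inv.mul (γ u)).det b - 1 - tr (L ((γ u).emb - (γ t).emb)) +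
        tr (L ((γ u).emb - (γ t).emb)) + 1) := by
    intro u
    rw [sub_add_cancel, sub_add_cancel, ← U1.det_mul, U1.mul_inv_mul]
  exact hsum.congr (fun u _ => key u) (key t)

theorem continuousOn_logTrace (b : HilbertBasis ι ℂ H) {γ : ℝ → U1 H} {T : ℝ → TraceClassOp H}
    {s : Set ℝ} (hγ : ContinuousOn (fun t => (γ t).emb) s) (hT : ContinuousOn T s) :
    ContinuousOn (fun t => logTrace b (γ t) (T t)) s := by
  have h1 : ContinuousOn (fun t => star (γ t).op) s := by
    simp only [U1.op_eq]
    exact ((continuousOn_const.add ((TraceClassOp.opL H).continuous.comp_continuousOn hγ))).star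
  exact (TraceClassOp.traceL b).continuous.comp_continuousOn
    (((TraceClassOp.mulL H).continuous.comp_continuousOn h1).clm_apply hT)

/-- The Fredholm determinant along a path is the exponential of the integral of the trace of the
logarithmic derivative. -/
theorem det_path (b : HilbertBasis ι ℂ H) {γ : ℝ → U1 H}
    (hγ : ContDiffOn ℝ ∞ (fun t => (γ t).emb) (Set.Icc (0 : ℝ) 1)) :
    (γ 1).det b = (γ 0).det b * Complex.exp (∫ t in (0 : ℝ)..1,
      logTrace b (γ t) (derivWithin (fun t => (γ t).emb) (Set.Icc (0 : ℝ) 1) t)) := by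
  set τ : ℝ → ℂ := fun t =>
    logTrace b (γ t) (derivWithin (fun t => (γ t).emb) (Set.Icc (0 : ℝ) 1) t) with hτ
  have hu := uniqueDiffOn_Icc (zero_lt_one (α := ℝ))
  have hτc : ContinuousOn τ (Set.Icc (0 : ℝ) 1) :=
    continuousOn_logTrace b hγ.continuousOn (hγ.continuousOn_derivWithin hu (by simp))
  -- The integrand is controlled only on the interval; its continuous extension admits the
  -- fundamental theorem of calculus at the endpoints too.
  let τ' : ℝ → ℂ := Set.IccExtend (zero_le_one (α := ℝ)) (Set.domRestrict (Set.Icc (0 : ℝ) 1) τ)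
  have hτ' : Continuous τ' := (continuousOn_iff_continuous_domRestrict.1 hτc).Icc_extend'
  have heq : ∀ t ∈ Set.Icc (0 : ℝ) 1, τ' t = τ t := fun t ht => Set.IccExtend_of_mem _ _ ht
  have hint : ∫ t in (0 : ℝ)..1, τ t = ∫ t in (0 : ℝ)..1, τ' t := by
    refine intervalIntegral.integral_congr fun t ht => ?_
    rw [Set.uIcc_of_le zero_le_one] at ht
    exact (heq t ht).symm
  rw [hint]
  -- Integrating factor: `G` has zero derivative, hence is constant.
  let G : ℝ → ℂ := fun t => (γ t).det b * Complex.exp (-∫ u in (0 : ℝ)..t, τ' u)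
  have hG : ∀ t ∈ Set.Icc (0 : ℝ) 1, HasDerivWithinAt G 0 (Set.Icc (0 : ℝ) 1) t := by
    intro t ht
    have h1 := hasDerivWithinAt_det b (hγ.differentiableOn (by simp) t ht).hasDerivWithinAt
    have h2 : HasDerivWithinAt (fun t => ∫ u in (0 : ℝ)..t, τ' u) (τ t) (Set.Icc (0 : ℝ) 1) t := by
      rw [← heq t ht]
      exact (hτ'.integral_hasStrictDerivAt 0 t).hasDerivAt.hasDerivWithinAt
    refine (h1.mul h2.neg.cexp).congr_deriv ?_
    simp only [hτ]
    ring
  have hconst := constant_of_derivWithin_zero (f := G) (a := 0) (b := 1)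
    (fun t ht => (hG t ht).differentiableWithinAt)
    (fun t ht => (hG t ⟨ht.1, ht.2.le⟩).derivWithin (hu t ⟨ht.1, ht.2.le⟩)) 1
    (Set.right_mem_Icc.2 zero_le_one)
  simp only [G, intervalIntegral.integral_same, neg_zero, Complex.exp_zero, mul_one] at hconst
  rw [← hconst, mul_assoc, ← Complex.exp_add, neg_add_cancel, Complex.exp_zero, mul_one]

end PathDeterminant

/-! ### Smooth paths in `U1` and Cayley transforms -/

section Paths

variable {H : Type*} [NormedAddCommGroup H] [InnerProductSpace ℂ H] [CompleteSpace H]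

theorem one_add_smul_mem_unitary {p : H →L[ℂ] H} (hp : IsSelfAdjoint p) (hpp : p * p = p) {z : ℂ}
    (hz : ‖z‖ = 1) : 1 + (z - 1) • p ∈ unitary (H →L[ℂ] H) := by
  have h1 : star (1 + (z - 1) • p) = 1 + (star z - 1) • p := by
    rw [star_add, star_smul, star_one, hp.star_eq, star_sub, star_one]
  have hzz : star z * z = 1 := by
    have := Complex.conj_mul' z
    rw [hz] at this
    simpa using this
  have h2 : ∀ u v : ℂ, u * v = 1 → (1 + (u - 1) • p) * (1 + (v - 1) • p) = 1 := by
    intro u v huv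
    have h3 : (1 + (u - 1) • p) * (1 + (v - 1) • p) =
        1 + ((u - 1) + (v - 1) + (u - 1) * (v - 1)) • p := by
      rw [add_mul, mul_add, mul_add, mul_one, one_mul, mul_one, smul_mul_smul_comm, hpp, add_smul,
        add_smul]
      abel
    rw [h3]
    have h4 : (u - 1) + (v - 1) + (u - 1) * (v - 1) = u * v - 1 := by ring
    rw [h4, huv, sub_self, zero_smul, add_zero]
  rw [Unitary.mem_iff, h1]
  exact ⟨h2 _ _ hzz, h2 _ _ (by rw [mul_comm, hzz])⟩

/-- The unitary operator which is multiplication by `z` on the range of the projection `p` and the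
identity on the orthogonal complement. -/
def U1.ofProjection (p : H →L[ℂ] H) (hp : IsSelfAdjoint p) (hpp : p * p = p) (ht : IsTraceClass p)
    (z : ℂ) (hz : ‖z‖ = 1) : U1 H where
  op := 1 + (z - 1) • p
  unitary := one_add_smul_mem_unitary hp hpp hz
  traceClass := by
    rw [add_sub_cancel_left]
    exact ht.smul _

theorem U1.emb_ofProjection (p : H →L[ℂ] H) (hp : IsSelfAdjoint p) (hpp : p * p = p)
    (ht : IsTraceClass p) (z : ℂ) (hz : ‖z‖ = 1) :
    (U1.ofProjection p hp hpp ht z hz).emb = (z - 1) • TraceClassOp.mk p ht := by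
  apply TraceClassOp.op_injective
  rw [U1.op_emb, map_smul, TraceClassOp.op_mk]
  exact add_sub_cancel_left _ _

theorem U1.emb_mul (P Q : U1 H) : (P.mul Q).emb = TraceClassOp.mulR H Q.op P.emb + Q.emb := by
  apply TraceClassOp.op_injective
  rw [map_add, TraceClassOp.op_mulR, U1.op_emb, U1.op_emb, U1.op_emb]
  change P.op * Q.op - 1 = _
  noncomm_ring

theorem contDiff_op {γ : ℝ → U1 H} (h : ContDiff ℝ ∞ fun t => (γ t).emb) :
    ContDiff ℝ ∞ fun t => (γ t).op := by
  simp only [U1.op_eq]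
  exact contDiff_const.add (((TraceClassOp.opL H).restrictScalars ℝ).contDiff.comp h)

theorem contDiff_mulR {f : ℝ → H →L[ℂ] H} {g : ℝ → TraceClassOp H} (hf : ContDiff ℝ ∞ f)
    (hg : ContDiff ℝ ∞ g) : ContDiff ℝ ∞ fun t => TraceClassOp.mulR H (f t) (g t) :=
  ((TraceClassOp.mulR H).bilinearRestrictScalars ℝ).isBoundedBilinearMap.contDiff.comp
    (hf.prodMk hg)

theorem contDiff_mulL {f : ℝ → H →L[ℂ] H} {g : ℝ → TraceClassOp H} (hf : ContDiff ℝ ∞ f)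
    (hg : ContDiff ℝ ∞ g) : ContDiff ℝ ∞ fun t => TraceClassOp.mulL H (f t) (g t) :=
  ((TraceClassOp.mulL H).bilinearRestrictScalars ℝ).isBoundedBilinearMap.contDiff.comp
    (hf.prodMk hg)

theorem contDiff_emb_mul {γ δ : ℝ → U1 H} (hγ : ContDiff ℝ ∞ fun t => (γ t).emb)
    (hδ : ContDiff ℝ ∞ fun t => (δ t).emb) : ContDiff ℝ ∞ fun t => ((γ t).mul (δ t)).emb := by
  simp only [U1.emb_mul]
  exact (contDiff_mulR (contDiff_op hδ) hγ).add hδ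

/-- The operator dominates `1` because `star X * X` is positive. Besides Cayley transforms, this
serves the projections onto graphs. -/
theorem isUnit_one_add_star_mul_self (X : H →L[ℂ] H) : IsUnit (1 + star X * X) := by
  nontriviality (H →L[ℂ] H)
  exact CStarAlgebra.isUnit_of_le 1 (le_add_of_nonneg_right (star_mul_self_nonneg X))

/-- The product `(1 - i t X) (1 + i t X) = 1 + (t X)²` is invertible and its factors commute. -/
theorem isUnit_one_sub_smul {X : H →L[ℂ] H} (hX : IsSelfAdjoint X) (t : ℝ) :
    IsUnit (1 - (Complex.I * t) • X) := by
  have h1 : star ((t : ℂ) • X) = (t : ℂ) • X := by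
    rw [star_smul, hX.star_eq]
    simp
  have h := isUnit_one_add_star_mul_self ((t : ℂ) • X)
  rw [h1] at h
  have hI : Complex.I * t * (Complex.I * t) = -(t * t : ℂ) := by
    rw [mul_mul_mul_comm, Complex.I_mul_I]
    ring
  have h2 : 1 + (t : ℂ) • X * (t : ℂ) • X =
      (1 - (Complex.I * t) • X) * (1 + (Complex.I * t) • X) := by
    rw [smul_mul_smul_comm, sub_mul, mul_add, mul_add, smul_mul_smul_comm, hI, neg_smul]
    simp only [mul_one, one_mul]
    abel
  have hc : Commute (1 - (Complex.I * t) • X) (1 + (Complex.I * t) • X) := by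
    rw [commute_iff_eq, sub_mul, mul_add, mul_add, add_mul, mul_sub, mul_sub]
    simp only [mul_one, one_mul]
    abel
  rw [h2] at h
  exact (hc.isUnit_mul_iff.1 h).1

/-- The Cayley transform `(1 + i t X) (1 - i t X)⁻¹` of a self-adjoint trace class operator. -/
def U1.cayley (X : TraceClassOp H) (hX : IsSelfAdjoint (TraceClassOp.op H X)) (t : ℝ) : U1 H where
  op := (1 + (Complex.I * t) • TraceClassOp.op H X) *
    Ring.inverse (1 - (Complex.I * t) • TraceClassOp.op H X)
  unitary := by
    set S := 1 - (Complex.I * t) • TraceClassOp.op H X with hS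
    have hu : IsUnit S := isUnit_one_sub_smul hX t
    -- The numerator is the adjoint of the denominator `S`, and `S` is normal; hence `S* S⁻¹` is
    -- unitary.
    have hS' : 1 + (Complex.I * t) • TraceClassOp.op H X = star S := by
      rw [hS, star_sub, star_one, star_smul, hX.star_eq]
      simp
    have hc : S * star S = star S * S := by
      rw [← hS', hS, sub_mul, mul_add, mul_add, add_mul, mul_sub, mul_sub]
      simp only [mul_one, one_mul]
      abel
    rw [hS']
    obtain ⟨u, hu'⟩ := hu
    rw [← hu', Ring.inverse_unit]
    have hus : (u : H →L[ℂ] H) * star (u : H →L[ℂ] H) = star (u : H →L[ℂ] H) * u := by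
      rw [hu']
      exact hc
    have h1 : star (↑u⁻¹ : H →L[ℂ] H) * star (u : H →L[ℂ] H) = 1 := by
      rw [← star_mul, Units.mul_inv, star_one]
    have h2 : star (u : H →L[ℂ] H) * star (↑u⁻¹ : H →L[ℂ] H) = 1 := by
      rw [← star_mul, Units.inv_mul, star_one]
    rw [Unitary.mem_iff, star_mul, star_star]
    constructor
    · calc star (↑u⁻¹ : H →L[ℂ] H) * u * (star (u : H →L[ℂ] H) * ↑u⁻¹) =
          star (↑u⁻¹ : H →L[ℂ] H) * (u * star (u : H →L[ℂ] H)) * ↑u⁻¹ := by simp only [mul_assoc]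
        _ = (star (↑u⁻¹ : H →L[ℂ] H) * star (u : H →L[ℂ] H)) * (u * ↑u⁻¹) := by
          rw [hus]
          simp only [mul_assoc]
        _ = 1 := by rw [h1, Units.mul_inv, one_mul]
    · have h3 : (↑u⁻¹ : H →L[ℂ] H) * star (↑u⁻¹ : H →L[ℂ] H) =
          star (↑u⁻¹ : H →L[ℂ] H) * ↑u⁻¹ := by
        have h4 : ((u : H →L[ℂ] H) * star (u : H →L[ℂ] H)) *
            (star (↑u⁻¹ : H →L[ℂ] H) * ↑u⁻¹) = 1 := by
          rw [mul_assoc, ← mul_assoc (star (u : H →L[ℂ] H)), h2, one_mul, Units.mul_inv]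
        have h5 : (↑u⁻¹ * star (↑u⁻¹ : H →L[ℂ] H)) * ((u : H →L[ℂ] H) * star (u : H →L[ℂ] H)) = 1 := by
          rw [hus, mul_assoc, ← mul_assoc (star (↑u⁻¹ : H →L[ℂ] H)), h1, one_mul, Units.inv_mul]
        exact left_inv_eq_right_inv h5 h4
      calc star (u : H →L[ℂ] H) * ↑u⁻¹ * (star (↑u⁻¹ : H →L[ℂ] H) * u) =
          star (u : H →L[ℂ] H) * (↑u⁻¹ * star (↑u⁻¹ : H →L[ℂ] H)) * u := by simp only [mul_assoc]
        _ = (star (u : H →L[ℂ] H) * star (↑u⁻¹ : H →L[ℂ] H)) * (↑u⁻¹ * u) := by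
          rw [h3]
          simp only [mul_assoc]
        _ = 1 := by rw [h2, Units.inv_mul, one_mul]
  traceClass := by
    have hu := isUnit_one_sub_smul hX t
    set S := 1 - (Complex.I * t) • TraceClassOp.op H X with hS
    have h : (1 + (Complex.I * t) • TraceClassOp.op H X) * Ring.inverse S - 1 =
        (2 * (Complex.I * t)) • (TraceClassOp.op H X * Ring.inverse S) := by
      have h1 : (1 : H →L[ℂ] H) = S * Ring.inverse S := (Ring.mul_inverse_cancel S hu).symm
      conv_lhs =>
        rhs
        rw [h1]
      rw [← sub_mul, hS, ← smul_mul_assoc, two_mul, add_smul]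
      congr 1
      abel
    rw [h]
    exact (IsTraceClass.mul_right X.2 _).smul _

theorem U1.emb_cayley (X : TraceClassOp H) (hX : IsSelfAdjoint (TraceClassOp.op H X)) (t : ℝ) :
    (U1.cayley X hX t).emb = (2 * (Complex.I * t)) •
      TraceClassOp.mulR H (Ring.inverse (1 - (Complex.I * t) • TraceClassOp.op H X)) X := by
  apply TraceClassOp.op_injective
  rw [U1.op_emb, map_smul, TraceClassOp.op_mulR]
  have hu := isUnit_one_sub_smul hX t
  change (1 + (Complex.I * t) • TraceClassOp.op H X) * Ring.inverse _ - 1 = _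
  set S := 1 - (Complex.I * t) • TraceClassOp.op H X with hS
  have h1 : (1 : H →L[ℂ] H) = S * Ring.inverse S := (Ring.mul_inverse_cancel S hu).symm
  conv_lhs =>
    rhs
    rw [h1]
  rw [← sub_mul, hS, ← smul_mul_assoc, two_mul, add_smul]
  congr 1
  abel

theorem contDiff_ofReal : ContDiff ℝ ∞ (fun t : ℝ => (t : ℂ)) := Complex.ofRealCLM.contDiff

/-- The trace class factor `X` is fixed, and only a bounded inverse depends on `t`, smoothly in
operator norm; the ideal bound upgrades this to the trace norm. -/
theorem contDiff_cayley (X : TraceClassOp H) (hX : IsSelfAdjoint (TraceClassOp.op H X)) :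
    ContDiff ℝ ∞ fun t => (U1.cayley X hX t).emb := by
  simp only [U1.emb_cayley]
  have h1 : ContDiff ℝ ∞ fun t : ℝ => Complex.I * (t : ℂ) := contDiff_const.mul contDiff_ofReal
  have h2 : ContDiff ℝ ∞ fun t : ℝ => 1 - (Complex.I * (t : ℂ)) • TraceClassOp.op H X :=
    contDiff_const.sub (h1.smul contDiff_const)
  have h3 : ContDiff ℝ ∞ fun t : ℝ =>
      Ring.inverse (1 - (Complex.I * (t : ℂ)) • TraceClassOp.op H X) := by
    rw [contDiff_iff_contDiffAt]
    intro t
    obtain ⟨u, hu⟩ := isUnit_one_sub_smul hX t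
    have := contDiffAt_ringInverse ℝ (n := ∞) u
    rw [hu] at this
    exact this.comp t h2.contDiffAt
  exact (contDiff_const.mul h1).smul (contDiff_mulR h3 contDiff_const)

theorem isCompactOperator_rankOne (x y : H) :
    IsCompactOperator (InnerProductSpace.rankOne ℂ x y) := by
  have h : IsCompactOperator (innerSL ℂ y) :=
    ⟨Metric.closedBall 0 1, isCompact_closedBall 0 1,
      (innerSL ℂ y).continuous.continuousAt.preimage_mem_nhds
        (by rw [map_zero]; exact Metric.closedBall_mem_nhds 0 one_pos)⟩
  exact h.clm_comp (ContinuousLinearMap.toSpanSingleton ℂ x)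

/-- Finite sections have finite rank and converge in trace norm, hence in operator norm. -/
theorem IsTraceClass.isCompactOperator {ι : Type*} (b : HilbertBasis ι ℂ H) {T : H →L[ℂ] H}
    (hT : IsTraceClass T) : IsCompactOperator T := by
  have h := ((TraceClassOp.opL H).continuous.tendsto _).comp
    (tendsto_compress b (TraceClassOp.mk T hT))
  refine isCompactOperator_of_tendsto (F := fun s => TraceClassOp.opL H
    (TraceClassOp.compress b s (TraceClassOp.mk T hT))) h (Filter.Eventually.of_forall fun s => ?_)
  rw [TraceClassOp.opL_apply, TraceClassOp.op_compress, mul_assoc]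
  have hp : IsCompactOperator (coordProj b s) := by
    have : coordProj b s ∈ compactOperator (RingHom.id ℂ) H H :=
      Submodule.sum_mem _ fun i _ => isCompactOperator_rankOne (b i) (b i)
    exact this
  exact hp.comp_clm (TraceClassOp.op H (TraceClassOp.mk T hT) * coordProj b s)

/-- The Fredholm alternative for the compact operator `Q - 1` at the point `-2`. -/
theorem U1.isUnit_add_one {ι : Type*} (b : HilbertBasis ι ℂ H) (Q : U1 H)
    (h : ∀ x, Q.op x = -x → x = 0) : IsUnit (Q.op + 1) := by
  have hc := Q.traceClass.isCompactOperator b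
  rcases hc.hasEigenvalue_or_mem_resolventSet (μ := -2) (by norm_num) with h1 | h1
  · obtain ⟨x, hx⟩ := h1.exists_hasEigenvector
    have h2 : (Q.op - 1) x = (-2 : ℂ) • x := hx.apply_eq_smul
    rw [sub_apply, one_apply_eq_self] at h2
    refine absurd (h x ?_) hx.2
    rw [sub_eq_iff_eq_add.1 h2, neg_smul, two_smul]
    abel
  · have h2 : IsUnit (algebraMap ℂ (H →L[ℂ] H) (-2) - (Q.op - 1)) := h1
    have h3 : algebraMap ℂ (H →L[ℂ] H) (-2) - (Q.op - 1) = -(Q.op + 1) := by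
      rw [map_neg, map_ofNat, ← one_add_one_eq_two]
      abel
    rw [h3] at h2
    simpa using h2.neg

/-- The inverse Cayley transform `i X = (Q - 1) (Q + 1)⁻¹`: then `1 + i X = 2 Q (Q + 1)⁻¹` and `1 -
i X = 2 (Q + 1)⁻¹`, with quotient `Q`. -/
theorem U1.exists_cayley {ι : Type*} (b : HilbertBasis ι ℂ H) (Q : U1 H)
    (h : ∀ x, Q.op x = -x → x = 0) :
    ∃ (X : TraceClassOp H) (hX : IsSelfAdjoint (TraceClassOp.op H X)), U1.cayley X hX 1 = Q := by
  obtain ⟨u, hu⟩ := Q.isUnit_add_one b h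
  set R : H →L[ℂ] H := ↑u⁻¹ with hR
  have hRu : R * (Q.op + 1) = 1 := by rw [← hu, hR, Units.inv_mul]
  have huR : (Q.op + 1) * R = 1 := by rw [← hu, hR, Units.mul_inv]
  have hc : R * Q.op = Q.op * R := by
    have h1 : R * Q.op + R = 1 := by rw [← hRu, mul_add, mul_one]
    have h2 : Q.op * R + R = 1 := by rw [← huR, add_mul, one_mul]
    exact add_right_cancel (h1.trans h2.symm)
  -- `(Q - 1) R` is skew-adjoint since `Q* (Q + 1) = Q* + 1`
  have hRs : star R = Q.op * R := by
    have h1 : star R * (star Q.op + 1) = 1 := by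
      rw [← star_one, ← star_add, ← star_mul, huR, star_one]
    have h2 : (star Q.op + 1) * (Q.op * R) = 1 := by
      rw [add_mul, ← mul_assoc, U1.star_mul_op, one_mul, one_mul]
      rw [add_mul, one_mul] at huR
      rw [add_comm]
      exact huR
    exact left_inv_eq_right_inv h1 h2
  let X : TraceClassOp H := (-Complex.I) • TraceClassOp.mulR H R Q.emb
  have hXop : TraceClassOp.op H X = (-Complex.I) • ((Q.op - 1) * R) := rfl
  have hX : IsSelfAdjoint (TraceClassOp.op H X) := by
    rw [IsSelfAdjoint, hXop, star_smul, star_mul, hRs, star_sub, star_one]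
    have h1 : Q.op * R * (star Q.op - 1) = -((Q.op - 1) * R) := by
      rw [← hc, mul_assoc, mul_sub, U1.op_mul_star, mul_one, sub_mul, one_mul, ← hc, mul_sub, mul_one]
      abel
    rw [h1]
    simp
  refine ⟨X, hX, ?_⟩
  ext1
  change (1 + (Complex.I * (1 : ℝ)) • TraceClassOp.op H X) *
    Ring.inverse (1 - (Complex.I * (1 : ℝ)) • TraceClassOp.op H X) = Q.op
  have hI : (Complex.I * ((1 : ℝ) : ℂ)) • TraceClassOp.op H X = (Q.op - 1) * R := by
    rw [hXop, smul_smul]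
    simp
  have hu := isUnit_one_sub_smul hX 1
  rw [hI] at hu ⊢
  have h2 : 1 + (Q.op - 1) * R = Q.op * (1 - (Q.op - 1) * R) := by
    have h3 : 1 + (Q.op - 1) * R = (Q.op + 1) * R + (Q.op - 1) * R := by rw [huR]
    have h4 : 1 - (Q.op - 1) * R = (Q.op + 1) * R - (Q.op - 1) * R := by rw [huR]
    rw [h3, h4]
    noncomm_ring
  rw [h2, mul_assoc, Ring.mul_inverse_cancel _ hu, mul_one]

/-- Every element of `U¹` is joined to the base point by a smooth path. -/
theorem U1.exists_path {ι : Type*} (b : HilbertBasis ι ℂ H) (P : U1 H) :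
    ∃ γ : ℝ → U1 H, ContDiff ℝ ∞ (fun t => (γ t).emb) ∧ γ 0 = P ∧ γ 1 = U1.base H := by
  -- The eigenspace for `-1` is the only obstruction to writing `P` as a Cayley transform.
  let E : Submodule ℂ H := LinearMap.ker (P.op + 1).toLinearMap
  have hmem : ∀ x, x ∈ E ↔ P.op x = -x := fun x => by
    rw [LinearMap.mem_ker]
    exact eq_neg_iff_add_eq_zero.symm
  have hE : IsClosed (E : Set H) := (P.op + 1).isClosed_ker
  set p := orthProj E hE with hpdef
  have hp : IsSelfAdjoint p := orthProj_isSelfAdjoint E hE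
  have hpp : p * p = p := orthProj_mul_self E hE
  have hPp : P.op * p = -p := by
    ext x
    exact (hmem _).1 (orthProj_mem E hE x)
  have hpP : p * P.op = -p := by
    have h1 : p = -(star P.op * p) := by
      rw [← mul_neg, ← hPp, ← mul_assoc, U1.star_mul_op, one_mul]
    have h2 := congrArg star h1
    rw [star_neg, star_mul, star_star, hp.star_eq] at h2
    rw [eq_neg_iff_add_eq_zero, add_comm]
    exact eq_neg_iff_add_eq_zero.1 h2
  -- On this eigenspace `P - 1` is multiplication by `-2`, so `p` is a multiple of `(P - 1) p`.
  have ht : IsTraceClass p := by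
    have h1 : p = (-(1 / 2) : ℂ) • ((P.op - 1) * p) := by
      rw [sub_mul, one_mul, hPp, ← neg_add', ← two_smul ℂ p, smul_neg, smul_smul]
      norm_num
    rw [h1]
    exact (P.traceClass.mul_right p).smul _
  have hexp : ∀ t : ℝ, ‖Complex.exp (Real.pi * t * Complex.I)‖ = 1 := fun t => by
    have := Complex.norm_exp_ofReal_mul_I (Real.pi * t)
    push_cast at this
    exact this
  let δ : ℝ → U1 H := fun t => U1.ofProjection p hp hpp ht (Complex.exp (Real.pi * t * Complex.I)) (hexp t)
  have hδ : ContDiff ℝ ∞ fun t => (δ t).emb := by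
    simp only [δ, U1.emb_ofProjection]
    have h1 : ContDiff ℝ ∞ fun t : ℝ => Complex.exp (Real.pi * t * Complex.I) - 1 :=
      ((contDiff_const.mul contDiff_ofReal).mul contDiff_const).cexp.sub contDiff_const
    exact h1.smul contDiff_const
  have hδ1 : (δ 1).op = 1 - (2 : ℂ) • p := by
    change 1 + (Complex.exp (Real.pi * (1 : ℝ) * Complex.I) - 1) • p = _
    rw [Complex.ofReal_one, mul_one, Complex.exp_pi_mul_I, sub_eq_add_neg 1, ← neg_smul]
    norm_num
  have hδ0 : (δ 0).op = 1 := by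
    change 1 + (Complex.exp (Real.pi * (0 : ℝ) * Complex.I) - 1) • p = _
    simp
  have hδδ : (δ 1).op * (δ 1).op = 1 := by
    rw [hδ1, sub_mul, mul_sub, mul_sub, smul_mul_smul_comm, hpp, one_mul, one_mul, mul_one,
      mul_smul, two_smul ℂ ((2 : ℂ) • p)]
    abel
  -- Multiplying by the reflection `1 - 2 p` turns the eigenvalue `-1` into `1`, so `Q` is a Cayley
  -- transform. The reflection is its own inverse, hence `P = Q · δ 1`, and both factors are
  -- contracted to `1` at once.
  let Q := P.mul (δ 1)
  have hQ : ∀ x, Q.op x = -x → x = 0 := by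
    intro x hx
    have hQop : Q.op = P.op + (2 : ℂ) • p := by
      change P.op * (δ 1).op = _
      rw [hδ1, mul_sub, mul_one, mul_smul_comm, hPp, smul_neg, sub_neg_eq_add]
    have h1 : p x = 0 := by
      have h2 : p (Q.op x) = p x := by
        rw [← mul_apply_eq_comp, hQop, mul_add, mul_smul_comm, hpP, hpp, two_smul]
        congr 1
        abel
      rw [hx, map_neg] at h2
      have h3 : (2 : ℂ) • p x = 0 := by
        rw [two_smul]
        nth_rewrite 1 [← h2]
        exact neg_add_cancel _
      simpa using h3
    have h4 : P.op x = -x := by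
      rw [hQop, add_apply, smul_apply, h1, smul_zero, add_zero] at hx
      exact hx
    rw [← orthProj_eq_self E hE ((hmem x).2 h4)]
    exact h1
  obtain ⟨X, hX, hXQ⟩ := Q.exists_cayley b hQ
  refine ⟨fun t => (U1.cayley X hX (1 - t)).mul (δ (1 - t)), ?_, ?_, ?_⟩
  · exact contDiff_emb_mul ((contDiff_cayley X hX).comp (contDiff_const.sub contDiff_id))
      (hδ.comp (contDiff_const.sub contDiff_id))
  · ext1
    change (U1.cayley X hX (1 - 0)).op * (δ (1 - 0)).op = P.op
    rw [sub_zero, hXQ]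
    change P.op * (δ 1).op * (δ 1).op = P.op
    rw [mul_assoc, hδδ, mul_one]
  · ext1
    change (1 + (Complex.I * ((1 - 1 : ℝ) : ℂ)) • TraceClassOp.op H X) *
      Ring.inverse (1 - (Complex.I * ((1 - 1 : ℝ) : ℂ)) • TraceClassOp.op H X) * (δ (1 - 1)).op = 1
    rw [sub_self, hδ0]
    simp

end Paths

/-! ### Correcting a path by a phase on one basis vector -/

section OddKTheory

variable {H : Type*} [NormedAddCommGroup H] [InnerProductSpace ℂ H] [CompleteSpace H]
variable (c : HilbertBasis ℕ ℂ H)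

/-- The projection onto the line spanned by the first basis vector. -/
def lineProj : H →L[ℂ] H := InnerProductSpace.rankOne ℂ (c 0) (c 0)

theorem lineProj_basis (i : ℕ) : lineProj c (c i) = if i = 0 then c 0 else 0 := by
  rw [lineProj, InnerProductSpace.rankOne_apply, orthonormal_iff_ite.1 c.orthonormal]
  by_cases h : i = 0
  · simp [h]
  · simp [h, Ne.symm h]

theorem lineProj_isSelfAdjoint : IsSelfAdjoint (lineProj c) := by
  rw [IsSelfAdjoint, ContinuousLinearMap.star_eq_adjoint, lineProj,
    InnerProductSpace.adjoint_rankOne]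

theorem lineProj_mul_self : lineProj c * lineProj c = lineProj c := by
  apply op_ext c
  intro i
  rw [mul_apply_eq_comp, lineProj_basis]
  by_cases h : i = 0 <;> simp [h, lineProj_basis]

theorem isTraceClass_lineProj : IsTraceClass (lineProj c) := isTraceClass_rankOne _ _

/-- The unitary operator `diag (z, 1, 1, …)`. -/
def U1.phase (z : ℂ) (hz : ‖z‖ = 1) : U1 H :=
  U1.ofProjection (lineProj c) (lineProj_isSelfAdjoint c) (lineProj_mul_self c)
    (isTraceClass_lineProj c) z hz

theorem U1.op_phase (z : ℂ) (hz : ‖z‖ = 1) : (U1.phase c z hz).op = 1 + (z - 1) • lineProj c := rfl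

theorem U1.phase_basis (z : ℂ) (hz : ‖z‖ = 1) (i : ℕ) :
    (U1.phase c z hz).op (c i) = (if i = 0 then z else 1) • c i := by
  rw [U1.op_phase, add_apply, one_apply_eq_self, smul_apply, lineProj_basis]
  by_cases h : i = 0
  · simp [h, sub_smul]
  · simp [h]

theorem U1.det_phase (z : ℂ) (hz : ‖z‖ = 1) : (U1.phase c z hz).det c = z := by
  apply U1.det_eq_of_isFredholmDet
  rw [isFredholmDet_iff]
  refine tendsto_const_nhds.congr' ?_
  filter_upwards [Filter.eventually_ge_atTop ({0} : Finset ℕ)] with s hs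
  have h0 : 0 ∈ s := hs (Finset.mem_singleton_self 0)
  have hM : sectionMatrix c s (U1.phase c z hz).op =
      Matrix.diagonal fun i : s => if (i : ℕ) = 0 then z else 1 := by
    ext i j
    rw [sectionMatrix_apply, U1.phase_basis, inner_smul_right,
      orthonormal_iff_ite.1 c.orthonormal, Matrix.diagonal_apply]
    by_cases h : i = j
    · subst h
      simp
    · have : (i : ℕ) ≠ j := fun e => h (Subtype.ext e)
      simp [h, this]
  rw [sectionDet_eq, hM, Matrix.det_diagonal,
    Finset.prod_coe_sort s (fun i => if i = 0 then z else 1)]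
  rw [Finset.prod_ite_eq' s 0 (fun _ => z)]
  simp [h0]

/-- The phase is diagonal, so each diagonal entry is multiplied by a squared modulus equal to one;
no general cyclicity of the trace is needed. -/
theorem opTrace_conj_phase (z : ℂ) (hz : ‖z‖ = 1) (T : H →L[ℂ] H) :
    opTrace c (star (U1.phase c z hz).op * T * (U1.phase c z hz).op) = opTrace c T := by
  refine tsum_congr fun i => ?_
  have hzz : starRingEnd ℂ z * z = 1 := by
    rw [Complex.conj_mul', hz]
    simp
  rw [mul_assoc, mul_apply_eq_comp, ContinuousLinearMap.star_eq_adjoint,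
    ContinuousLinearMap.adjoint_inner_right, mul_apply_eq_comp, U1.phase_basis, map_smul,
    inner_smul_left, inner_smul_right, ← mul_assoc]
  by_cases h : i = 0
  · simp [h, hzz]
  · simp [h]

theorem opTrace_star_phase_mul_lineProj (z : ℂ) (hz : ‖z‖ = 1) :
    opTrace c (star (U1.phase c z hz).op * lineProj c) = starRingEnd ℂ z := by
  rw [opTrace, tsum_eq_single 0]
  · rw [mul_apply_eq_comp, lineProj_basis, if_pos rfl, ContinuousLinearMap.star_eq_adjoint,
      ContinuousLinearMap.adjoint_inner_right, U1.phase_basis, inner_smul_left,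
      inner_self_eq_norm_sq_to_K, c.orthonormal.1]
    simp
  · intro i hi
    rw [mul_apply_eq_comp, lineProj_basis, if_neg hi, map_zero, inner_zero_right]

theorem opTrace_star (T : H →L[ℂ] H) : opTrace c (star T) = starRingEnd ℂ (opTrace c T) := by
  rw [opTrace, opTrace, Complex.conj_tsum]
  refine tsum_congr fun i => ?_
  rw [inner_conj_symm, ContinuousLinearMap.star_eq_adjoint, ContinuousLinearMap.adjoint_inner_right]

/-- The trace of the logarithmic derivative of a path of unitary operators is imaginary. -/
theorem logTrace_re_eq_zero {γ : ℝ → U1 H} (hγ : ContDiff ℝ ∞ fun t => (γ t).emb) (t : ℝ) :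
    (logTrace c (γ t) (deriv (fun t => (γ t).emb) t)).re = 0 := by
  set T := deriv (fun t => (γ t).emb) t with hT
  have h1 : HasDerivAt (fun t => (γ t).emb) T t :=
    (hγ.differentiable (by simp) t).hasDerivAt
  have h2 : HasDerivAt (fun t => (γ t).op) (TraceClassOp.op H T) t := by
    simp only [U1.op_eq]
    exact (((TraceClassOp.opL H).restrictScalars ℝ).hasFDerivAt.comp_hasDerivAt t h1).const_add _
  have h3 : HasDerivAt (fun t => star (γ t).op * (γ t).op)
      (star (TraceClassOp.op H T) * (γ t).op + star (γ t).op * TraceClassOp.op H T) t :=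
    h2.star.mul h2
  have h4 : HasDerivAt (fun t => star (γ t).op * (γ t).op) 0 t := by
    simp only [U1.star_mul_op]
    exact hasDerivAt_const _ _
  have h5 := h3.unique h4
  have h6 : star (star (γ t).op * TraceClassOp.op H T) = -(star (γ t).op * TraceClassOp.op H T) := by
    rw [star_mul, star_star]
    exact eq_neg_of_add_eq_zero_left h5
  have h7 := opTrace_star c (star (γ t).op * TraceClassOp.op H T)
  rw [h6, ← logTrace_eq] at h7
  have h8 : opTrace c (-(star (γ t).op * TraceClassOp.op H T)) = -logTrace c (γ t) T :=
    map_neg (TraceClassOp.traceL c) (TraceClassOp.mulL H (star (γ t).op) T)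
  rw [h8] at h7
  have h9 := congrArg Complex.re h7
  rw [Complex.neg_re, Complex.conj_re] at h9
  linarith

/-- A path in `U¹` from `P` to `1` can be corrected to a path from `P` to some `diag (z, 1, 1, …)`
along which the trace of the logarithmic derivative vanishes. -/
theorem exists_corrected_path {γ : ℝ → U1 H} (hγ : ContDiff ℝ ∞ fun t => (γ t).emb)
    (h1 : γ 1 = U1.base H) :
    ∃ (δ : ℝ → U1 H) (z : ℂ) (hz : ‖z‖ = 1), ContDiff ℝ ∞ (fun t => (δ t).emb) ∧ δ 0 = γ 0 ∧
      δ 1 = U1.phase c z hz ∧ ∀ t, logTrace c (δ t) (deriv (fun t => (δ t).emb) t) = 0 := by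
  let g : ℝ → TraceClassOp H := fun t => (γ t).emb
  have hg : ContDiff ℝ ∞ g := hγ
  have hg' : ContDiff ℝ ∞ (deriv g) := (contDiff_infty_iff_deriv.1 hg).2
  let τ : ℝ → ℂ := fun t => logTrace c (γ t) (deriv g t)
  have hτ : ContDiff ℝ ∞ τ := by
    have h2 : ContDiff ℝ ∞ fun t => star (γ t).op :=
      (starL' ℝ : (H →L[ℂ] H) ≃L[ℝ] (H →L[ℂ] H)).contDiff.comp (contDiff_op hγ)
    exact ((TraceClassOp.traceL c).restrictScalars ℝ).contDiff.comp (contDiff_mulL h2 hg')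
  let θ : ℝ → ℂ := fun t => ∫ u in (0 : ℝ)..t, τ u
  have hθ' : ∀ t, HasDerivAt θ (τ t) t := fun t =>
    (hτ.continuous.integral_hasStrictDerivAt 0 t).hasDerivAt
  have hθ : ContDiff ℝ ∞ θ := by
    rw [contDiff_infty_iff_deriv]
    refine ⟨fun t => (hθ' t).differentiableAt, ?_⟩
    have : deriv θ = τ := funext fun t => (hθ' t).deriv
    rwa [this]
  have hθre : ∀ t, (θ t).re = 0 := by
    intro t
    have hi : IntervalIntegrable τ MeasureTheory.volume 0 t := hτ.continuous.intervalIntegrable _ _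
    have := Complex.reCLM.intervalIntegral_comp_comm hi
    change Complex.reCLM (θ t) = 0
    rw [← this]
    have hz : ∀ u, Complex.reCLM (τ u) = 0 := fun u => logTrace_re_eq_zero c hγ u
    simp [hz]
  -- The solution of `ζ' = -τ ζ` with `ζ 0 = 1`; it has modulus one because `τ` is imaginary.
  let ζ : ℝ → ℂ := fun t => Complex.exp (-θ t)
  have hζn : ∀ t, ‖ζ t‖ = 1 := by
    intro t
    rw [Complex.norm_exp, Complex.neg_re, hθre, neg_zero, Real.exp_zero]
  have hζ : ContDiff ℝ ∞ ζ := hθ.neg.cexp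
  have hζ' : ∀ t, HasDerivAt ζ (ζ t * -τ t) t := fun t => (hθ' t).neg.cexp
  let r : TraceClassOp H := TraceClassOp.mk (lineProj c) (isTraceClass_lineProj c)
  let D : ℝ → U1 H := fun t => U1.phase c (ζ t) (hζn t)
  have hDe : ∀ t, (D t).emb = (ζ t - 1) • r := fun t => U1.emb_ofProjection _ _ _ _ _ _
  have hD : ContDiff ℝ ∞ fun t => (D t).emb := by
    simp only [hDe]
    exact (hζ.sub contDiff_const).smul contDiff_const
  refine ⟨fun t => (γ t).mul (D t), ζ 1, hζn 1, contDiff_emb_mul hγ hD, ?_, ?_, ?_⟩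
  · ext1
    change (γ 0).op * (1 + (ζ 0 - 1) • lineProj c) = (γ 0).op
    simp [ζ, θ]
  · ext1
    change (γ 1).op * (D 1).op = (D 1).op
    rw [h1]
    exact one_mul _
  · intro t
    have hDd : HasDerivAt (fun t => (D t).emb) ((ζ t * -τ t) • r) t := by
      simp only [hDe]
      exact ((hζ' t).sub_const 1).smul_const r
    have hd : HasDerivAt (fun t => ((γ t).mul (D t)).op)
        (TraceClassOp.op H (deriv g t) * (D t).op + (γ t).op * ((ζ t * -τ t) • lineProj c)) t := by
      have e1 : HasDerivAt (fun t => (γ t).op) (TraceClassOp.op H (deriv g t)) t := by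
        simp only [U1.op_eq]
        exact (((TraceClassOp.opL H).restrictScalars ℝ).hasFDerivAt.comp_hasDerivAt t
          (hg.differentiable (by simp) t).hasDerivAt).const_add _
      have e2 : HasDerivAt (fun t => (D t).op) ((ζ t * -τ t) • lineProj c) t := by
        simp only [U1.op_eq]
        exact (((TraceClassOp.opL H).restrictScalars ℝ).hasFDerivAt.comp_hasDerivAt t
          hDd).const_add _
      exact e1.mul e2
    have hd2 : TraceClassOp.op H (deriv (fun t => ((γ t).mul (D t)).emb) t) =
        TraceClassOp.op H (deriv g t) * (D t).op + (γ t).op * ((ζ t * -τ t) • lineProj c) := by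
      have e1 : HasDerivAt (fun t => ((γ t).mul (D t)).op)
          (TraceClassOp.op H (deriv (fun t => ((γ t).mul (D t)).emb) t)) t := by
        simp only [U1.op_eq ((γ _).mul _)]
        exact (((TraceClassOp.opL H).restrictScalars ℝ).hasFDerivAt.comp_hasDerivAt t
          ((contDiff_emb_mul hγ hD).differentiable (by simp) t).hasDerivAt).const_add _
      exact e1.unique hd
    rw [logTrace_eq, hd2]
    -- The logarithmic derivative of `γ D` is that of `γ`, conjugated by `D`, plus that of `D`.
    -- Their traces are `τ` and `-τ`.
    have e3 : star ((γ t).mul (D t)).op * (TraceClassOp.op H (deriv g t) * (D t).op +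
        (γ t).op * ((ζ t * -τ t) • lineProj c)) =
        star (D t).op * (star (γ t).op * TraceClassOp.op H (deriv g t)) * (D t).op +
          (ζ t * -τ t) • (star (D t).op * lineProj c) := by
      change star ((γ t).op * (D t).op) * _ = _
      rw [star_mul, mul_add]
      congr 1
      rw [mul_assoc, ← mul_assoc (star (γ t).op), U1.star_mul_op, one_mul, mul_smul_comm]
    have e4 : IsTraceClass (star (D t).op * (star (γ t).op * TraceClassOp.op H (deriv g t)) * (D t).op) :=
      ((IsTraceClass.mul_left (deriv g t).2 _).mul_left _).mul_right _
    have e5 : IsTraceClass (star (D t).op * lineProj c) := (isTraceClass_lineProj c).mul_left _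
    rw [e3, opTrace_add c e4 (e5.smul _), opTrace_conj_phase]
    have e6 : opTrace c ((ζ t * -τ t) • (star (D t).op * lineProj c)) =
        (ζ t * -τ t) * opTrace c (star (D t).op * lineProj c) :=
      map_smul (TraceClassOp.traceL c) (ζ t * -τ t) (TraceClassOp.mk _ e5)
    have e7 : starRingEnd ℂ (ζ t) * ζ t = 1 := by
      rw [Complex.conj_mul', hζn]
      simp
    rw [e6, opTrace_star_phase_mul_lineProj, ← logTrace_eq]
    change τ t + _ = 0
    linear_combination -τ t * e7

end OddKTheory

/-! ### The group K̂¹ of the point -/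

section OddPoint

variable {H : Type*} [NormedAddCommGroup H] [InnerProductSpace ℂ H] [CompleteSpace H]

section DetBlockSum

variable {ι : Type*} (s : Splitting ι) (b : HilbertBasis ι ℂ H)

theorem blockSum_even (A B : H →L[ℂ] H) (i : ι) :
    blockSum s b A B (b (s.even i)) = star (rho₀ s b) (A (b i)) := by
  rw [blockSum, add_apply, mul_apply_eq_comp, mul_apply_eq_comp, mul_apply_eq_comp, rho₀_even,
    rho₁_even, map_zero, add_zero]

theorem blockSum_odd (A B : H →L[ℂ] H) (i : ι) :
    blockSum s b A B (b (s.odd i)) = star (rho₁ s b) (B (b i)) := by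
  rw [blockSum, add_apply, mul_apply_eq_comp, mul_apply_eq_comp, mul_apply_eq_comp, rho₀_odd,
    rho₁_odd, map_zero, map_zero, zero_add, mul_apply_eq_comp]

theorem inner_even_star_rho₀ (i : ι) (x : H) :
    inner ℂ (b (s.even i)) (star (rho₀ s b) x) = inner ℂ (b i) x := by
  rw [ContinuousLinearMap.star_eq_adjoint, ContinuousLinearMap.adjoint_inner_right, rho₀_even]

theorem inner_even_star_rho₁ (i : ι) (x : H) :
    inner ℂ (b (s.even i)) (star (rho₁ s b) x) = 0 := by
  rw [ContinuousLinearMap.star_eq_adjoint, ContinuousLinearMap.adjoint_inner_right, rho₁_even,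
    inner_zero_left]

theorem inner_odd_star_rho₀ (i : ι) (x : H) :
    inner ℂ (b (s.odd i)) (star (rho₀ s b) x) = 0 := by
  rw [ContinuousLinearMap.star_eq_adjoint, ContinuousLinearMap.adjoint_inner_right, rho₀_odd,
    inner_zero_left]

theorem inner_odd_star_rho₁ (i : ι) (x : H) :
    inner ℂ (b (s.odd i)) (star (rho₁ s b) x) = inner ℂ (b i) x := by
  rw [ContinuousLinearMap.star_eq_adjoint, ContinuousLinearMap.adjoint_inner_right, rho₁_odd]

/-- The indices in the two copies of `u`. -/
def Splitting.double [DecidableEq ι] (u : Finset ι) : Finset ι := u.image s.even ∪ u.image s.odd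

/-- Doubled index sets are cofinal, so the determinant of a block sum may be computed along them. -/
theorem Splitting.tendsto_double [DecidableEq ι] :
    Filter.Tendsto (Splitting.double s) Filter.atTop Filter.atTop := by
  refine Filter.tendsto_atTop_finset_of_monotone (fun u v h => ?_) fun k => ?_
  · exact Finset.union_subset_union (Finset.image_subset_image h) (Finset.image_subset_image h)
  · rcases s.mem_or k with ⟨i, rfl⟩ | ⟨i, rfl⟩
    · exact ⟨{i}, by simp [Splitting.double]⟩
    · exact ⟨{i}, by simp [Splitting.double]⟩

/-- The index set of a double is a disjoint union of two copies. -/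
def Splitting.doubleEquiv [DecidableEq ι] (u : Finset ι) : u ⊕ u ≃ Splitting.double s u :=
  Equiv.ofBijective
    (Sum.elim
      (fun i => ⟨s.even i, Finset.mem_union_left _ (Finset.mem_image_of_mem _ i.2)⟩)
      (fun i => ⟨s.odd i, Finset.mem_union_right _ (Finset.mem_image_of_mem _ i.2)⟩))
    ⟨by
      rintro (i | i) (j | j) h
      · exact congrArg Sum.inl (Subtype.ext (s.even_inj (congrArg Subtype.val h)))
      · exact (s.even_ne_odd _ _ (congrArg Subtype.val h)).elim
      · exact (s.even_ne_odd _ _ (congrArg Subtype.val h).symm).elim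
      · exact congrArg Sum.inr (Subtype.ext (s.odd_inj (congrArg Subtype.val h))), by
      rintro ⟨k, hk⟩
      rcases Finset.mem_union.1 hk with hk | hk
      · obtain ⟨i, hi, rfl⟩ := Finset.mem_image.1 hk
        exact ⟨Sum.inl ⟨i, hi⟩, rfl⟩
      · obtain ⟨i, hi, rfl⟩ := Finset.mem_image.1 hk
        exact ⟨Sum.inr ⟨i, hi⟩, rfl⟩⟩

/-- Reindexed by `Splitting.doubleEquiv`, the section over a doubled set is block diagonal. -/
theorem sectionDet_blockSum [DecidableEq ι] (u : Finset ι) (A B : H →L[ℂ] H) :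
    sectionDet b (Splitting.double s u) (blockSum s b A B) =
      sectionDet b u A * sectionDet b u B := by
  have h : (sectionMatrix b (Splitting.double s u) (blockSum s b A B)).submatrix
      (Splitting.doubleEquiv s u) (Splitting.doubleEquiv s u) =
      Matrix.fromBlocks (sectionMatrix b u A) 0 0 (sectionMatrix b u B) := by
    ext i j
    rcases i with i | i <;> rcases j with j | j
    · change inner ℂ (b (s.even i)) (blockSum s b A B (b (s.even j))) = inner ℂ (b i) (A (b j))
      rw [blockSum_even, inner_even_star_rho₀]
    · change inner ℂ (b (s.even i)) (blockSum s b A B (b (s.odd j))) = 0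
      rw [blockSum_odd, inner_even_star_rho₁]
    · change inner ℂ (b (s.odd i)) (blockSum s b A B (b (s.even j))) = 0
      rw [blockSum_even, inner_odd_star_rho₀]
    · change inner ℂ (b (s.odd i)) (blockSum s b A B (b (s.odd j))) = inner ℂ (b i) (B (b j))
      rw [blockSum_odd, inner_odd_star_rho₁]
  rw [sectionDet_eq, sectionDet_eq, sectionDet_eq,
    ← Matrix.det_submatrix_equiv_self (Splitting.doubleEquiv s u), h,
    Matrix.det_fromBlocks_zero₂₁]

end DetBlockSum

variable (c : HilbertBasis ℕ ℂ H)

theorem U1.det_blockSum (P Q : U1 H) : (U1.blockSum c P Q).det c = P.det c * Q.det c := by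
  have h1 := (U1.isFredholmDet_det c (U1.blockSum c P Q))
  rw [isFredholmDet_iff] at h1
  have h2 := h1.comp (Splitting.tendsto_double natSplitting)
  have h3 : ((fun s => sectionDet c s (U1.blockSum c P Q).op) ∘ Splitting.double natSplitting) =
      fun u => sectionDet c u P.op * sectionDet c u Q.op :=
    funext fun u => sectionDet_blockSum natSplitting c u P.op Q.op
  rw [h3] at h2
  exact tendsto_nhds_unique h2 ((U1.isFredholmDet_det c P).mul (U1.isFredholmDet_det c Q))

theorem U1.det_base : (U1.base H).det c = 1 := by
  apply U1.det_eq_of_isFredholmDet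
  rw [isFredholmDet_iff]
  refine tendsto_const_nhds.congr fun s => ?_
  classical
  change _ = sectionDet c s 1
  rw [sectionDet_eq, sectionMatrix_one, Matrix.det_one]

/-- The degree one component, a multiple of `d log det`; the only permutation is the identity. -/
theorem chOdd_zero (P : U1 H) (A : Fin (2 * 0 + 1) → TraceClassOp H) :
    chOdd c 0 P A = Complex.I / (2 * Real.pi) * logTrace c P (A 0) := by
  rw [logTrace_eq, chOdd]
  have : Subsingleton (Fin (2 * 0 + 1)) := inferInstanceAs (Subsingleton (Fin 1))
  rw [Fintype.sum_eq_single 1 fun σ h => (h (Subsingleton.elim _ _)).elim]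
  simp [List.ofFn_succ]

theorem csForm_chOdd_zero {F : Point × ℝ → U1 H} (h : IsSmoothHomotopy Point U1.emb F) (x : Point)
    (v : Fin (2 * 0) → TangentSpace 𝓘(ℝ, Point) x) :
    csForm (E := Point) U1.emb (chOdd c 0) F x v = Complex.I / (2 * Real.pi) *
      ∫ t in (0 : ℝ)..1, logTrace c (F (x, t))
        (derivWithin (fun t => (F (x, t)).emb) (Set.Icc (0 : ℝ) 1) t) := by
  rw [← intervalIntegral.integral_const_mul, csForm]
  refine intervalIntegral.integral_congr fun t ht => ?_
  rw [Set.uIcc_of_le zero_le_one] at ht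
  simp only [chOdd_zero, Fin.cons_zero]
  congr 2
  exact h.homotopyDeriv_eq x ht

/-- From degree three on, some argument comes from the base. For every permutation it occurs as one
factor of the product, which is therefore zero. -/
theorem csForm_chOdd_succ (F : Point × ℝ → U1 H) (j : ℕ) (x : Point)
    (v : Fin (2 * (j + 1)) → TangentSpace 𝓘(ℝ, Point) x) :
    csForm (E := Point) U1.emb (chOdd c (j + 1)) F x v = 0 := by
  rw [csForm]
  refine intervalIntegral.integral_zero_ae (Filter.Eventually.of_forall fun t _ => ?_)
  rw [chOdd]
  refine mul_eq_zero_of_right _ (Finset.sum_eq_zero fun σ _ => ?_)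
  have h0 : (List.ofFn fun l : Fin (2 * (j + 1) + 1) => star (F (x, t)).op *
      TraceClassOp.op H ((Fin.cons (homotopyDeriv (E := Point) U1.emb F x t 0 1) fun i =>
        homotopyDeriv (E := Point) U1.emb F x t (v i) 0 :
          Fin (2 * (j + 1) + 1) → TraceClassOp H) (σ l))).prod = 0 := by
    apply List.prod_eq_zero
    rw [List.mem_ofFn]
    refine ⟨σ.symm (Fin.succ 0), ?_⟩
    rw [Equiv.apply_symm_apply, Fin.cons_succ, homotopyDeriv_zero_right, map_zero, mul_zero]
  rw [h0]
  simp [opTrace]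

/-- Only the condition in degree zero has content: there exactness means that the integral vanishes.
-/
theorem csHomotopic_chOdd_iff (f g : OddMap H Point Point) :
    CSHomotopic U1.emb (deg := fun j => 2 * j) (chOdd c) f g ↔
      ∃ F : Point × ℝ → U1 H, IsSmoothHomotopy Point U1.emb F ∧ (∀ x, F (x, 0) = f.1 x) ∧
        (∀ x, F (x, 1) = g.1 x) ∧ ∀ x, ∫ t in (0 : ℝ)..1, logTrace c (F (x, t))
          (derivWithin (fun t => (F (x, t)).emb) (Set.Icc (0 : ℝ) 1) t) = 0 := by
  refine exists_congr fun F => and_congr_right fun hF => and_congr_right fun _ =>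
    and_congr_right fun _ => ?_
  have hI : Complex.I / (2 * Real.pi) ≠ 0 := by
    simp [Real.pi_ne_zero]
  constructor
  · intro h x
    have h0 : csForm (E := Point) U1.emb (chOdd c 0) F x (fun i => i.elim0) = 0 := h 0 x _
    rw [csForm_chOdd_zero c hF] at h0
    exact (mul_eq_zero.1 h0).resolve_left hI
  · rintro h (_ | j)
    · intro x v
      rw [csForm_chOdd_zero c hF, h, mul_zero]
    · exact isExactForm_of_forall_eq_zero _ fun x v => csForm_chOdd_succ c F j x v

theorem det_eq_of_csHomotopic {f g : OddMap H Point Point}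
    (h : CSHomotopic U1.emb (deg := fun j => 2 * j) (chOdd c) f g) :
    (f.1 0).det c = (g.1 0).det c := by
  obtain ⟨F, hF, h0, h1, hi⟩ := (csHomotopic_chOdd_iff c f g).1 h
  have := det_path c (γ := fun t => F (0, t)) (hF.contDiffOn 0)
  rw [hi, Complex.exp_zero, mul_one, h0, h1] at this
  exact this.symm

/-- The constant map with value `P`. -/
def OddMap.const (P : U1 H) : OddMap H Point Point := ⟨fun _ => P, contMDiff_const⟩

theorem OddMap.eq_const (f : OddMap H Point Point) : f = OddMap.const (f.1 0) :=
  Subtype.ext (funext fun x => congrArg f.1 (Subsingleton.elim x 0))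

/-- Normal form of a class. Along the corrected path the integrand vanishes identically, so the path
is a Chern–Simons homotopy. -/
theorem KHat1.exists_phase (f : OddMap H Point Point) :
    ∃ (z : ℂ) (hz : ‖z‖ = 1), KHat1.mk c f = KHat1.mk c (OddMap.const (U1.phase c z hz)) := by
  obtain ⟨γ, hγ, h0, h1⟩ := U1.exists_path c (f.1 0)
  obtain ⟨δ, z, hz, hδ, hδ0, hδ1, hδt⟩ := exists_corrected_path c hγ h1
  refine ⟨z, hz, Quot.sound (Or.inl ?_)⟩
  rw [csHomotopic_chOdd_iff]
  refine ⟨fun p => δ p.2, isSmoothHomotopy_of_contDiff hδ, fun x => ?_, fun x => hδ1, fun x => ?_⟩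
  · rw [f.eq_const]
    exact hδ0.trans h0
  · refine intervalIntegral.integral_zero_ae (Filter.Eventually.of_forall fun t ht => ?_)
    rw [Set.uIoc_of_le zero_le_one] at ht
    have hd : derivWithin (fun t => (δ t).emb) (Set.Icc (0 : ℝ) 1) t =
        deriv (fun t => (δ t).emb) t :=
      ((hδ.differentiable (by simp) t).derivWithin
        (uniqueDiffOn_Icc zero_lt_one t ⟨ht.1.le, ht.2⟩))
    change logTrace c (δ t) (derivWithin (fun t => (δ t).emb) (Set.Icc (0 : ℝ) 1) t) = 0
    rw [hd, hδt]

/-- The Fredholm determinant on `K̂¹` of the point. -/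
def KHat1.det : KHat1 c Point Point → ℂ :=
  Quot.lift (fun f => (f.1 0).det c) (by
    rintro f g (h | rfl)
    · exact det_eq_of_csHomotopic c h
    · change _ = (U1.blockSum c (f.1 0) (U1.base H)).det c
      rw [U1.det_blockSum, U1.det_base, mul_one])

theorem KHat1.det_mk (f : OddMap H Point Point) :
    KHat1.det c (KHat1.mk c f) = (f.1 0).det c := rfl

theorem KHat1.norm_det (x : KHat1 c Point Point) : ‖KHat1.det c x‖ = 1 := by
  obtain ⟨f, rfl⟩ := Quot.exists_rep x
  obtain ⟨z, hz, h⟩ := KHat1.exists_phase c f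
  change ‖KHat1.det c (KHat1.mk c f)‖ = 1
  rw [h, KHat1.det_mk]
  exact (congrArg norm (U1.det_phase c z hz)).trans hz

/-- The Fredholm determinant identifies `K̂¹` of the point with the circle. -/
def KHat1.equivCircle : KHat1 c Point Point ≃ Circle :=
  Equiv.ofBijective (fun x => ⟨KHat1.det c x, mem_sphere_zero_iff_norm.2 (KHat1.norm_det c x)⟩)
    ⟨by
      intro x y h
      obtain ⟨f, rfl⟩ := Quot.exists_rep x
      obtain ⟨g, rfl⟩ := Quot.exists_rep y
      have h' : KHat1.det c (KHat1.mk c f) = KHat1.det c (KHat1.mk c g) := congrArg Subtype.val h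
      change KHat1.mk c f = KHat1.mk c g
      obtain ⟨z, hz, hf⟩ := KHat1.exists_phase c f
      obtain ⟨w, hw, hg⟩ := KHat1.exists_phase c g
      -- On normal forms `diag (z, 1, 1, …)` the determinant is `z`, so equal determinants force
      -- equal normal forms.
      rw [hf, hg] at h' ⊢
      have hzw : z = w := ((U1.det_phase c z hz).symm.trans h').trans (U1.det_phase c w hw)
      subst hzw
      rfl, by
      intro z
      exact ⟨KHat1.mk c (OddMap.const (U1.phase c z z.norm_coe)),
        Subtype.ext (U1.det_phase c z z.norm_coe)⟩⟩

/-- The Fredholm determinant identifies `K̂¹` of the point with `ℝ / ℤ`. -/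
def KHat1.equivAddCircle : KHat1 c Point Point ≃ AddCircle (1 : ℝ) :=
  (KHat1.equivCircle c).trans (AddCircle.homeomorphCircle (one_ne_zero (α := ℝ))).symm.toEquiv

theorem KHat1.toCircle_equivAddCircle (x : KHat1 c Point Point) :
    AddCircle.toCircle (KHat1.equivAddCircle c x) = KHat1.equivCircle c x := by
  have := (AddCircle.homeomorphCircle (one_ne_zero (α := ℝ))).apply_symm_apply
    (KHat1.equivCircle c x)
  rwa [AddCircle.homeomorphCircle_apply] at this

/-- Addition is transported from `ℝ / ℤ`; it agrees with the block sum because the determinant is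
multiplicative, which is checked after the injective map to the circle. -/
theorem exists_addCommGroup_KHat1_point :
    ∃ _ : AddCommGroup (KHat1 c Point Point),
      (∀ f g : OddMap H Point Point,
        KHat1.mk c f + KHat1.mk c g = KHat1.mk c (OddMap.blockSum c f g)) ∧
      ∃ D : KHat1 c Point Point ≃+ AddCircle (1 : ℝ), ∀ f : OddMap H Point Point,
        IsFredholmDet c (f.1 0).op ((AddCircle.toCircle (D (KHat1.mk c f)) : Circle) : ℂ) := by
  let _ : AddCommGroup (KHat1 c Point Point) := (KHat1.equivAddCircle c).addCommGroup
  refine ⟨inferInstance, fun f g => ?_, (KHat1.equivAddCircle c).addEquiv, fun f => ?_⟩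
  · apply (KHat1.equivAddCircle c).injective
    apply AddCircle.injective_toCircle one_ne_zero
    have h := (KHat1.equivAddCircle c).addEquiv.map_add (KHat1.mk c f) (KHat1.mk c g)
    change KHat1.equivAddCircle c _ = KHat1.equivAddCircle c _ + KHat1.equivAddCircle c _ at h
    rw [h, AddCircle.toCircle_add, KHat1.toCircle_equivAddCircle, KHat1.toCircle_equivAddCircle,
      KHat1.toCircle_equivAddCircle]
    apply Subtype.ext
    exact (U1.det_blockSum c (f.1 0) (g.1 0)).symm
  · change IsFredholmDet c (f.1 0).op (AddCircle.toCircle (KHat1.equivAddCircle c (KHat1.mk c f)))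
    rw [KHat1.toCircle_equivAddCircle]
    exact U1.isFredholmDet_det c (f.1 0)

end OddPoint

/-! ### The Hilbert–Schmidt norm and smooth products -/

section HilbertSchmidtSpace

variable {H : Type*} [NormedAddCommGroup H] [InnerProductSpace ℂ H] [CompleteSpace H]
variable {ι : Type*} {b : HilbertBasis ι ℂ H}

theorem HSOp.norm_eq_hsNorm (T : HSOp b) : ‖T‖ = hsNorm b (HSOp.op b T) := by
  have h2 : (0 : ℝ) < (2 : ℝ≥0∞).toReal := by simp
  rw [HSOp.norm_eq, lp.norm_eq_tsum_rpow h2, hsNorm, Real.sqrt_eq_rpow, hsSq,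
    ENNReal.tsum_toReal_eq (by simp)]
  simp only [ENNReal.toReal_ofNat, Real.rpow_ofNat, ENNReal.toReal_pow, toReal_enorm]
  rfl

/-- Expand `‖T x‖²` as the sum of the `|⟨T* b_i, x⟩|²`, apply Cauchy–Schwarz, and use that `T` and
`T*` have the same Hilbert–Schmidt norm. -/
theorem norm_apply_le_hsNorm {T : H →L[ℂ] H} (hT : IsHilbertSchmidt b T) (x : H) :
    ‖T x‖ ≤ hsNorm b T * ‖x‖ := by
  have h1 : ‖T x‖ₑ ^ 2 ≤ hsSq b T * ‖x‖ₑ ^ 2 := by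
    rw [← tsum_enorm_inner_sq b, ← hsSq_adjoint b b, hsSq, ← ENNReal.tsum_mul_right]
    refine ENNReal.tsum_le_tsum fun i => ?_
    rw [← ContinuousLinearMap.adjoint_inner_left, ← mul_pow]
    gcongr
    rw [← ofReal_norm, ← ofReal_norm, ← ofReal_norm, ← ENNReal.ofReal_mul (norm_nonneg _)]
    exact ENNReal.ofReal_le_ofReal (norm_inner_le_norm _ _)
  have hf := (isHilbertSchmidt_iff_hsSq b T).1 hT
  have h3 := ENNReal.toReal_mono (ENNReal.mul_ne_top hf (by simp)) h1
  rw [ENNReal.toReal_mul, ENNReal.toReal_pow, ENNReal.toReal_pow, toReal_enorm, toReal_enorm] at h3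
  refine le_of_sq_le_sq ?_ (by unfold hsNorm; positivity)
  rw [mul_pow, hsNorm, Real.sq_sqrt ENNReal.toReal_nonneg]
  exact h3

theorem hsNorm_mul_left_le {T : H →L[ℂ] H} (hT : IsHilbertSchmidt b T) (S : H →L[ℂ] H) :
    hsNorm b (S * T) ≤ ‖S‖ * hsNorm b T := by
  have h := ENNReal.toReal_mono (ENNReal.mul_ne_top (by simp)
    ((isHilbertSchmidt_iff_hsSq b T).1 hT)) (hsSq_comp_left b S T)
  rw [ENNReal.toReal_mul, ENNReal.toReal_pow, toReal_enorm] at h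
  rw [hsNorm, hsNorm, ← Real.sqrt_sq (norm_nonneg S), ← Real.sqrt_mul (sq_nonneg _)]
  exact Real.sqrt_le_sqrt h

theorem hsNorm_mul_right_le {T : H →L[ℂ] H} (hT : IsHilbertSchmidt b T) (S : H →L[ℂ] H) :
    hsNorm b (T * S) ≤ ‖S‖ * hsNorm b T := by
  have h := ENNReal.toReal_mono (ENNReal.mul_ne_top (by simp)
    ((isHilbertSchmidt_iff_hsSq b T).1 hT)) (hsSq_comp_right b b b T S)
  rw [ENNReal.toReal_mul, ENNReal.toReal_pow, toReal_enorm] at h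
  rw [hsNorm, hsNorm, ← Real.sqrt_sq (norm_nonneg S), ← Real.sqrt_mul (sq_nonneg _)]
  exact Real.sqrt_le_sqrt h

/-- A Hilbert-Schmidt operator as an element of `L²`. -/
def HSOp.mk (T : H →L[ℂ] H) (hT : IsHilbertSchmidt b T) : HSOp b := ⟨T, hT⟩

theorem HSOp.op_injective : Function.Injective (HSOp.op b) := Subtype.val_injective

theorem HSOp.norm_op_le (T : HSOp b) : ‖HSOp.op b T‖ ≤ ‖T‖ := by
  refine ContinuousLinearMap.opNorm_le_bound _ (norm_nonneg _) fun x => ?_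
  rw [HSOp.norm_eq_hsNorm]
  exact norm_apply_le_hsNorm T.2 x

variable (b) in
/-- The product `(B, T) ↦ B T` of a bounded and a Hilbert-Schmidt operator. -/
def HSOp.mulL : (H →L[ℂ] H) →L[ℂ] HSOp b →L[ℂ] HSOp b :=
  LinearMap.mkContinuous₂
    (LinearMap.mk₂ ℂ (fun B T => HSOp.mk (B * HSOp.op b T) (IsHilbertSchmidt.mul_left T.2 B))
      (fun B B' T => Subtype.ext (add_mul B B' _))
      (fun c B T => Subtype.ext (smul_mul_assoc c B _))
      (fun B T T' => Subtype.ext (mul_add B _ _))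
      (fun c B T => Subtype.ext (mul_smul_comm c B _))) 1
    (fun B T => by
      rw [one_mul, HSOp.norm_eq_hsNorm, HSOp.norm_eq_hsNorm]
      exact hsNorm_mul_left_le T.2 B)

variable (b) in
/-- The product `(B, T) ↦ T B` of a bounded and a Hilbert-Schmidt operator. -/
def HSOp.mulR : (H →L[ℂ] H) →L[ℂ] HSOp b →L[ℂ] HSOp b :=
  LinearMap.mkContinuous₂
    (LinearMap.mk₂ ℂ (fun B T => HSOp.mk (HSOp.op b T * B) (IsHilbertSchmidt.mul_right T.2 B))
      (fun B B' T => Subtype.ext (mul_add _ B B'))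
      (fun c B T => Subtype.ext (mul_smul_comm c _ B))
      (fun B T T' => Subtype.ext (add_mul _ _ B))
      (fun c B T => Subtype.ext (smul_mul_assoc c _ B))) 1
    (fun B T => by
      rw [one_mul, HSOp.norm_eq_hsNorm, HSOp.norm_eq_hsNorm]
      exact hsNorm_mul_right_le T.2 B)

theorem HSOp.op_mulL (B : H →L[ℂ] H) (T : HSOp b) :
    HSOp.op b (HSOp.mulL b B T) = B * HSOp.op b T := rfl

theorem HSOp.op_mulR (B : H →L[ℂ] H) (T : HSOp b) :
    HSOp.op b (HSOp.mulR b B T) = HSOp.op b T * B := rfl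

theorem contDiff_hsMulL {f : ℝ → H →L[ℂ] H} (hf : ContDiff ℝ ∞ f) (T : HSOp b) :
    ContDiff ℝ ∞ fun t => HSOp.mulL b (f t) T :=
  ((HSOp.mulL b).bilinearRestrictScalars ℝ).isBoundedBilinearMap.contDiff.comp
    (hf.prodMk contDiff_const)

theorem contDiff_hsMulR {f : ℝ → H →L[ℂ] H} (hf : ContDiff ℝ ∞ f) (T : HSOp b) :
    ContDiff ℝ ∞ fun t => HSOp.mulR b (f t) T :=
  ((HSOp.mulR b).bilinearRestrictScalars ℝ).isBoundedBilinearMap.contDiff.comp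
    (hf.prodMk contDiff_const)

/-- A Hilbert-Schmidt operator is small on the orthogonal complement of finitely many vectors of the
basis. -/
theorem IsHilbertSchmidt.exists_finset_norm_le {T : H →L[ℂ] H} (hT : IsHilbertSchmidt b T) {ε : ℝ}
    (hε : 0 < ε) : ∃ s : Finset ι, ∀ x, (∀ i ∈ s, inner ℂ (b i) x = 0) → ‖T x‖ ≤ ε * ‖x‖ := by
  obtain ⟨s, hs⟩ := ((tendsto_order.1 (tendsto_hsNorm_tail b hT)).2 ε hε).exists
  refine ⟨s, fun x hx => ?_⟩
  have h0 : coordProj b s x = 0 := by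
    rw [coordProj_apply]
    exact Finset.sum_eq_zero fun i hi => by rw [hx i hi, zero_smul]
  have h1 : T x = (T * (1 - coordProj b s)) x := by
    rw [mul_apply_eq_comp, sub_apply, one_apply_eq_self, h0, sub_zero]
  rw [h1]
  refine (norm_apply_le_hsNorm (hT.mul_right _) x).trans ?_
  gcongr

end HilbertSchmidtSpace

/-! ### Half spaces, and projections close to `π₊` as points of the Grassmannian -/

section HalfSpaces

variable {H : Type*} [NormedAddCommGroup H] [InnerProductSpace ℂ H] [CompleteSpace H]
variable (b : HilbertBasis ℤ ℂ H)

/-- The closed span of the basis vectors `e_i` with `N ≤ i`. -/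
def halfSpace (N : ℤ) : Submodule ℂ H where
  carrier := {x | ∀ i < N, inner ℂ (b i) x = 0}
  add_mem' hx hy i hi := by rw [inner_add_right, hx i hi, hy i hi, add_zero]
  zero_mem' i _ := inner_zero_right _
  smul_mem' c x hx i hi := by rw [inner_smul_right, hx i hi, mul_zero]

theorem isClosed_halfSpace (N : ℤ) : IsClosed (halfSpace b N : Set H) := by
  change IsClosed {x : H | ∀ i < N, inner ℂ (b i) x = 0}
  simp only [Set.ofPred_forall]
  exact isClosed_iInter fun i => isClosed_iInter fun _ =>
    isClosed_eq (continuous_const.inner continuous_id) continuous_const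

/-- The orthogonal projection onto the half space. -/
def halfProj (N : ℤ) : H →L[ℂ] H := orthProj (halfSpace b N) (isClosed_halfSpace b N)

variable {b}

theorem basis_mem_halfSpace {N i : ℤ} (h : N ≤ i) : b i ∈ halfSpace b N := by
  intro j hj
  exact b.orthonormal.2 (by omega)

theorem inner_halfProj (N i : ℤ) (x : H) :
    inner ℂ (b i) (halfProj b N x) = if N ≤ i then inner ℂ (b i) x else 0 := by
  split_ifs with h
  · rw [halfProj, ← orthProj_inner, orthProj_eq_self _ _ (basis_mem_halfSpace h)]
  · exact orthProj_mem (halfSpace b N) (isClosed_halfSpace b N) x i (not_le.1 h)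

theorem halfProj_basis (N i : ℤ) : halfProj b N (b i) = if N ≤ i then b i else 0 := by
  apply ext_basis b
  intro j
  rw [inner_halfProj]
  by_cases hij : j = i
  · subst hij
    split_ifs <;> simp
  · have h0 : inner ℂ (b j) (b i) = 0 := b.orthonormal.2 hij
    split_ifs <;> simp [h0]

theorem halfProj_zero : halfProj b 0 = piPlus b := by
  apply op_ext b
  intro i
  rw [halfProj_basis]
  split_ifs with h
  · rw [piPlus_basis_of_nonneg b h]
  · rw [piPlus_basis_of_neg b h]

theorem halfProj_mul_of_le {N M : ℤ} (h : N ≤ M) : halfProj b N * halfProj b M = halfProj b M := by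
  apply op_ext b
  intro i
  rw [mul_apply_eq_comp, halfProj_basis]
  by_cases h1 : M ≤ i
  · rw [if_pos h1, halfProj_basis, if_pos (h.trans h1)]
  · rw [if_neg h1, map_zero]

theorem halfProj_mul_of_le' {N M : ℤ} (h : N ≤ M) : halfProj b M * halfProj b N = halfProj b M := by
  apply op_ext b
  intro i
  rw [mul_apply_eq_comp, halfProj_basis]
  by_cases h1 : N ≤ i
  · rw [if_pos h1]
  · rw [if_neg h1, map_zero, halfProj_basis, if_neg (by omega)]

theorem halfProj_isSelfAdjoint (N : ℤ) : IsSelfAdjoint (halfProj b N) := orthProj_isSelfAdjoint _ _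

theorem halfProj_mul_self (N : ℤ) : halfProj b N * halfProj b N = halfProj b N :=
  orthProj_mul_self _ _

theorem piPlus_sub_halfProj {N : ℤ} (h : 0 ≤ N) :
    piPlus b - halfProj b N = coordProj b (Finset.Ico 0 N) := by
  apply op_ext b
  intro i
  rw [← halfProj_zero, sub_apply, halfProj_basis, halfProj_basis, coordProj_basis]
  simp only [Finset.mem_Ico]
  split_ifs <;> first | omega | simp

theorem isHilbertSchmidt_halfProj_sub (N : ℤ) : IsHilbertSchmidt b (halfProj b N - piPlus b) := by
  rw [isHilbertSchmidt_iff]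
  refine summable_of_ne_finset_zero (s := Finset.Icc (-|N|) |N|) fun i hi => ?_
  rw [Finset.mem_Icc, not_and_or] at hi
  have := neg_abs_le N
  have := le_abs_self N
  have := abs_nonneg N
  rw [← halfProj_zero, sub_apply, halfProj_basis, halfProj_basis]
  split_ifs <;> first | omega | simp

section Projections

variable {E : H →L[ℂ] H}

/-- On a half space `p` far enough out, `T = E - π₊` has norm at most one half, so `p E p = p + p T
p` is invertible there by a Neumann series. -/
theorem exists_forall_exists_halfProj_eq (hHS : IsHilbertSchmidt b (E - piPlus b))
    (hE : E * E = E) :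
    ∃ N₀ : ℤ, 0 ≤ N₀ ∧ ∀ N, N₀ ≤ N → ∀ y ∈ halfSpace b N, ∃ w, E w = w ∧ halfProj b N w = y := by
  obtain ⟨s, hs⟩ := hHS.exists_finset_norm_le (one_half_pos (α := ℝ))
  obtain ⟨m, hm⟩ := s.bddAbove
  -- `m + 1` moves the half space past all indices in `s`, where `T` is small; the bound by `0` puts
  -- it inside `H₊`.
  refine ⟨max 0 (m + 1), le_max_left _ _, fun N hN y hy => ?_⟩
  have hN0 : 0 ≤ N := (le_max_left _ _).trans hN
  have hNm : m + 1 ≤ N := (le_max_right _ _).trans hN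
  set p := halfProj b N with hp
  set T := E - piPlus b with hT
  have hTp : ∀ x, ‖T (p x)‖ ≤ 1 / 2 * ‖x‖ := by
    intro x
    have h1 : ‖p x‖ ≤ ‖x‖ := norm_orthProj_le _ _ x
    refine (hs (p x) fun i hi => ?_).trans (by gcongr)
    rw [hp, inner_halfProj, if_neg]
    have : i ≤ m := hm hi
    omega
  have hn : ‖-(p * T * p)‖ < 1 := by
    rw [norm_neg]
    refine lt_of_le_of_lt (ContinuousLinearMap.opNorm_le_bound _ (by norm_num : (0 : ℝ) ≤ 1 / 2)
      fun x => ?_) (by norm_num : (1 / 2 : ℝ) < 1)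
    exact (norm_orthProj_le _ (isClosed_halfSpace b N) _).trans (hTp x)
  obtain ⟨u, hu⟩ := isUnit_one_sub_of_norm_lt_one hn
  rw [sub_neg_eq_add] at hu
  -- `z` solves `z + p T p z = y`. It lies in the half space, so `π₊ z = z` and `p E z = y`; the
  -- required vector is `E z`.
  set z := (↑u⁻¹ : H →L[ℂ] H) y with hz
  have hz1 : z + p (T (p z)) = y := by
    have h1 : (u : H →L[ℂ] H) z = y := by
      rw [hz, ← mul_apply_eq_comp, Units.mul_inv, one_apply_eq_self]
    rw [hu] at h1
    exact h1
  have hy' : p y = y := orthProj_eq_self _ _ hy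
  have hpp : ∀ x, p (p x) = p x := fun x =>
    congrArg (fun S : H →L[ℂ] H => S x) (halfProj_mul_self (b := b) N)
  have hz2 : p z = z := by
    have h2 : z = y - p (T (p z)) := eq_sub_of_add_eq hz1
    rw [h2, map_sub, hpp, hy']
  have hz3 : piPlus b z = z := by
    have h3 := congrArg (fun S : H →L[ℂ] H => S z) (halfProj_mul_of_le (b := b) hN0)
    rw [halfProj_zero] at h3
    change piPlus b (p z) = p z at h3
    rwa [hz2] at h3
  refine ⟨E z, congrArg (fun S : H →L[ℂ] H => S z) hE, ?_⟩
  have h4 : E z = T z + z := by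
    rw [hT, sub_apply, hz3, sub_add_cancel]
  rw [h4, map_add, hz2, add_comm]
  rwa [hz2] at hz1

/-- Finitely many coordinates separate the points of `K`: those in `[0, N)` force `π₊ x = 0`, and
those in `s` then give `‖x‖ = ‖(E - π₊) x‖ ≤ ‖x‖ / 2`. -/
theorem finiteDimensional_of_halfProj_eq_zero (hHS : IsHilbertSchmidt b (E - piPlus b))
    (K : Submodule ℂ H) (N : ℤ) (h1 : ∀ x ∈ K, E x = x) (h2 : ∀ x ∈ K, halfProj b N x = 0) :
    FiniteDimensional ℂ K := by
  obtain ⟨s, hs⟩ := hHS.exists_finset_norm_le (one_half_pos (α := ℝ))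
  let f : K →ₗ[ℂ] ((s ∪ Finset.Ico 0 N : Finset ℤ) → ℂ) :=
    LinearMap.pi fun i => (innerSL ℂ (b i)).toLinearMap.comp K.subtype
  refine Module.Finite.of_injective f ?_
  rw [injective_iff_map_eq_zero]
  rintro ⟨x, hx⟩ hfx
  have h3 : ∀ i ∈ s ∪ Finset.Ico 0 N, inner ℂ (b i) x = 0 := fun i hi => congrFun hfx ⟨i, hi⟩
  have h4 : piPlus b x = 0 := by
    apply ext_basis b
    intro i
    rw [← halfProj_zero, inner_halfProj, inner_zero_right]
    split_ifs with hi
    · by_cases hN : N ≤ i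
      · have h5 := congrArg (inner ℂ (b i)) (h2 x hx)
        rwa [inner_halfProj, if_pos hN, inner_zero_right] at h5
      · exact h3 i (Finset.mem_union_right _ (Finset.mem_Ico.2 ⟨hi, not_le.1 hN⟩))
    · rfl
  have h5 := hs x fun i hi => h3 i (Finset.mem_union_left _ hi)
  rw [sub_apply, h1 x hx, h4, sub_zero] at h5
  have h6 : ‖x‖ = 0 := by
    have := norm_nonneg x
    linarith
  exact Subtype.ext (norm_eq_zero.1 h6)

/-- The fixed vectors of an operator. -/
def fixedSpace (E : H →L[ℂ] H) : Submodule ℂ H := LinearMap.ker (1 - E).toLinearMap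

theorem mem_fixedSpace {x : H} : x ∈ fixedSpace E ↔ E x = x := by
  change x - E x = 0 ↔ _
  rw [sub_eq_zero, eq_comm]

theorem isClosed_fixedSpace : IsClosed (fixedSpace E : Set H) := (1 - E).isClosed_ker

theorem orthProj_fixedSpace (hsa : IsSelfAdjoint E) (hE : E * E = E) :
    orthProj (fixedSpace E) isClosed_fixedSpace = E := by
  ext x
  apply orthProj_unique
  · rw [mem_fixedSpace, ← mul_apply_eq_comp, hE]
  · intro w hw
    rw [mem_fixedSpace] at hw
    have h1 : inner ℂ (E x) w = inner ℂ x (E w) := by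
      rw [← ContinuousLinearMap.adjoint_inner_left, ← ContinuousLinearMap.star_eq_adjoint,
        hsa.star_eq]
    rw [inner_sub_left, h1, hw, sub_self]

/-- The kernel is handled by the preceding bound with `N = 0`. The range covers a far half space up
to the span of `e_0, …, e_{N-1}`, which therefore surjects onto the cokernel. This is the converse
of `isHilbertSchmidt_sub`, by which points and paths can be given by projections. -/
theorem isFredholm_fixedSpace (hE : E * E = E) (hHS : IsHilbertSchmidt b (E - piPlus b)) :
    IsFredholm (plusMap b (fixedSpace E)) := by
  constructor
  · have := finiteDimensional_of_halfProj_eq_zero hHS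
      ((LinearMap.ker (plusMap b (fixedSpace E))).map (fixedSpace E).subtype) 0
      (by
        rintro _ ⟨x, hx, rfl⟩
        exact mem_fixedSpace.1 x.2)
      (by
        rintro _ ⟨x, hx, rfl⟩
        rw [halfProj_zero]
        exact congrArg Subtype.val (LinearMap.mem_ker.1 hx))
    exact Module.Finite.of_injective
      ((Submodule.equivMapOfInjective (fixedSpace E).subtype (Submodule.injective_subtype _)
        (LinearMap.ker (plusMap b (fixedSpace E)))).toLinearMap) (LinearEquiv.injective _)
  · obtain ⟨N, hN0, hN⟩ := exists_forall_exists_halfProj_eq hHS hE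
    let G : Submodule ℂ H := Submodule.span ℂ (b '' (Finset.Ico 0 N : Finset ℤ))
    have hG : FiniteDimensional ℂ G :=
      FiniteDimensional.span_of_finite ℂ ((Finset.finite_toSet _).image _)
    have hcp : ∀ x, coordProj b (Finset.Ico 0 N) x ∈ G := by
      intro x
      rw [coordProj_apply]
      exact Submodule.sum_mem _ fun i hi =>
        Submodule.smul_mem _ _ (Submodule.subset_span ⟨i, hi, rfl⟩)
    let F : Submodule ℂ (Hplus b) := G.comap (Hplus b).subtype
    have hF : FiniteDimensional ℂ F :=
      Module.Finite.of_injective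
        ((((Hplus b).subtype.comp F.subtype).codRestrict G fun x => x.2))
        (by
          intro x y h
          exact Subtype.ext (Subtype.ext (congrArg (fun z : G => (z : H)) h)))
    refine Module.Finite.of_surjective
      ((LinearMap.range (plusMap b (fixedSpace E))).mkQ.comp F.subtype) ?_
    intro q
    obtain ⟨y, rfl⟩ := Submodule.mkQ_surjective _ q
    obtain ⟨w, hw, hwy⟩ := hN N le_rfl (halfProj b N y) (orthProj_mem _ _ _)
    have h1 : (y : H) - piPlus b w ∈ G := by
      have hy : piPlus b y = y := orthProj_eq_self _ _ y.2
      have h2 : (y : H) - piPlus b w =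
          coordProj b (Finset.Ico 0 N) y - coordProj b (Finset.Ico 0 N) w := by
        rw [← piPlus_sub_halfProj hN0, sub_apply, sub_apply, hwy, hy]
        abel
      rw [h2]
      exact G.sub_mem (hcp _) (hcp _)
    refine ⟨⟨y - plusMap b (fixedSpace E) ⟨w, mem_fixedSpace.2 hw⟩, h1⟩, ?_⟩
    rw [LinearMap.comp_apply, Submodule.subtype_apply, map_sub, sub_eq_self, Submodule.mkQ_apply,
      Submodule.Quotient.mk_eq_zero]
    exact ⟨_, rfl⟩

/-- The point of the restricted Grassmannian given by an orthogonal projection. -/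
def GrRes.ofProj (hsa : IsSelfAdjoint E) (hE : E * E = E)
    (hHS : IsHilbertSchmidt b (E - piPlus b)) : GrRes b where
  carrier := fixedSpace E
  closed := isClosed_fixedSpace
  fredholm := isFredholm_fixedSpace hE hHS
  hilbertSchmidt := by
    rw [orthProj_fixedSpace hsa hE]
    have h : piMinus b * E = (E - piPlus b) * E := by
      rw [piMinus, sub_mul, sub_mul, one_mul, hE]
    rw [h]
    exact hHS.mul_right E

theorem GrRes.proj_ofProj (hsa : IsSelfAdjoint E) (hE : E * E = E)
    (hHS : IsHilbertSchmidt b (E - piPlus b)) : (GrRes.ofProj hsa hE hHS).proj = E := orthProj_fixedSpace hsa hE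

end Projections

namespace GrRes

variable (W : GrRes b)

theorem proj_isSelfAdjoint : IsSelfAdjoint W.proj := orthProj_isSelfAdjoint _ _

theorem proj_mul_self : W.proj * W.proj = W.proj := orthProj_mul_self _ _

theorem op_emb : HSOp.op b W.emb = W.proj - piPlus b := rfl

theorem isHilbertSchmidt_proj_sub : IsHilbertSchmidt b (W.proj - piPlus b) := W.emb.2

variable {W}

theorem mem_iff {x : H} : x ∈ W.carrier ↔ W.proj x = x := by
  refine ⟨fun h => orthProj_eq_self _ _ h, fun h => ?_⟩
  rw [← h]
  exact orthProj_mem _ _ _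

theorem ext_proj {V W : GrRes b} (h : V.proj = W.proj) : V = W := by
  have hc : V.carrier = W.carrier := by
    ext x
    rw [mem_iff, mem_iff, h]
  cases V
  cases W
  cases hc
  rfl

end GrRes

end HalfSpaces

/-! ### Algebra of the projection onto a graph -/

section GraphProjection

variable {A : Type*} [Ring A] [StarRing A] {p y r : A}

/-- Here `y` maps the range of `p` to its complement, and `p + y` parametrizes its graph. This Gram
operator must be inverted to obtain the orthogonal projection `(p + y) (1 + y* y)⁻¹ (p + y*)` onto
the graph. -/
theorem star_graph_mul_graph (hp : star p = p) (hpp : p * p = p) (hyp : y * p = y)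
    (hpy : p * y = 0) : (p + star y) * (p + y) = (1 + star y * y) * p := by
  have h1 : star y * p = 0 := by
    rw [← hp, ← star_mul, hpy, star_zero]
  rw [add_mul, mul_add, mul_add, hpp, hpy, h1, add_mul, mul_assoc (star y) y p, hyp, one_mul]
  abel

theorem graph_proj_mul_self (hp : star p = p) (hpp : p * p = p) (hyp : y * p = y)
    (hpy : p * y = 0) (hr : r * (1 + star y * y) = 1) :
    (p + y) * r * (p + star y) * ((p + y) * r * (p + star y)) = (p + y) * r * (p + star y) := by
  have h1 : (p + y) * r * (p + star y) * ((p + y) * r * (p + star y)) =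
      (p + y) * (r * ((p + star y) * (p + y))) * (r * (p + star y)) := by noncomm_ring
  have h2 : (p + y) * p = p + y := by rw [add_mul, hpp, hyp]
  rw [h1, star_graph_mul_graph hp hpp hyp hpy, ← mul_assoc r, hr, one_mul, h2, mul_assoc]

/-- Each term on the right contains `y` or `y*` as a factor, so the difference is Hilbert–Schmidt as
soon as `y` is. -/
theorem graph_proj_sub (hyp : y * p = y) (hpp : p * p = p) (hr : r * (1 + star y * y) = 1) :
    (p + y) * r * (p + star y) - p =
      y * r * p + p * r * star y + y * r * star y - p * r * star y * y := by
  have h1 : r = 1 - r * (star y * y) := by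
    rw [mul_add, mul_one] at hr
    exact eq_sub_of_add_eq hr
  have h2 : p * r * p = p - p * r * star y * y := by
    calc p * r * p = p * (1 - r * (star y * y)) * p := by rw [← h1]
      _ = p * p - p * r * star y * (y * p) := by noncomm_ring
      _ = _ := by rw [hpp, hyp]
  have h3 : (p + y) * r * (p + star y) =
      p * r * p + (y * r * p + p * r * star y + y * r * star y) := by noncomm_ring
  rw [h3, h2]
  abel

/-- An orthogonal projection is determined by its range: `h1` says that the graph lies in the range
of `q`, and `h2` gives the reverse inclusion. -/
theorem graph_proj_eq {q : A} (hp : star p = p) (hpp : p * p = p) (hyp : y * p = y)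
    (hpy : p * y = 0) (hr : r * (1 + star y * y) = 1) (hrs : star r = r) (hq : star q = q)
    (h1 : q * (p + y) = p + y) (h2 : (p + y) * p * q = q) :
    (p + y) * r * (p + star y) = q := by
  set e := (p + y) * r * (p + star y) with he
  have h3 : (p + y) * p = p + y := by rw [add_mul, hpp, hyp]
  have h4 : e * (p + y) = p + y := by
    calc e * (p + y) = (p + y) * (r * ((p + star y) * (p + y))) := by rw [he]; noncomm_ring
      _ = (p + y) * p := by
        rw [star_graph_mul_graph hp hpp hyp hpy, ← mul_assoc r, hr, one_mul]
      _ = p + y := h3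
  have h5 : e * q = q := by
    rw [h3] at h2
    calc e * q = e * ((p + y) * q) := by rw [h2]
      _ = (p + y) * q := by rw [← mul_assoc, h4]
      _ = q := h2
  have h6 : q * e = e := by
    rw [he, ← mul_assoc, ← mul_assoc, h1]
  have h7 : star e = e := by
    rw [he, star_mul, star_mul, star_add, star_add, star_star, hrs, hp, mul_assoc]
  calc e = star (q * e) := by rw [h6, h7]
    _ = e * q := by rw [star_mul, h7, hq]
    _ = q := h5

theorem star_graph_proj (hp : star p = p) (hrs : star r = r) :
    star ((p + y) * r * (p + star y)) = (p + y) * r * (p + star y) := by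
  rw [star_mul, star_mul, star_add, star_add, star_star, hrs, hp, mul_assoc]

end GraphProjection

/-! ### Openness of the graph condition and paths of graphs -/

section Graphs

variable {H : Type*} [NormedAddCommGroup H] [InnerProductSpace ℂ H] [CompleteSpace H]
variable {b : HilbertBasis ℤ ℂ H}

/-- The orthogonal projection onto `V` restricts to an isomorphism `W → V`, with inverse `θ`. -/
def GrRes.IsGraphOver (W V : GrRes b) : Prop :=
  ∃ θ : H →L[ℂ] H, W.proj * θ = θ ∧ V.proj * θ = V.proj ∧ θ * V.proj = θ ∧ θ * W.proj = W.proj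

/-- The inverse of the bijection `W → V` is bounded by the open mapping theorem; `θ` is this inverse
precomposed with the projection onto `V`. -/
theorem GrRes.isGraphOver_of_bijective {W V : GrRes b}
    (hinj : ∀ w ∈ W.carrier, V.proj w = 0 → w = 0)
    (hsurj : ∀ y ∈ V.carrier, ∃ w ∈ W.carrier, V.proj w = y) : W.IsGraphOver V := by
  have : CompleteSpace W.carrier := W.closed.completeSpace_coe
  have : CompleteSpace V.carrier := V.closed.completeSpace_coe
  let q : H →L[ℂ] V.carrier := V.proj.codRestrict V.carrier (orthProj_mem _ _)
  let f : W.carrier →L[ℂ] V.carrier := q ∘L W.carrier.subtypeL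
  have hker : LinearMap.ker f.toLinearMap = ⊥ := by
    rw [LinearMap.ker_eq_bot']
    intro w hw
    exact Subtype.ext (hinj w w.2 (congrArg (fun z : V.carrier => (z : H)) hw))
  have hrange : LinearMap.range f.toLinearMap = ⊤ := by
    rw [LinearMap.range_eq_top]
    intro y
    obtain ⟨w, hw, hwy⟩ := hsurj y y.2
    exact ⟨⟨w, hw⟩, Subtype.ext hwy⟩
  let e := ContinuousLinearEquiv.ofBijective f hker hrange
  have hfe : ∀ y, f (e.symm y) = y := fun y =>
    ContinuousLinearEquiv.ofBijective_apply_symm_apply f hker hrange y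
  have hef : ∀ w, e.symm (f w) = w := fun w =>
    ContinuousLinearEquiv.ofBijective_symm_apply_apply f hker hrange w
  refine ⟨W.carrier.subtypeL ∘L (e.symm : V.carrier →L[ℂ] W.carrier) ∘L q, ?_, ?_, ?_, ?_⟩
  · ext x
    exact orthProj_eq_self _ W.closed (e.symm (q x)).2
  · ext x
    exact congrArg (fun z : V.carrier => (z : H)) (hfe (q x))
  · ext x
    have h1 : q (V.proj x) = q x :=
      Subtype.ext (congrArg (fun S : H →L[ℂ] H => S x) V.proj_mul_self)
    change ((e.symm (q (V.proj x)) : W.carrier) : H) = ((e.symm (q x) : W.carrier) : H)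
    rw [h1]
  · ext x
    exact congrArg (fun z : W.carrier => (z : H)) (hef ⟨W.proj x, orthProj_mem _ _ _⟩)

theorem GrRes.norm_proj_le (W : GrRes b) : ‖W.proj‖ ≤ 1 :=
  norm_le_one_of_projection W.proj_isSelfAdjoint W.proj_mul_self

/-- Invertibility is an open condition: a perturbation of the projection by less than `(1 + ‖θ‖)⁻¹`
preserves it. -/
theorem GrRes.IsGraphOver.eventually {W V : GrRes b} (h : W.IsGraphOver V) :
    ∀ᶠ W' in nhds W, GrRes.IsGraphOver W' V := by
  obtain ⟨θ, h1, h2, h3, h4⟩ := h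
  have hε : 0 < (1 + ‖θ‖)⁻¹ := by positivity
  have hc : Continuous (GrRes.emb (b := b)) := continuous_induced_dom
  filter_upwards [(hc.tendsto W).eventually (Metric.ball_mem_nhds _ hε)] with W' hW'
  have hd : ‖W'.proj - W.proj‖ < (1 + ‖θ‖)⁻¹ := by
    rw [dist_eq_norm] at hW'
    refine lt_of_le_of_lt ?_ hW'
    have := HSOp.norm_op_le (W'.emb - W.emb)
    rwa [map_sub, GrRes.op_emb, GrRes.op_emb, sub_sub_sub_cancel_right] at this
  have hd' : ‖W'.proj - W.proj‖ * (1 + ‖θ‖) < 1 := by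
    rwa [← lt_div_iff₀ (by positivity), one_div]
  apply GrRes.isGraphOver_of_bijective
  · intro w hw hw0
    have e1 : W'.proj w = w := GrRes.mem_iff.1 hw
    have e2 : W.proj w = θ (W.proj w) :=
      (congrArg (fun S : H →L[ℂ] H => S w) h4).symm
    have e3 : θ w = 0 := by
      rw [← h3, mul_apply_eq_comp, hw0, map_zero]
    -- A vector `w` killed by `V` satisfies `θ w = 0`, so it equals a small operator applied to
    -- itself.
    have e4 : w = (W'.proj - W.proj) w - θ ((W'.proj - W.proj) w) := by
      rw [sub_apply, e1, map_sub, e3, zero_sub, ← e2]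
      abel
    have e5 : ‖w‖ ≤ ‖W'.proj - W.proj‖ * (1 + ‖θ‖) * ‖w‖ := by
      calc ‖w‖ = ‖(W'.proj - W.proj) w - θ ((W'.proj - W.proj) w)‖ := by rw [← e4]
        _ ≤ ‖(W'.proj - W.proj) w‖ + ‖θ‖ * ‖(W'.proj - W.proj) w‖ :=
          (norm_sub_le _ _).trans (add_le_add_right (θ.le_opNorm _) _)
        _ = (1 + ‖θ‖) * ‖(W'.proj - W.proj) w‖ := by ring
        _ ≤ (1 + ‖θ‖) * (‖W'.proj - W.proj‖ * ‖w‖) := by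
          gcongr
          exact ContinuousLinearMap.le_opNorm _ _
        _ = _ := by ring
    by_contra hne
    have : 0 < ‖w‖ := norm_pos_iff.2 hne
    nlinarith
  · have hn : ‖-(V.proj * (W'.proj - W.proj) * θ)‖ < 1 := by
      rw [norm_neg]
      calc ‖V.proj * (W'.proj - W.proj) * θ‖ ≤ ‖V.proj‖ * ‖W'.proj - W.proj‖ * ‖θ‖ :=
            (norm_mul_le _ _).trans (mul_le_mul_of_nonneg_right (norm_mul_le _ _) (norm_nonneg _))
        _ ≤ 1 * ‖W'.proj - W.proj‖ * (1 + ‖θ‖) := by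
          gcongr
          · exact V.norm_proj_le
          · linarith
        _ < 1 := by rwa [one_mul]
    obtain ⟨u, hu⟩ := isUnit_one_sub_of_norm_lt_one hn
    rw [sub_neg_eq_add] at hu
    intro y hy
    -- Up to the invertible factor `u`, the map `θ` is still a right inverse of the projection to
    -- `V`, which yields surjectivity.
    have e1 : V.proj * W'.proj * θ = V.proj * u := by
      rw [hu, mul_add, mul_one, ← mul_assoc, ← mul_assoc, V.proj_mul_self, mul_sub, sub_mul,
        mul_assoc V.proj W.proj, h1, h2]
      abel
    have e2 : V.proj (W'.proj (θ ((↑u⁻¹ : H →L[ℂ] H) y))) = V.proj y := by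
      have := congrArg (fun S : H →L[ℂ] H => (S * (↑u⁻¹ : H →L[ℂ] H)) y) e1
      simp only [mul_assoc, Units.mul_inv, mul_one] at this
      exact this
    exact ⟨_, orthProj_mem _ _ _, e2.trans (GrRes.mem_iff.1 hy)⟩

/-- A smooth path of points of the restricted Grassmannian. -/
def GrRes.Connected (V W : GrRes b) : Prop :=
  ∃ γ : ℝ → GrRes b, ContDiff ℝ ∞ (GrRes.emb ∘ γ) ∧ γ 0 = V ∧ γ 1 = W

/-- `W` is the graph of `X = θ - p` from `V` to its complement; the graphs of `t X` run from `V` to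
`W`. -/
theorem GrRes.IsGraphOver.connected {W V : GrRes b} (h : W.IsGraphOver V) : V.Connected W := by
  obtain ⟨θ, h1, h2, h3, h4⟩ := h
  set p := V.proj with hp
  have hpp : p * p = p := V.proj_mul_self
  have hps : star p = p := V.proj_isSelfAdjoint.star_eq
  set X := θ - p with hX
  have hXp : X * p = X := by rw [hX, sub_mul, h3, hpp]
  have hpX : p * X = 0 := by rw [hX, mul_sub, h2, hpp, sub_self]
  -- `X = (π_W - π_V) θ`, and the difference of the projections is Hilbert–Schmidt.
  have hXhs : IsHilbertSchmidt b X := by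
    have e1 : X = (HSOp.op b (W.emb - V.emb)) * θ := by
      rw [map_sub, GrRes.op_emb, GrRes.op_emb, sub_sub_sub_cancel_right, sub_mul, h1, ← hp, h2]
    rw [e1]
    exact IsHilbertSchmidt.mul_right (W.emb - V.emb).2 θ
  let Y : ℝ → H →L[ℂ] H := fun t => (t : ℂ) • X
  have hYs : ∀ t, star (Y t) = (t : ℂ) • star X := by
    intro t
    rw [star_smul]
    congr 1
    exact Complex.conj_ofReal t
  let R : ℝ → H →L[ℂ] H := fun t => Ring.inverse (1 + star (Y t) * Y t)
  have hR : ∀ t, R t * (1 + star (Y t) * Y t) = 1 := fun t =>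
    Ring.inverse_mul_cancel _ (isUnit_one_add_star_mul_self _)
  have hR' : ∀ t, (1 + star (Y t) * Y t) * R t = 1 := fun t =>
    Ring.mul_inverse_cancel _ (isUnit_one_add_star_mul_self _)
  have hRs : ∀ t, star (R t) = R t := by
    intro t
    have e1 : star (1 + star (Y t) * Y t) = 1 + star (Y t) * Y t := by
      rw [star_add, star_one, star_mul, star_star]
    have e2 := congrArg star (hR t)
    rw [star_mul, e1, star_one] at e2
    exact (left_inv_eq_right_inv (hR t) e2).symm
  have hYp : ∀ t, Y t * p = Y t := fun t => by
    change ((t : ℂ) • X) * p = (t : ℂ) • X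
    rw [smul_mul_assoc, hXp]
  have hpY : ∀ t, p * Y t = 0 := fun t => by
    change p * ((t : ℂ) • X) = 0
    rw [mul_smul_comm, hpX, smul_zero]
  let E : ℝ → H →L[ℂ] H := fun t => (p + Y t) * R t * (p + star (Y t))
  have hEs : ∀ t, IsSelfAdjoint (E t) := fun t => star_graph_proj hps (hRs t)
  have hEE : ∀ t, E t * E t = E t := fun t =>
    graph_proj_mul_self hps hpp (hYp t) (hpY t) (hR t)
  let x : HSOp b := HSOp.mk X hXhs
  let xs : HSOp b := HSOp.mk (star X) hXhs.star'
  -- The formula of `graph_proj_sub`, with `X` or `X*` isolated as a fixed Hilbert–Schmidt factor,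
  -- so that smoothness in `L²` reduces to smoothness of bounded coefficients.
  let G : ℝ → HSOp b := fun t => V.emb + (HSOp.mulR b ((t : ℂ) • (R t * p)) x +
    HSOp.mulL b ((t : ℂ) • (p * R t)) xs + HSOp.mulL b ((t : ℂ) • (Y t * R t)) xs -
    HSOp.mulL b ((t : ℂ) • (p * R t * star (Y t))) x)
  have hG : ∀ t, HSOp.op b (G t) = E t - piPlus b := by
    intro t
    have e1 := graph_proj_sub (hYp t) hpp (hR t)
    have e2 : E t - piPlus b = (p - piPlus b) + (E t - p) := by abel
    rw [e2, e1, map_add, GrRes.op_emb, map_sub, map_add, map_add, HSOp.op_mulR, HSOp.op_mulL,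
      HSOp.op_mulL, HSOp.op_mulL]
    change _ + (X * _ + _ * star X + _ * star X - _ * X) = _
    rw [hYs]
    simp only [Y, smul_mul_assoc, mul_smul_comm, mul_assoc, hp]
  have hHS : ∀ t, IsHilbertSchmidt b (E t - piPlus b) := by
    intro t
    rw [← hG]
    exact (G t).2
  have hY : ContDiff ℝ ∞ Y := contDiff_ofReal.smul contDiff_const
  have hYst : ContDiff ℝ ∞ fun t => star (Y t) :=
    (starL' ℝ : (H →L[ℂ] H) ≃L[ℝ] (H →L[ℂ] H)).contDiff.comp hY
  have hRc : ContDiff ℝ ∞ R := by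
    rw [contDiff_iff_contDiffAt]
    intro t
    obtain ⟨u, hu⟩ := isUnit_one_add_star_mul_self (Y t)
    have e1 := contDiffAt_ringInverse ℝ (n := ∞) u
    rw [hu] at e1
    exact e1.comp t ((contDiff_const.add (hYst.mul hY)).contDiffAt (x := t))
  have hGc : ContDiff ℝ ∞ G :=
    contDiff_const.add ((((contDiff_hsMulR (contDiff_ofReal.smul (hRc.mul contDiff_const)) x).add
      (contDiff_hsMulL (contDiff_ofReal.smul (contDiff_const.mul hRc)) xs)).add
      (contDiff_hsMulL (contDiff_ofReal.smul (hY.mul hRc)) xs)).sub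
      (contDiff_hsMulL (contDiff_ofReal.smul ((contDiff_const.mul hRc).mul hYst)) x))
  have hY1 : p + Y 1 = θ := by
    change p + ((1 : ℝ) : ℂ) • (θ - p) = θ
    rw [Complex.ofReal_one, one_smul]
    abel
  refine ⟨fun t => GrRes.ofProj (hEs t) (hEE t) (hHS t), ?_, ?_, ?_⟩
  · have e1 : (GrRes.emb ∘ fun t => GrRes.ofProj (hEs t) (hEE t) (hHS t)) = G := by
      funext t
      apply HSOp.op_injective
      rw [Function.comp_apply, GrRes.op_emb, GrRes.proj_ofProj, hG]
    rw [e1]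
    exact hGc
  · apply GrRes.ext_proj
    rw [GrRes.proj_ofProj]
    have e1 : Y 0 = 0 := by simp [Y]
    change (p + Y 0) * Ring.inverse (1 + star (Y 0) * Y 0) * (p + star (Y 0)) = p
    rw [e1, star_zero, mul_zero, add_zero, add_zero, Ring.inverse_one, mul_one, hpp]
  · apply GrRes.ext_proj
    rw [GrRes.proj_ofProj]
    refine graph_proj_eq hps hpp (hYp 1) (hpY 1) (hR 1) (hRs 1) W.proj_isSelfAdjoint.star_eq ?_ ?_
    · rw [hY1, h1]
    · rw [hY1, h3, h4]

end Graphs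

/-! ### Finite-dimensional modifications of half spaces -/

section FiniteModifications

variable {H : Type*} [NormedAddCommGroup H] [InnerProductSpace ℂ H] [CompleteSpace H]

/-- The orthogonal projection onto a finite-dimensional subspace. -/
def finProj (K : Submodule ℂ H) [FiniteDimensional ℂ K] : H →L[ℂ] H :=
  orthProj K K.closed_of_finiteDimensional

theorem finProj_mem (K : Submodule ℂ H) [FiniteDimensional ℂ K] (x : H) : finProj K x ∈ K :=
  orthProj_mem _ _ _

theorem finProj_eq_self {K : Submodule ℂ H} [FiniteDimensional ℂ K] {x : H} (hx : x ∈ K) :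
    finProj K x = x := orthProj_eq_self _ _ hx

/-- Two finite-dimensional subspaces of the same dimension admit a third one which projects
isomorphically to both of them. -/
theorem exists_common_graph (K L : Submodule ℂ H) [FiniteDimensional ℂ K] [FiniteDimensional ℂ L]
    (h : Module.finrank ℂ K = Module.finrank ℂ L) :
    ∃ J : Submodule ℂ H, ∃ _ : FiniteDimensional ℂ J, J ≤ K ⊔ L ∧
      Module.finrank ℂ J = Module.finrank ℂ K ∧
      (∀ x ∈ J, finProj K x = 0 → x = 0) ∧ (∀ x ∈ J, finProj L x = 0 → x = 0) := by
  let φ : K ≃ₗ[ℂ] L := LinearEquiv.ofFinrankEq K L h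
  let pK : H →ₗ[ℂ] K := (finProj K).toLinearMap.codRestrict K (finProj_mem K)
  let pL : H →ₗ[ℂ] L := (finProj L).toLinearMap.codRestrict L (finProj_mem L)
  -- `J` will be the image of `k ↦ k + c φ(k)`. Its projections to `K` and `L`, the latter read in
  -- `K` through `φ`, are `1 + c A` and `B + c`.
  let A : Module.End ℂ K := pK ∘ₗ L.subtype ∘ₗ φ.toLinearMap
  let B : Module.End ℂ K := φ.symm.toLinearMap ∘ₗ pL ∘ₗ K.subtype
  have hA : {μ | A.HasEigenvalue μ}.Finite := Module.End.finite_hasEigenvalue A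
  have hB : {μ | B.HasEigenvalue μ}.Finite := Module.End.finite_hasEigenvalue B
  -- Both maps are injective unless `c` lies in a finite set: zero, the `-1 / μ` for eigenvalues of
  -- `A`, and the `-μ` for eigenvalues of `B`.
  obtain ⟨c, hc⟩ := (((Set.finite_singleton (0 : ℂ)).union (hA.image fun μ => -μ⁻¹)).union
    (hB.image fun μ => -μ)).exists_notMem
  rw [Set.mem_union, Set.mem_union, not_or, not_or] at hc
  obtain ⟨⟨hc0, hcA⟩, hcB⟩ := hc
  rw [Set.mem_singleton_iff] at hc0
  have hAk : ∀ k : K, k + c • A k = 0 → k = 0 := by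
    intro k hk
    by_contra hne
    refine hcA ⟨-c⁻¹, Module.End.hasEigenvalue_of_hasEigenvector (x := k) ?_, by simp⟩
    rw [Module.End.hasEigenvector_iff, Module.End.mem_eigenspace_iff]
    refine ⟨?_, hne⟩
    have h1 : c⁻¹ • (k + c • A k) = 0 := by rw [hk, smul_zero]
    rw [smul_add, inv_smul_smul₀ hc0] at h1
    rw [neg_smul]
    exact eq_neg_of_add_eq_zero_right h1
  have hBk : ∀ k : K, B k + c • k = 0 → k = 0 := by
    intro k hk
    by_contra hne
    refine hcB ⟨-c, Module.End.hasEigenvalue_of_hasEigenvector (x := k) ?_, by simp⟩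
    rw [Module.End.hasEigenvector_iff, Module.End.mem_eigenspace_iff]
    refine ⟨?_, hne⟩
    rw [neg_smul]
    exact eq_neg_of_add_eq_zero_left hk
  let f : K →ₗ[ℂ] H := K.subtype + c • (L.subtype ∘ₗ φ.toLinearMap)
  have hfK : ∀ k, finProj K (f k) = 0 → k = 0 := by
    intro k hk
    apply hAk
    apply Subtype.ext
    have h1 : finProj K (f k) = k + c • finProj K (φ k) := by
      change finProj K (k + c • (φ k : H)) = _
      rw [map_add, map_smul, finProj_eq_self k.2]
    rw [h1] at hk
    exact hk
  have hfL : ∀ k, finProj L (f k) = 0 → k = 0 := by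
    intro k hk
    apply hBk
    have h1 : finProj L (f k) = finProj L k + c • (φ k : H) := by
      change finProj L (k + c • (φ k : H)) = _
      rw [map_add, map_smul, finProj_eq_self (φ k).2]
    rw [h1] at hk
    have h2 : pL k + c • φ k = 0 := Subtype.ext hk
    have h3 := congrArg φ.symm h2
    rw [map_add, map_smul, φ.symm_apply_apply, map_zero] at h3
    exact h3
  refine ⟨LinearMap.range f, inferInstance, ?_, ?_, ?_, ?_⟩
  · rintro _ ⟨k, rfl⟩
    exact Submodule.add_mem _ (Submodule.mem_sup_left k.2)
      (Submodule.smul_mem _ _ (Submodule.mem_sup_right (φ k).2))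
  · apply LinearMap.finrank_range_of_inj
    rw [injective_iff_map_eq_zero]
    intro k hk
    exact hfK k (by rw [hk, map_zero])
  · rintro _ ⟨k, rfl⟩ hk
    rw [hfK k hk, map_zero]
  · rintro _ ⟨k, rfl⟩ hk
    rw [hfL k hk, map_zero]

variable {b : HilbertBasis ℤ ℂ H}

section

variable {K : Submodule ℂ H} [FiniteDimensional ℂ K] {N : ℤ}

theorem halfProj_mul_finProj (hK : ∀ x ∈ K, halfProj b N x = 0) :
    halfProj b N * finProj K = 0 := by
  ext x
  exact hK _ (finProj_mem K x)

theorem finProj_mul_halfProj (hK : ∀ x ∈ K, halfProj b N x = 0) :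
    finProj K * halfProj b N = 0 := by
  have h := congrArg star (halfProj_mul_finProj hK)
  rwa [star_mul, star_zero, (halfProj_isSelfAdjoint N).star_eq, finProj,
    (orthProj_isSelfAdjoint _ _).star_eq] at h

/-- The subspace `K + span {e_i | N ≤ i}`, where `K` is finite-dimensional and orthogonal to the
second summand. -/
def GrRes.ofFinite (hK : ∀ x ∈ K, halfProj b N x = 0) : GrRes b :=
  GrRes.ofProj (E := finProj K + halfProj b N)
    ((orthProj_isSelfAdjoint _ _).add (halfProj_isSelfAdjoint N))
    (by
      rw [add_mul, mul_add, mul_add, halfProj_mul_finProj hK, finProj_mul_halfProj hK,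
        halfProj_mul_self, finProj, orthProj_mul_self, add_zero, zero_add])
    (by
      rw [add_sub_assoc]
      have h := isHilbertSchmidt_of_finite_range b 1 K K.closed_of_finiteDimensional
      rw [mul_one] at h
      exact (hsSubmodule b).add_mem h (isHilbertSchmidt_halfProj_sub N))

theorem GrRes.proj_ofFinite (hK : ∀ x ∈ K, halfProj b N x = 0) :
    (GrRes.ofFinite hK).proj = finProj K + halfProj b N := GrRes.proj_ofProj _ _ _

theorem GrRes.proj_ofFinite_apply (hK : ∀ x ∈ K, halfProj b N x = 0) (x : H) :
    (GrRes.ofFinite hK).proj x = finProj K x + halfProj b N x := by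
  rw [GrRes.proj_ofFinite, add_apply]

theorem halfProj_mul_proj_ofFinite (hK : ∀ x ∈ K, halfProj b N x = 0) :
    halfProj b N * (GrRes.ofFinite hK).proj = halfProj b N := by
  rw [GrRes.proj_ofFinite, mul_add, halfProj_mul_finProj hK, halfProj_mul_self, zero_add]

theorem halfProj_apply_proj_ofFinite (hK : ∀ x ∈ K, halfProj b N x = 0) (x : H) :
    halfProj b N ((GrRes.ofFinite hK).proj x) = halfProj b N x :=
  congrArg (fun S : H →L[ℂ] H => S x) (halfProj_mul_proj_ofFinite hK)

theorem finProj_halfProj_apply (hK : ∀ x ∈ K, halfProj b N x = 0) (x : H) :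
    finProj K (halfProj b N x) = 0 :=
  congrArg (fun S : H →L[ℂ] H => S x) (finProj_mul_halfProj hK)

theorem halfProj_halfProj_apply (x : H) : halfProj b N (halfProj b N x) = halfProj b N x :=
  congrArg (fun S : H →L[ℂ] H => S x) (halfProj_mul_self N)

/-- The projection is the identity on the common half space and an injection `K → L` between spaces
of equal dimension, hence bijective. -/
theorem GrRes.isGraphOver_ofFinite {L : Submodule ℂ H} [FiniteDimensional ℂ L]
    (hK : ∀ x ∈ K, halfProj b N x = 0) (hL : ∀ x ∈ L, halfProj b N x = 0)
    (hd : Module.finrank ℂ K = Module.finrank ℂ L) (h : ∀ x ∈ K, finProj L x = 0 → x = 0) :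
    (GrRes.ofFinite hK).IsGraphOver (GrRes.ofFinite hL) := by
  apply GrRes.isGraphOver_of_bijective
  · intro v hv hv0
    rw [GrRes.mem_iff, GrRes.proj_ofFinite_apply] at hv
    have h1 := congrArg (halfProj b N) hv0
    rw [halfProj_apply_proj_ofFinite, map_zero] at h1
    rw [h1, add_zero] at hv
    rw [GrRes.proj_ofFinite_apply, h1, add_zero] at hv0
    exact h v (hv ▸ finProj_mem K v) hv0
  · intro y hy
    rw [GrRes.mem_iff, GrRes.proj_ofFinite_apply] at hy
    let g : K →ₗ[ℂ] L := ((finProj L).toLinearMap.comp K.subtype).codRestrict L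
      fun x => finProj_mem L x
    have hg : Function.Injective g := by
      rw [injective_iff_map_eq_zero]
      intro k hk
      exact Subtype.ext (h k k.2 (congrArg (fun z : L => (z : H)) hk))
    obtain ⟨k, hk⟩ := (LinearMap.injective_iff_surjective_of_finrank_eq_finrank hd).1 hg
      ⟨finProj L y, finProj_mem L y⟩
    have hk' : finProj L (k : H) = finProj L y := congrArg (fun z : L => (z : H)) hk
    refine ⟨k + halfProj b N y, ?_, ?_⟩
    · rw [GrRes.mem_iff, GrRes.proj_ofFinite_apply, map_add, map_add, finProj_eq_self k.2,
        finProj_halfProj_apply hK, hK k k.2, halfProj_halfProj_apply, add_zero, zero_add]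
    · rw [GrRes.proj_ofFinite_apply, map_add, map_add, finProj_halfProj_apply hL, hK k k.2,
        halfProj_halfProj_apply, add_zero, zero_add, hk', hy]

end

/-! ### The virtual dimension -/

namespace GrRes

variable (W : GrRes b)

/-- The vectors of `W` orthogonal to all `e_i` with `N ≤ i`. -/
def low (N : ℤ) : Submodule ℂ H := W.carrier ⊓ LinearMap.ker (halfProj b N).toLinearMap

variable {W}

theorem mem_low {N : ℤ} {x : H} : x ∈ W.low N ↔ x ∈ W.carrier ∧ halfProj b N x = 0 := Iff.rfl

theorem halfProj_low (W : GrRes b) (N : ℤ) : ∀ x ∈ W.low N, halfProj b N x = 0 :=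
  fun _ hx => (mem_low.1 hx).2

instance (N : ℤ) : FiniteDimensional ℂ (W.low N) :=
  finiteDimensional_of_halfProj_eq_zero W.isHilbertSchmidt_proj_sub _ N
    (fun _ hx => mem_iff.1 hx.1) (fun _ hx => hx.2)

variable (W) in
/-- `W` projects onto the closed span of the `e_i` with `N ≤ i`, with a kernel of dimension `d`. -/
def HasIndex (N : ℤ) (d : ℕ) : Prop :=
  (∀ y ∈ halfSpace b N, ∃ w ∈ W.carrier, halfProj b N w = y) ∧ Module.finrank ℂ (W.low N) = d

variable (W) in
theorem exists_hasIndex : ∃ N₀ : ℤ, ∀ N, N₀ ≤ N → ∃ d, W.HasIndex N d := by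
  obtain ⟨N₀, -, h⟩ := exists_forall_exists_halfProj_eq W.isHilbertSchmidt_proj_sub W.proj_mul_self
  refine ⟨N₀, fun N hN => ⟨_, fun y hy => ?_, rfl⟩⟩
  obtain ⟨w, hw, hwy⟩ := h N hN y hy
  exact ⟨w, mem_iff.2 hw, hwy⟩

theorem halfProj_eq_zero_iff {N : ℤ} {x : H} :
    halfProj b N x = 0 ↔ ∀ i, N ≤ i → inner ℂ (b i) x = 0 := by
  constructor
  · intro h i hi
    have := congrArg (inner ℂ (b i)) h
    rwa [inner_halfProj, if_pos hi, inner_zero_right] at this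
  · intro h
    apply ext_basis b
    intro i
    rw [inner_halfProj, inner_zero_right]
    split_ifs with hi
    · exact h i hi
    · rfl

/-- The functional `⟨e_N, ·⟩` on `W.low (N + 1)` has kernel `W.low N`. It is onto, since a vector of
`W` projecting to `e_N` lies in `W.low (N + 1)`. -/
theorem HasIndex.succ {N : ℤ} {d : ℕ} (h : W.HasIndex N d) : W.HasIndex (N + 1) (d + 1) := by
  constructor
  · intro y hy
    obtain ⟨w, hw, hwy⟩ := h.1 y fun i hi => hy i (by omega)
    refine ⟨w, hw, ?_⟩
    have h1 := congrArg (fun S : H →L[ℂ] H => S w) (halfProj_mul_of_le' (b := b) (N := N)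
      (M := N + 1) (by omega))
    rw [← h1]
    change halfProj b (N + 1) (halfProj b N w) = y
    rw [hwy]
    exact orthProj_eq_self _ _ hy
  · let f : W.low (N + 1) →ₗ[ℂ] ℂ := (innerSL ℂ (b N)).toLinearMap.comp (W.low (N + 1)).subtype
    have hf : ∀ x : W.low (N + 1), f x = inner ℂ (b N) (x : H) := fun _ => rfl
    have hr : LinearMap.range f = ⊤ := by
      obtain ⟨w, hw, hwN⟩ := h.1 (b N) (basis_mem_halfSpace le_rfl)
      have h2 : w ∈ W.low (N + 1) := by
        refine ⟨hw, halfProj_eq_zero_iff.2 fun i hi => ?_⟩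
        have h3 := congrArg (inner ℂ (b i)) hwN
        rw [inner_halfProj, if_pos (by omega), b.orthonormal.2 (by omega : i ≠ N)] at h3
        exact h3
      have h4 : f ⟨w, h2⟩ = 1 := by
        have h3 := congrArg (inner ℂ (b N)) hwN
        rw [inner_halfProj, if_pos le_rfl, inner_self_eq_norm_sq_to_K, b.orthonormal.1] at h3
        rw [hf, h3]
        simp
      rw [LinearMap.range_eq_top]
      intro z
      exact ⟨z • ⟨w, h2⟩, by rw [map_smul, h4, smul_eq_mul, mul_one]⟩
    have hk : Module.finrank ℂ (LinearMap.ker f) = d := by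
      rw [← h.2]
      have hm : (LinearMap.ker f).map (W.low (N + 1)).subtype = W.low N := by
        ext x
        rw [Submodule.mem_map]
        constructor
        · rintro ⟨y, hy, rfl⟩
          refine ⟨y.2.1, halfProj_eq_zero_iff.2 fun i hi => ?_⟩
          rcases hi.eq_or_lt with rfl | hi
          · exact hy
          · exact halfProj_eq_zero_iff.1 y.2.2 i hi
        · rintro ⟨hx, hx0⟩
          have h0 := halfProj_eq_zero_iff.1 hx0
          exact ⟨⟨x, hx, halfProj_eq_zero_iff.2 fun i hi => h0 i (by omega)⟩, h0 N le_rfl, rfl⟩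
      rw [← hm]
      exact (Submodule.equivMapOfInjective _ (Submodule.injective_subtype _) _).finrank_eq
    have := LinearMap.finrank_range_add_finrank_ker f
    rw [hr, hk, finrank_top, Module.finrank_self] at this
    omega

theorem HasIndex.add {N : ℤ} {d : ℕ} (h : W.HasIndex N d) (k : ℕ) : W.HasIndex (N + k) (d + k) := by
  induction k with
  | zero => simpa using h
  | succ k ih =>
    have := ih.succ
    rwa [add_assoc, add_assoc, ← Nat.cast_succ] at this

/-- The common value is the Fredholm index of `π₊ : W → H₊`: for `N ≥ 0` the projection of `H₊` onto
the half space has index `N`. -/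
theorem HasIndex.unique {N M : ℤ} {d e : ℕ} (h : W.HasIndex N d) (h' : W.HasIndex M e) :
    (d : ℤ) - N = e - M := by
  wlog hNM : N ≤ M generalizing N M d e
  · exact (this h' h (le_of_not_ge hNM)).symm
  obtain ⟨k, rfl⟩ := Int.le.dest hNM
  have := (h.add k).2.symm.trans h'.2
  omega

variable (W) in
/-- The virtual dimension. -/
def index : ℤ :=
  (W.exists_hasIndex.choose_spec _ le_rfl).choose - W.exists_hasIndex.choose

theorem HasIndex.index_eq {N : ℤ} {d : ℕ} (h : W.HasIndex N d) : W.index = d - N :=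
  (W.exists_hasIndex.choose_spec _ le_rfl).choose_spec.unique h

/-- The hypothesis says that `V` contains the half space. Then `θ` does not change the component in
the half space, so it maps `V.low N` isomorphically to `W.low N`. The index of `W` is thus read off
from `V`. -/
theorem hasIndex_of_halfProj_mul {V : GrRes b} {N : ℤ} (hV : halfProj b N * V.proj = halfProj b N)
    (h : W.IsGraphOver V) : W.HasIndex N (Module.finrank ℂ (V.low N)) := by
  obtain ⟨θ, h1, h2, h3, h4⟩ := h
  have h1' : ∀ x, W.proj (θ x) = θ x := fun x => congrArg (fun S : H →L[ℂ] H => S x) h1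
  have h2' : ∀ x, V.proj (θ x) = V.proj x := fun x => congrArg (fun S : H →L[ℂ] H => S x) h2
  have h3' : ∀ x, θ (V.proj x) = θ x := fun x => congrArg (fun S : H →L[ℂ] H => S x) h3
  have h4' : ∀ x, θ (W.proj x) = W.proj x := fun x => congrArg (fun S : H →L[ℂ] H => S x) h4
  have hV' : ∀ x, halfProj b N (V.proj x) = halfProj b N x := fun x =>
    congrArg (fun S : H →L[ℂ] H => S x) hV
  constructor
  · intro y hy
    refine ⟨θ y, mem_iff.2 (h1' y), ?_⟩
    rw [← hV', h2', hV']
    exact orthProj_eq_self _ _ hy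
  · refine LinearEquiv.finrank_eq
      { toFun x := ⟨V.proj x, orthProj_mem _ _ _, (hV' x).trans x.2.2⟩
        invFun y := ⟨θ y, mem_iff.2 (h1' y), ?_⟩
        map_add' x y := Subtype.ext (map_add V.proj _ _)
        map_smul' c x := Subtype.ext (map_smul V.proj c _)
        left_inv x := ?_
        right_inv y := ?_ }
    · change halfProj b N (θ y) = 0
      rw [← hV', h2', hV']
      exact y.2.2
    · apply Subtype.ext
      change θ (V.proj x) = x
      rw [h3', ← mem_iff.1 x.2.1, h4']
    · apply Subtype.ext
      change V.proj (θ y) = y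
      rw [h2', mem_iff.1 y.2.1]

/-- A vector of `W` is determined by its component in the half space and its projection to `W.low
N`. Surjectivity onto the half space allows both to be prescribed. -/
theorem HasIndex.isGraphOver {N : ℤ} {d : ℕ} (h : W.HasIndex N d) :
    W.IsGraphOver (ofFinite (halfProj_low W N)) := by
  have hK := halfProj_low W N
  apply isGraphOver_of_bijective
  · intro w hw hw0
    have h1 := congrArg (halfProj b N) hw0
    rw [halfProj_apply_proj_ofFinite, map_zero] at h1
    rwa [proj_ofFinite_apply, h1, add_zero, finProj_eq_self (mem_low.2 ⟨hw, h1⟩)] at hw0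
  · intro y hy
    rw [mem_iff, proj_ofFinite_apply] at hy
    obtain ⟨w, hw, hwy⟩ := h.1 (halfProj b N y) (orthProj_mem _ _ _)
    refine ⟨w - finProj (W.low N) w + finProj (W.low N) y, ?_, ?_⟩
    · exact W.carrier.add_mem (W.carrier.sub_mem hw (finProj_mem (W.low N) w).1)
        (finProj_mem (W.low N) y).1
    · rw [proj_ofFinite_apply, map_add, map_sub, map_add, map_sub,
        finProj_eq_self (finProj_mem (W.low N) w), finProj_eq_self (finProj_mem (W.low N) y),
        hK _ (finProj_mem (W.low N) w), hK _ (finProj_mem (W.low N) y), sub_self, zero_add,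
        sub_zero, add_zero, hwy, hy]

/-- Points near `W` remain graphs over the same model, a finite-dimensional space plus a half space,
which determines the index. -/
theorem eventually_index_eq (W : GrRes b) : ∀ᶠ W' in nhds W, index W' = index W := by
  obtain ⟨N, hN⟩ := W.exists_hasIndex
  obtain ⟨d, h⟩ := hN N le_rfl
  have hg := h.isGraphOver
  filter_upwards [hg.eventually] with W' hW'
  rw [(hasIndex_of_halfProj_mul (halfProj_mul_proj_ofFinite _) hg).index_eq,
    (hasIndex_of_halfProj_mul (halfProj_mul_proj_ofFinite _) hW').index_eq]

theorem isLocallyConstant_index : IsLocallyConstant (index (b := b)) :=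
  (IsLocallyConstant.iff_eventually_eq _).2 eventually_index_eq

/-- A quantity which is invariant along smooth paths depends only on the virtual dimension. -/
theorem eq_of_index_eq {α : Type*} (Φ : GrRes b → α)
    (hΦ : ∀ V W : GrRes b, V.Connected W → Φ V = Φ W) {V W : GrRes b} (h : V.index = W.index) :
    Φ V = Φ W := by
  obtain ⟨N₀, h0⟩ := V.exists_hasIndex
  obtain ⟨N₁, h1⟩ := W.exists_hasIndex
  obtain ⟨d, hd⟩ := h0 (max N₀ N₁) (le_max_left _ _)
  obtain ⟨e, he⟩ := h1 (max N₀ N₁) (le_max_right _ _)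
  generalize max N₀ N₁ = N at hd he
  rw [hd.index_eq, he.index_eq] at h
  have hde : Module.finrank ℂ (V.low N) = Module.finrank ℂ (W.low N) := by
    rw [hd.2, he.2]
    omega
  -- Four paths link `V` and `W` through three models over the same half space, with finite parts
  -- `V.low N`, `J` and `W.low N`.
  obtain ⟨J, hJ, hJle, hJd, hJV, hJW⟩ := exists_common_graph (V.low N) (W.low N) hde
  have hJ0 : ∀ x ∈ J, halfProj b N x = 0 := by
    intro x hx
    obtain ⟨y, hy, z, hz, rfl⟩ := Submodule.mem_sup.1 (hJle hx)
    rw [map_add, halfProj_low V N y hy, halfProj_low W N z hz, add_zero]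
  have e1 := hΦ _ _ hd.isGraphOver.connected
  have e2 := hΦ _ _ he.isGraphOver.connected
  have e3 := hΦ _ _ (isGraphOver_ofFinite hJ0 (halfProj_low V N) hJd hJV).connected
  have e4 := hΦ _ _ (isGraphOver_ofFinite hJ0 (halfProj_low W N) (hJd.trans hde) hJW).connected
  rw [← e1, ← e2, e3, e4]

end GrRes

end FiniteModifications

/-! ### The groups K̂⁰ and K⁰ of the point -/

section EvenPoint

variable {H : Type*} [NormedAddCommGroup H] [InnerProductSpace ℂ H] [CompleteSpace H]
variable {b : HilbertBasis ℤ ℂ H}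

theorem halfProj_rho₀ (N : ℤ) (x : H) :
    halfProj b N (rho₀ intSplitting b x) = rho₀ intSplitting b (halfProj b (2 * N) x) := by
  apply ext_basis b
  intro i
  rw [inner_halfProj, rho₀, inner_basis_star_basisShift, inner_basis_star_basisShift,
    inner_halfProj]
  change (if N ≤ i then _ else _) = if 2 * N ≤ 2 * i then _ else _
  simp

theorem halfProj_rho₁ (N : ℤ) (x : H) :
    halfProj b N (rho₁ intSplitting b x) = rho₁ intSplitting b (halfProj b (2 * N) x) := by
  apply ext_basis b
  intro i
  rw [inner_halfProj, rho₁, inner_basis_star_basisShift, inner_basis_star_basisShift,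
    inner_halfProj]
  change (if N ≤ i then _ else _) = if 2 * N ≤ 2 * i + 1 then _ else _
  have e : (2 * N ≤ 2 * i + 1) = (N ≤ i) := by
    apply propext
    omega
  simp only [e]

namespace GrRes

variable {V W : GrRes b}

/-- The half space from `2 N` on is the block sum of two copies of the one from `N` on, so both
surjectivity and the kernel split through `ρ`. -/
theorem HasIndex.blockSum {N : ℤ} {d e : ℕ} (hW : W.HasIndex N d) (hV : V.HasIndex N e) :
    (W.blockSum V).HasIndex (2 * N) (d + e) := by
  have hr : ∀ x, halfProj b (2 * N) x = star (rho₀ intSplitting b)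
      (halfProj b N (rho₀ intSplitting b x)) + star (rho₁ intSplitting b)
      (halfProj b N (rho₁ intSplitting b x)) := by
    intro x
    rw [halfProj_rho₀, halfProj_rho₁, combine_rho]
  constructor
  · intro y hy
    have hy' : halfProj b (2 * N) y = y := orthProj_eq_self _ _ hy
    have h0 : rho₀ intSplitting b y ∈ halfSpace b N := by
      rw [← hy', ← halfProj_rho₀]
      exact orthProj_mem _ _ _
    have h1 : rho₁ intSplitting b y ∈ halfSpace b N := by
      rw [← hy', ← halfProj_rho₁]
      exact orthProj_mem _ _ _
    obtain ⟨w, hw, hwy⟩ := hW.1 _ h0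
    obtain ⟨v, hv, hvy⟩ := hV.1 _ h1
    refine ⟨star (rho₀ intSplitting b) w + star (rho₁ intSplitting b) v, ?_, ?_⟩
    · change _ ∈ subspaceSum b W.carrier V.carrier
      rw [mem_subspaceSum, rho₀_combine, rho₁_combine]
      exact ⟨hw, hv⟩
    · rw [hr, rho₀_combine, rho₁_combine, hwy, hvy, combine_rho]
  · rw [← hW.2, ← hV.2, ← Module.finrank_prod]
    refine LinearEquiv.finrank_eq
      { toFun x := (⟨rho₀ intSplitting b x, x.2.1.1, ?_⟩, ⟨rho₁ intSplitting b x, x.2.1.2, ?_⟩)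
        invFun y := ⟨star (rho₀ intSplitting b) y.1 + star (rho₁ intSplitting b) y.2, ?_, ?_⟩
        map_add' x y := Prod.ext (Subtype.ext (map_add _ _ _)) (Subtype.ext (map_add _ _ _))
        map_smul' c x := Prod.ext (Subtype.ext (map_smul _ _ _)) (Subtype.ext (map_smul _ _ _))
        left_inv x := Subtype.ext (combine_rho b _)
        right_inv y := Prod.ext (Subtype.ext (rho₀_combine b _ _))
          (Subtype.ext (rho₁_combine b _ _)) }
    · change halfProj b N (rho₀ intSplitting b x) = 0
      rw [halfProj_rho₀, halfProj_low _ _ _ x.2, map_zero]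
    · change halfProj b N (rho₁ intSplitting b x) = 0
      rw [halfProj_rho₁, halfProj_low _ _ _ x.2, map_zero]
    · change _ ∈ subspaceSum b W.carrier V.carrier
      rw [mem_subspaceSum, rho₀_combine, rho₁_combine]
      exact ⟨y.1.2.1, y.2.2.1⟩
    · change halfProj b (2 * N) _ = 0
      rw [hr, rho₀_combine, rho₁_combine, halfProj_low _ _ _ y.1.2, halfProj_low _ _ _ y.2.2,
        map_zero, map_zero, add_zero]

theorem index_blockSum (W V : GrRes b) : (W.blockSum V).index = W.index + V.index := by
  obtain ⟨N₀, h0⟩ := W.exists_hasIndex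
  obtain ⟨N₁, h1⟩ := V.exists_hasIndex
  obtain ⟨d, hd⟩ := h0 (max N₀ N₁) (le_max_left _ _)
  obtain ⟨e, he⟩ := h1 (max N₀ N₁) (le_max_right _ _)
  rw [(hd.blockSum he).index_eq, hd.index_eq, he.index_eq]
  push_cast
  ring

variable (b) in
/-- The closed span of the `e_i` with `N ≤ i`, as a point of the restricted Grassmannian. -/
def half (N : ℤ) : GrRes b :=
  ofProj (halfProj_isSelfAdjoint N) (halfProj_mul_self N) (isHilbertSchmidt_halfProj_sub N)

theorem index_half (N : ℤ) : (half b N).index = -N := by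
  have hp : (half b N).proj = halfProj b N := proj_ofProj _ _ _
  have h : (half b N).HasIndex N 0 := by
    constructor
    · intro y hy
      have hy' : halfProj b N y = y := orthProj_eq_self _ _ hy
      exact ⟨y, mem_iff.2 (by rw [hp, hy']), hy'⟩
    · have hb : (half b N).low N = ⊥ := by
        rw [eq_bot_iff]
        intro x hx
        have h1 := mem_iff.1 (mem_low.1 hx).1
        rw [hp, (mem_low.1 hx).2] at h1
        rw [← h1]
        exact Submodule.zero_mem _
      rw [hb, finrank_bot]
  rw [h.index_eq]
  simp

theorem index_base : (base b).index = 0 := by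
  have h : base b = half b 0 := by
    apply ext_proj
    rw [half, proj_ofProj, halfProj_zero]
    rfl
  rw [h, index_half, neg_zero]

end GrRes

/-- The degree is at least two, so an argument from the base always occurs; the parity of its
position only decides which of two factors vanishes. Every smooth homotopy over the point is
therefore a Chern–Simons homotopy. -/
theorem csForm_chEven (F : Point × ℝ → GrRes b) (j : ℕ) (x : Point)
    (v : Fin (2 * j + 1) → TangentSpace 𝓘(ℝ, Point) x) :
    csForm (E := Point) GrRes.emb (chEven b j) F x v = 0 := by
  rw [csForm]
  refine intervalIntegral.integral_zero_ae (Filter.Eventually.of_forall fun t _ => ?_)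
  rw [chEven]
  refine mul_eq_zero_of_right _ (Finset.sum_eq_zero fun σ _ => ?_)
  set A : Fin (2 * j + 1 + 1) → HSOp b := Fin.cons (homotopyDeriv (E := Point) GrRes.emb F x t 0 1)
    fun i => homotopyDeriv (E := Point) GrRes.emb F x t (v i) 0 with hA
  have hz : ∀ m : Fin (2 * j + 1 + 1), σ m = Fin.succ 0 → HSOp.op b (A (σ m)) = 0 := by
    intro m hm
    rw [hm, hA, Fin.cons_succ, homotopyDeriv_zero_right, map_zero]
  have h0 : (List.ofFn fun l : Fin (j + 1) =>
        (F (x, t)).proj * HSOp.op b (A (σ ⟨2 * l.1, by omega⟩)) *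
          HSOp.op b (A (σ ⟨2 * l.1 + 1, by omega⟩))).prod = 0 := by
    apply List.prod_eq_zero
    rw [List.mem_ofFn]
    obtain ⟨m, hm⟩ := σ.surjective (Fin.succ 0)
    have hm2 := m.2
    refine ⟨⟨m.1 / 2, by omega⟩, ?_⟩
    rcases Nat.mod_two_eq_zero_or_one m.1 with h | h
    · have e : (⟨2 * (m.1 / 2), by omega⟩ : Fin (2 * j + 1 + 1)) = m := Fin.ext (by simp only; omega)
      simp only [e, hz m hm, mul_zero, zero_mul]
    · have e : (⟨2 * (m.1 / 2) + 1, by omega⟩ : Fin (2 * j + 1 + 1)) = m :=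
        Fin.ext (by simp only; omega)
      simp only [e, hz m hm, mul_zero]
  rw [h0]
  simp [opTrace]

/-- The constant map with value `W`. -/
def EvenMap.const (W : GrRes b) : EvenMap b Point Point := ⟨fun _ => W, contMDiff_const⟩

theorem EvenMap.eq_const (f : EvenMap b Point Point) : f = EvenMap.const (f.1 0) :=
  Subtype.ext (funext fun x => congrArg f.1 (Subsingleton.elim x 0))

theorem continuousMap_point_eq_const {X : Type*} [TopologicalSpace X] (f : C(Point, X)) :
    f = ContinuousMap.const Point (f 0) :=
  ContinuousMap.ext fun x => congrArg f (Subsingleton.elim x 0)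

theorem KHat0.mk_const_eq_of_connected {V W : GrRes b} (h : V.Connected W) :
    KHat0.mk (EvenMap.const V) = KHat0.mk (EvenMap.const W) := by
  obtain ⟨γ, hγ, h0, h1⟩ := h
  refine Quot.sound (Or.inl ⟨fun p => γ p.2, isSmoothHomotopy_of_contDiff hγ, fun _ => h0,
    fun _ => h1, fun j => ?_⟩)
  exact isExactForm_of_forall_eq_zero _ fun x v => csForm_chEven _ j x v

theorem K0.mk_const_eq_of_connected {V W : GrRes b} (h : V.Connected W) :
    K0.mk (ContinuousMap.const Point V) = K0.mk (ContinuousMap.const Point W) := by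
  obtain ⟨γ, hγ, h0, h1⟩ := h
  have hc : Continuous γ := continuous_induced_rng.2 hγ.continuous
  refine Quotient.sound ⟨⟨⟨fun p => γ p.1, hc.comp (continuous_subtype_val.comp continuous_fst)⟩,
    fun x => ?_, fun x => ?_⟩⟩
  · exact h0
  · exact h1

/-- The virtual dimension on `K̂⁰` of the point. -/
def KHat0.index : KHat0 b Point Point → ℤ :=
  Quot.lift (fun f => (f.1 0).index) (by
    rintro f g (⟨F, hF, h0, h1, -⟩ | rfl)
    · have hc : Continuous fun t : unitInterval => F (0, (t : ℝ)) :=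
        continuous_induced_rng.2
          (continuousOn_iff_continuous_domRestrict.1 (hF.contDiffOn 0).continuousOn)
      have h2 := (GrRes.isLocallyConstant_index.comp_continuous hc).apply_eq_of_preconnectedSpace
        0 1
      change (F (0, ((0 : unitInterval) : ℝ))).index = (F (0, ((1 : unitInterval) : ℝ))).index at h2
      rwa [Set.Icc.coe_zero, Set.Icc.coe_one, h0, h1] at h2
    · change _ = ((f.1 0).blockSum (GrRes.base b)).index
      rw [GrRes.index_blockSum, GrRes.index_base, add_zero])

/-- The virtual dimension on `K⁰` of the point. -/
def K0.index : K0 b Point → ℤ :=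
  Quotient.lift (fun f => (f 0).index) (by
    rintro f g ⟨F⟩
    have hc : Continuous fun t : unitInterval => F (t, 0) := by fun_prop
    have h2 := (GrRes.isLocallyConstant_index.comp_continuous hc).apply_eq_of_preconnectedSpace 0 1
    change (F (0, 0)).index = (F (1, 0)).index at h2
    rwa [F.apply_zero, F.apply_one] at h2)

variable (b) in
/-- The virtual dimension identifies `K̂⁰` of the point with the integers. -/
def KHat0.equivInt : KHat0 b Point Point ≃ ℤ :=
  Equiv.ofBijective KHat0.index
    ⟨by
      intro x y h
      obtain ⟨f, rfl⟩ := Quot.exists_rep x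
      obtain ⟨g, rfl⟩ := Quot.exists_rep y
      have h' : (f.1 0).index = (g.1 0).index := h
      change KHat0.mk f = KHat0.mk g
      rw [f.eq_const, g.eq_const]
      exact GrRes.eq_of_index_eq (fun W => KHat0.mk (EvenMap.const W))
        (fun _ _ => KHat0.mk_const_eq_of_connected) h', by
      intro n
      -- The half space starting at `-n` has virtual dimension `n`.
      refine ⟨KHat0.mk (EvenMap.const (GrRes.half b (-n))), ?_⟩
      exact (GrRes.index_half (-n)).trans (neg_neg n)⟩

variable (b) in
/-- The virtual dimension identifies `K⁰` of the point with the integers. -/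
def K0.equivInt : K0 b Point ≃ ℤ :=
  Equiv.ofBijective K0.index
    ⟨by
      intro x y h
      obtain ⟨f, rfl⟩ := Quotient.exists_rep x
      obtain ⟨g, rfl⟩ := Quotient.exists_rep y
      have h' : (f 0).index = (g 0).index := h
      change K0.mk f = K0.mk g
      rw [continuousMap_point_eq_const f, continuousMap_point_eq_const g]
      exact GrRes.eq_of_index_eq (fun W => K0.mk (ContinuousMap.const Point W))
        (fun _ _ => K0.mk_const_eq_of_connected) h', by
      intro n
      refine ⟨K0.mk (ContinuousMap.const Point (GrRes.half b (-n))), ?_⟩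
      exact (GrRes.index_half (-n)).trans (neg_neg n)⟩

-- Both groups are transported from `ℤ`, and the block sum induces them because the index is
-- additive. The underlying class map preserves the index of the value at the point, so it is the
-- composite of the two identifications.
variable (b) in
theorem exists_addCommGroup_KHat0_K0_point :
    ∃ (_ : AddCommGroup (KHat0 b Point Point)) (_ : AddCommGroup (K0 b Point)),
      (∀ f g : EvenMap b Point Point, KHat0.mk f + KHat0.mk g = KHat0.mk (f.blockSum g)) ∧
      (∀ f g : C(Point, GrRes b), K0.mk f + K0.mk g = K0.mk (K0.blockSum f g)) ∧
      (∃ I : KHat0 b Point Point ≃+ K0 b Point,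
        ∀ f : EvenMap b Point Point, I (KHat0.mk f) = K0.mk f.toContinuousMap) ∧
      Nonempty (K0 b Point ≃+ ℤ) := by
  let _ : AddCommGroup (KHat0 b Point Point) := (KHat0.equivInt b).addCommGroup
  let _ : AddCommGroup (K0 b Point) := (K0.equivInt b).addCommGroup
  refine ⟨inferInstance, inferInstance, fun f g => ?_, fun f g => ?_,
    ⟨(KHat0.equivInt b).addEquiv.trans (K0.equivInt b).addEquiv.symm, fun f => ?_⟩,
    ⟨(K0.equivInt b).addEquiv⟩⟩
  · apply (KHat0.equivInt b).addEquiv.injective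
    rw [map_add]
    exact (GrRes.index_blockSum (f.1 0) (g.1 0)).symm
  · apply (K0.equivInt b).addEquiv.injective
    rw [map_add]
    exact (GrRes.index_blockSum (f 0) (g 0)).symm
  · rw [AddEquiv.trans_apply, AddEquiv.symm_apply_eq]
    rfl

end EvenPoint

end

end DiffK

theorem mainTheorem10
    {H : Type*} [NormedAddCommGroup H] [InnerProductSpace ℂ H] [CompleteSpace H]
    (b : HilbertBasis ℤ ℂ H)
    {Hp : Type*} [NormedAddCommGroup Hp] [InnerProductSpace ℂ Hp] [CompleteSpace Hp]
    (c : HilbertBasis ℕ ℂ Hp) :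
    (∃ (_ : AddCommGroup (DiffK.KHat0 b DiffK.Point DiffK.Point))
       (_ : AddCommGroup (DiffK.K0 b DiffK.Point)),
      (∀ f g : DiffK.EvenMap b DiffK.Point DiffK.Point,
        DiffK.KHat0.mk f + DiffK.KHat0.mk g = DiffK.KHat0.mk (f.blockSum g)) ∧
      (∀ f g : C(DiffK.Point, DiffK.GrRes b),
        DiffK.K0.mk f + DiffK.K0.mk g = DiffK.K0.mk (DiffK.K0.blockSum f g)) ∧
      (∃ I : DiffK.KHat0 b DiffK.Point DiffK.Point ≃+ DiffK.K0 b DiffK.Point,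
        ∀ f : DiffK.EvenMap b DiffK.Point DiffK.Point,
          I (DiffK.KHat0.mk f) = DiffK.K0.mk f.toContinuousMap) ∧
      Nonempty (DiffK.K0 b DiffK.Point ≃+ ℤ)) ∧
    (∃ _ : AddCommGroup (DiffK.KHat1 c DiffK.Point DiffK.Point),
      (∀ f g : DiffK.OddMap Hp DiffK.Point DiffK.Point,
        DiffK.KHat1.mk c f + DiffK.KHat1.mk c g = DiffK.KHat1.mk c (DiffK.OddMap.blockSum c f g)) ∧
      ∃ D : DiffK.KHat1 c DiffK.Point DiffK.Point ≃+ AddCircle (1 : ℝ),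
        ∀ f : DiffK.OddMap Hp DiffK.Point DiffK.Point,
          DiffK.IsFredholmDet c (f.1 0).op
            ((AddCircle.toCircle (D (DiffK.KHat1.mk c f)) : Circle) : ℂ)) := by
  exact ⟨DiffK.exists_addCommGroup_KHat0_K0_point b, DiffK.exists_addCommGroup_KHat1_point c⟩
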